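/- Let $\alpha,\mu>0$ and consider the second-grade fluid equations on $\mathbb R^3$, $$\partial_t(\mathbf u-\alpha\Delta\mathbf u)-\mu\Delta\mathbf u+\operatorname{curl}(\mathbf u-\alpha\Delta\mathbf u)\times\mathbf u+\nabla p=0,\qquad \operatorname{div}\mathbf u=0,\qquad \mathbf u(0)=\mathbf u_0 .$$ **Notation.** $V=\{\mathbf v\in H^1(\mathbb R^3)^3:\operatorname{div}\mathbf v=0\}$ and $V_2=\{\mathbf v\in V:\operatorname{curl}(\mathbf v-\alpha\Delta\mathbf v)\in L^2(\mathbb R^3)^3\}\subset H^3(\mathbb R^3)^3$ (derivatives in the sense of distributions), with $$\|\mathbf v\|_{H^1_\alpha}^2=\|\mathbf v\|_{L^2}^2+\alpha\|\nabla\mathbf v\|_{L^2}^2,\qquad \|\mathbf v\|_{V_2}^2=\|\mathbf v\|_{H^1_\alpha}^2+\|\operatorname{curl}(\mathbf v-\alpha\Delta\mathbf v)\|_{L^2}^2 .$$ With $b(\mathbf u,\mathbf v,\mathbf w)=\sum_{i,j}\int u_j\,\partial_jv_i\,w_i\,dx$, a *weak solution* with initial value $\mathbf u_0\in V_2$ is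 a function $\mathbf u$ on $[0,\infty)$ with $\mathbf u\in L^\infty(0,T;V_2)$ and $\mathbf u'\in L^\infty(0,T;V)$ for every $T>0$, identified with its continuous representative, such that $\mathbf u(0)=\mathbf u_0$ and, for a.e. $t>0$ and every divergence-free $\phi\in C_c^\infty(\mathbb R^3)^3$, $$(\mathbf u',\phi)+\alpha(\nabla\mathbf u',\nabla\phi)+\mu(\nabla\mathbf u,\nabla\phi)+b(\mathbf u,\mathbf u,\phi)-\alpha\,b(\mathbf u,\Delta\mathbf u,\phi)+\alpha\,b(\phi,\Delta\mathbf u,\mathbf u)=0 .$$ For $\mathbf v\in L^2(\mathbb R^3)^3$, $r\in\mathbb R$ and $\rho>0$, with $\widehat{\mathbf v}(\xi)=\int e^{-i\xi\cdot x}\mathbf v(x)\,dx$, put $$Q_r(\mathbf v,\rho)=\rho^{-2r-3}\int_{|\xi|\le\rho}|\widehat{\mathbf v}(\xi)|^2d\xi,\qquad P_r(\mathbf v)_+=\limsup_{\rho\to0^+}Q_r(\mathbf v,\rho),\qquad A_r(\mathbf v)=\sup_{0<\rho\le1}Q_r(\mathbf v,\rho),$$ and let $r^*_+(\mathbf v)=\sup\{r\in\mathbb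 R:P_r(\mathbf v)_+<\infty\}\in[-\tfrac32,\infty]$ be the generalized upper decay character. **Theorem.** There is $\epsilon>0$, depending only on $\alpha$ and $\mu$, such that the following holds for every $\mathbf u_0\in V_2$ with $\|\mathbf u_0\|_{V_2}<\epsilon$ and every weak solution $\mathbf u$ with initial value $\mathbf u_0$. Write $r^*_+=r^*_+(\mathbf u_0)$. Then $\mathbf u(t)\in H^1(\mathbb R^3)^3$ for all $t\ge0$, and: 1. If $r^*_+>1$, or if the supremum defining $r^*_+$ is attained (that is, $r^*_+<\infty$ and $P_{r^*_+}(\mathbf u_0)_+<\infty$), then $$\|\mathbf u(t)\|_{H^1_\alpha}^2\le C\,(t+1)^{-\min\{\frac32+r^*_+,\,\frac52\}}\qquad\text{for all }t\ge0,$$ where $C>0$ depends only on $\alpha$, $\mu$, $r^*_+$, $\|\mathbf u_0\|_{V_2}$ and the (then finite) quantity $A_{\min\{r^*_+,1\}}(\mathbf u_0)$. 2. In all cases, for every real $r<r^*_+$, $$\|\mathbf u(t)\|_{H^1_\alpha}^2\le C\,(t+1)^{-\min\{\frac32+r,\,\frac52\}}\qquad\text{for all }t\ge0,$$ where $C>0$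 depends only on $\alpha$, $\mu$, $r$, $\|\mathbf u_0\|_{V_2}$ and the finite quantity $A_{\min\{r,1\}}(\mathbf u_0)$. -/

import Mathlib

open MeasureTheory Filter Topology Set
open scoped ENNReal ContDiff FourierTransform InnerProductSpace Laplacian

namespace SecondGradeFluid

noncomputable section

/-- Euclidean three-space. -/
abbrev E3 : Type := EuclideanSpace ℝ (Fin 3)

/-- The space `L²(ℝ³)³` of real square-integrable vector fields. -/
abbrev L2V : Type := Lp E3 2 (volume : Measure E3)

/-- The `j`-th standard basis vector of `ℝ³`. -/
def basisVec (j : Fin 3) : E3 := EuclideanSpace.single j (1 : ℝ)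

/-! ### Classical derivatives, used on smooth test fields -/

/-- The classical partial derivative `∂ⱼ φ` of a scalar function. -/
def partialD (j : Fin 3) (φ : E3 → ℝ) (x : E3) : ℝ := fderiv ℝ φ x (basisVec j)

/-- The classical curl of a vector field. -/
def curl (ψ : E3 → E3) (x : E3) : E3 :=
  !₂[partialD 1 (fun y => ψ y 2) x - partialD 2 (fun y => ψ y 1) x,
     partialD 2 (fun y => ψ y 0) x - partialD 0 (fun y => ψ y 2) x,
     partialD 0 (fun y => ψ y 1) x - partialD 1 (fun y => ψ y 0) x]

/-- Vector test fields: `C_c^∞(ℝ³)³`. -/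
def IsTestField (φ : E3 → E3) : Prop := ContDiff ℝ ∞ φ ∧ HasCompactSupport φ

/-- Divergence-free (solenoidal) test fields. -/
def IsSolenoidalTestField (φ : E3 → E3) : Prop :=
  IsTestField φ ∧ ∀ x, ∑ i, partialD i (fun y => φ y i) x = 0

/-! ### Weak derivatives and the function spaces -/

/-- `g` is the weak (distributional) partial derivative `∂ⱼ f` on `ℝ³`. -/
def HasWeakPartial (j : Fin 3) (f g : E3 → ℝ) : Prop :=
  LocallyIntegrable f volume ∧ LocallyIntegrable g volume ∧
    ∀ φ : E3 → ℝ, ContDiff ℝ ∞ φ → HasCompactSupport φ →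
      ∫ x, f x * partialD j φ x = - ∫ x, g x * φ x

open Classical in
/-- The weak partial derivative `∂ⱼ f`, unique up to null sets where it exists (and `0` by
convention where it does not). -/
def weakPartial (j : Fin 3) (f : E3 → ℝ) : E3 → ℝ :=
  if h : ∃ g, HasWeakPartial j f g then h.choose else 0

/-- The weak Laplacian of a vector field, `(Δ v)ᵢ = ∑ₖ ∂ₖ ∂ₖ vᵢ`. -/
def weakLaplacian (v : E3 → E3) (x : E3) : E3 :=
  WithLp.toLp 2 fun i => ∑ k, weakPartial k (weakPartial k fun y => v y i) x

/-- Membership in `H¹(ℝ³)³`. -/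
def MemH1 (v : E3 → E3) : Prop :=
  MemLp v 2 volume ∧
    ∀ i j, ∃ g : E3 → ℝ, MemLp g 2 volume ∧ HasWeakPartial j (fun x => v x i) g

/-- Membership in `V(ℝ³)`, the divergence-free fields of `H¹(ℝ³)³`. -/
def MemV (v : E3 → E3) : Prop :=
  MemH1 v ∧ ∀ᵐ x, ∑ i, weakPartial i (fun y => v y i) x = 0

/-- `curl (v - α Δ v) = g` in the sense of distributions. -/
def HasCurlStress (α : ℝ) (v g : E3 → E3) : Prop :=
  ∀ ψ : E3 → E3, IsTestField ψ →
    ∫ x, ⟪v x, curl ψ x - α • (Δ (curl ψ)) x⟫_ℝ = ∫ x, ⟪g x, ψ x⟫_ℝ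

/-- Membership in `V₂(ℝ³)`: the fields `v ∈ V(ℝ³)` with `curl (v - α Δ v) ∈ L²(ℝ³)³`. -/
def MemV2 (α : ℝ) (v : E3 → E3) : Prop :=
  MemV v ∧ ∃ g : E3 → E3, MemLp g 2 volume ∧ HasCurlStress α v g

open Classical in
/-- The field `curl (v - α Δ v)`, when it is in `L²(ℝ³)³` (and `0` by convention when not). -/
def curlStress (α : ℝ) (v : E3 → E3) : E3 → E3 :=
  if h : ∃ g : E3 → E3, MemLp g 2 volume ∧ HasCurlStress α v g then h.choose else 0

/-- `‖v‖²_{L²}`. -/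
def sqNormL2 (v : E3 → E3) : ℝ := ∫ x, ‖v x‖ ^ 2

/-- `‖∇ v‖²_{L²}`. -/
def sqNormGrad (v : E3 → E3) : ℝ :=
  ∫ x, ∑ i, ∑ j, weakPartial j (fun y => v y i) x ^ 2

/-- `‖v‖²_{H¹_α} = ‖v‖²_{L²} + α ‖∇ v‖²_{L²}`. -/
def sqNormH1 (α : ℝ) (v : E3 → E3) : ℝ := sqNormL2 v + α * sqNormGrad v

/-- The norm of `V₂(ℝ³)`,
`‖v‖²_{V₂} = ‖v‖²_{L²} + α ‖∇ v‖²_{L²} + ‖curl (v - α Δ v)‖²_{L²}`. -/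
def normV2 (α : ℝ) (v : E3 → E3) : ℝ :=
  Real.sqrt (sqNormL2 v + α * sqNormGrad v + sqNormL2 (curlStress α v))

/-! ### Weak solutions -/

/-- `(u, v)`, the `L²` inner product. -/
def pairL2 (u v : E3 → E3) : ℝ := ∫ x, ⟪u x, v x⟫_ℝ

/-- `(∇ u, ∇ φ)` for a test field `φ`. -/
def pairGrad (u φ : E3 → E3) : ℝ :=
  ∫ x, ∑ i, ∑ j, weakPartial j (fun y => u y i) x * partialD j (fun y => φ y i) x

/-- The trilinear form `b(u, v, w) = ∑ᵢⱼ ∫ uⱼ (∂ⱼ vᵢ) wᵢ dx`. -/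
def trilinear (u v w : E3 → E3) : ℝ :=
  ∫ x, ∑ i, ∑ j, u x j * weakPartial j (fun y => v y i) x * w x i

/-- `u` is a (global in time) weak solution, with initial value `u₀`, of
`∂ₜ(u - αΔu) - μΔu + curl(u - αΔu) × u + ∇p = 0`, `div u = 0`:
for every `T`, `u ∈ L^∞(0,T; V₂)` has a weak time derivative `u' ∈ L^∞(0,T; V)`, `u(0) = u₀`, and
the weak formulation holds for a.e. `t` against all solenoidal test fields.
A function with a bounded weak time derivative agrees a.e. with a unique continuous function, for
which `u(t) = u(0) + ∫₀ᵗ u'`; `u` denotes this representative, so `u(t)` makes sense for all `t`. -/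
def IsWeakSolution (α μ : ℝ) (u₀ : L2V) (u : ℝ → L2V) : Prop :=
  ∃ u' : ℝ → L2V,
    AEStronglyMeasurable u' (volume.restrict (Ioi (0 : ℝ))) ∧
    (∀ T > 0, ∃ M : ℝ, ∀ᵐ t ∂(volume.restrict (Ioo (0 : ℝ) T)),
      MemV2 α (u t) ∧ normV2 α (u t) ≤ M) ∧
    (∀ T > 0, ∃ M : ℝ, ∀ᵐ t ∂(volume.restrict (Ioo (0 : ℝ) T)),
      MemV (u' t) ∧ sqNormH1 1 (u' t) ≤ M) ∧
    (∀ t ≥ 0, u t = u₀ + ∫ s in (0 : ℝ)..t, u' s) ∧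
    (∀ᵐ t ∂(volume.restrict (Ioi (0 : ℝ))), ∀ φ : E3 → E3, IsSolenoidalTestField φ →
      pairL2 (u' t) φ + α * pairGrad (u' t) φ + μ * pairGrad (u t) φ
        + trilinear (u t) (u t) φ - α * trilinear (u t) (weakLaplacian (u t)) φ
        + α * trilinear φ (weakLaplacian (u t)) (u t) = 0)

/-! ### Decay characters -/

/-- The `i`-th component of the Fourier transform `v̂(ξ) = ∫ e^{-i ξ·x} v(x) dx` of `v ∈ L²(ℝ³)³`.
(The transform `𝓕` has the kernel `e^{-2πi ξ·x}`, hence the rescaling of the frequency.) -/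
def hat (v : L2V) (i : Fin 3) (ξ : E3) : ℂ :=
  (𝓕 ((Complex.ofRealCLM ∘L (EuclideanSpace.proj i : E3 →L[ℝ] ℝ)).compLp v :
    Lp ℂ 2 (volume : Measure E3)) : Lp ℂ 2 (volume : Measure E3)) ((2 * Real.pi)⁻¹ • ξ)

/-- `ρ^{-2r-3} ∫_{|ξ| ≤ ρ} |v̂(ξ)|² dξ`. -/
def decayQuotient (r : ℝ) (v : L2V) (ρ : ℝ) : ℝ≥0∞ :=
  ENNReal.ofReal (ρ ^ (-2 * r - 3)) * ∫⁻ ξ in Metric.closedBall (0 : E3) ρ, ∑ i, ‖hat v i ξ‖ₑ ^ 2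

/-- The generalized upper decay indicator `P_r(v)₊`. -/
def upperDecayIndicator (r : ℝ) (v : L2V) : ℝ≥0∞ :=
  limsup (decayQuotient r v) (𝓝[>] (0 : ℝ))

/-- The generalized upper decay character `r*₊(v) = sup {r ∈ ℝ : P_r(v)₊ < ∞}`, in `[-∞, ∞]`. -/
def upperDecayCharacter (v : L2V) : EReal :=
  sSup ((fun r : ℝ => (r : EReal)) '' {r : ℝ | upperDecayIndicator r v < ⊤})

/-- The supremum of `ρ^{-2r-3} ∫_{|ξ| ≤ ρ} |v̂(ξ)|² dξ` over `0 < ρ ≤ 1`. -/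
def decaySup (r : ℝ) (v : L2V) : ℝ≥0∞ :=
  ⨆ ρ ∈ Ioc (0 : ℝ) 1, decayQuotient r v ρ

/-- The exponent `min {3/2 + r, 5/2}`, equal to `5/2` for `r = ∞`. -/
def decayRate (r : EReal) : ℝ :=
  (min (((3 / 2 : ℝ) : EReal) + r) ((5 / 2 : ℝ) : EReal)).toReal

/-- The real number `min {r, 1}`, equal to `1` for `r = ∞`. -/
def truncOne (r : EReal) : ℝ := (min r 1).toReal

end

end SecondGradeFluid

open SecondGradeFluid

namespace SecondGradeFluid

noncomputable section

/-! The proof is Fourier splitting. Let E(t) be the energy ∫ (1 + 4π²α|ξ|²) |û|², which is the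
squared H¹_α norm by Plancherel. The inertial force does no work, so E' = -2μ‖∇u‖²
(`IsEvolution.energy_sub`). With s = t + T₀, the dissipation outside a ball of radius ρ of order
s^(-1/2) controls 3/s times the energy there (`MemH1.high_frequency_le`). Hence E' ≤ -(3/s)(E -
E_low), where E_low is the energy in |ξ| ≤ ρ, and E decays as fast as E_low permits, up to the rate
s^(-5/2).

Low frequencies change slowly because the nonlinearity is a divergence up to a gradient. It contains
third derivatives of u. Paired with a plane wave whose amplitude a satisfies a·ξ = 0, however, it
can be integrated by parts until only u and ∇u remain and every term carries a factor of ξ. It is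
therefore O(|ξ|(1+|ξ|)E), with no V₂ norm involved (`IsRegular.abs_inertia_wave_le`). Cauchy–Schwarz
on the ball, of volume of order ρ³, then gives E_low(t) ≤ 2 E_low(0) + Cρ⁵(∫₀ᵗ E)²
(`IsEvolution.lowEnergy_le`).

The decay character enters only through E_low(0) = O(ρ^(3+2r)), that is, s^(-(3/2+r)). The quadratic
term is s^(-5/2)(∫E)². Starting from E bounded, the integral grows like s, which gives the rate 1/2.
Then it grows like s^(1/2), which gives 3/2. Then it is bounded, which gives 5/2, the cap in the
theorem (`exists_decay_constant`).

Two points need care for weak solutions. In space, testing with the fields curl(χ e_l) shows that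
the residual of the equation is parallel to ξ for a.e. ξ, hence orthogonal to û (`weakForm_freq`);
this eliminates the pressure. A solenoidal field is recovered from its curl, so a V₂ field has three
square-integrable derivatives (`MemV2.exists_isRegular`). In time, u is only locally Lipschitz into
L², where the energy form is unbounded. Its truncations to |ξ| ≤ R are bounded there and obey the
chain rule (`bilinear_sub_eq_integral`). Letting R grow gives membership in H¹ at every time and the
energy equality. -/

/-! ### Functions as tempered distributions, and when they vanish. -/

open SchwartzMap LineDeriv in
theorem integral_fourier_mul_schwartz {f : E3 → ℂ} (hf : Integrable f) (g : 𝓢(E3, ℂ)) :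
    ∫ ξ, 𝓕 f ξ * g ξ = ∫ x, f x * 𝓕 g x := by
  simpa using! VectorFourier.integral_bilin_fourierIntegral_eq_flip (.mul ℂ ℂ) (L := innerₗ E3)
    Real.continuous_fourierChar continuous_inner hf g.integrable

theorem integral_fourier_mul_flip {f g : E3 → ℂ} (hf : Integrable f) (hg : Integrable g) :
    ∫ ξ, 𝓕 f ξ * g ξ = ∫ x, f x * 𝓕 g x := by
  simpa using! VectorFourier.integral_bilin_fourierIntegral_eq_flip (.mul ℂ ℂ) (L := innerₗ E3)
    Real.continuous_fourierChar continuous_inner hf hg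

/-- A measurable function whose product with every Schwartz function is integrable. -/
structure Tempered (h : E3 → ℂ) : Prop where
  aesm : AEStronglyMeasurable h volume
  integrable : ∀ g : SchwartzMap E3 ℂ, Integrable (fun ξ => h ξ * g ξ)

theorem Tempered.add {h k : E3 → ℂ} (hh : Tempered h) (hk : Tempered k) :
    Tempered (fun ξ => h ξ + k ξ) :=
  ⟨hh.1.add hk.1, fun g => by
    simpa only [add_mul] using! (hh.2 g).add (hk.2 g)⟩

theorem Tempered.mul {h p : E3 → ℂ} (hh : Tempered h) (hp : p.HasTemperateGrowth) :
    Tempered (fun ξ => p ξ * h ξ) :=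
  ⟨hp.1.continuous.aestronglyMeasurable.mul hh.1, fun g => by
    have := hh.2 (SchwartzMap.smulLeftCLM ℂ p g)
    simp only [SchwartzMap.smulLeftCLM_apply_apply hp, smul_eq_mul] at this
    refine this.congr (Eventually.of_forall fun x => ?_)
    simp only; ring⟩

theorem Tempered.const_mul {h : E3 → ℂ} (hh : Tempered h) (c : ℂ) :
    Tempered (fun ξ => c * h ξ) :=
  hh.mul (Function.HasTemperateGrowth.const c)

theorem tempered_of_memLp {h : E3 → ℂ} (hh : MemLp h 2 volume) : Tempered h :=
  ⟨hh.1, fun g => hh.integrable_mul (g.memLp 2)⟩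

theorem tempered_of_bounded {h : E3 → ℂ} (hm : AEStronglyMeasurable h volume) {C : ℝ}
    (hC : ∀ x, ‖h x‖ ≤ C) : Tempered h :=
  ⟨hm, fun g => g.integrable.bdd_mul hm (Eventually.of_forall hC)⟩

theorem Tempered.sum {ι : Type*} (s : Finset ι) {h : ι → E3 → ℂ} (hh : ∀ i ∈ s, Tempered (h i)) :
    Tempered (fun ξ => ∑ i ∈ s, h i ξ) :=
  ⟨by
    have := Finset.aestronglyMeasurable_sum s (fun i hi => (hh i hi).1)
    simpa [Finset.sum_fn] using! this, fun g => by
    simp only [Finset.sum_mul]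
    exact integrable_finsetSum s fun i hi => (hh i hi).2 g⟩

theorem Tempered.congr {h k : E3 → ℂ} (hh : Tempered h) (e : h =ᵐ[volume] k) : Tempered k :=
  ⟨hh.1.congr e, fun g => (hh.2 g).congr (by filter_upwards [e] with x hx; rw [hx])⟩

/-- A function with vanishing Fourier integral is zero almost everywhere. -/
theorem ae_eq_zero_of_fourier_eq_zero {k : E3 → ℂ} (hk : Integrable k) (h0 : ∀ y, 𝓕 k y = 0) :
    k =ᵐ[volume] 0 := by
  apply ae_eq_zero_of_integral_contDiff_smul_eq_zero hk.locallyIntegrable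
  intro θ hθ hc
  have h1 : HasCompactSupport (Complex.ofRealCLM ∘ θ) := hc.comp_left rfl
  have h2 : ContDiff ℝ ∞ (Complex.ofRealCLM ∘ θ) := by fun_prop
  set G : SchwartzMap E3 ℂ := 𝓕⁻ (h1.toSchwartzMap h2) with hG
  have h3 : ∀ x, 𝓕 G x = θ x := by
    intro x
    have : 𝓕 G = h1.toSchwartzMap h2 := by rw [hG]; simp
    rw [this]; simp
  have := integral_fourier_mul_schwartz hk G
  simp only [h0, zero_mul, integral_zero] at this
  rw [this]
  refine integral_congr_ae (Eventually.of_forall fun x => ?_)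
  simp only [h3]
  simp [mul_comm]

/-- The test condition: `g` is the inverse Fourier transform of a real test function. -/
def IsTestTransform (g : SchwartzMap E3 ℂ) : Prop :=
  HasCompactSupport (𝓕 g : SchwartzMap E3 ℂ) ∧ ∀ x, (𝓕 g x).im = 0

/-- A tempered function that is orthogonal to the inverse Fourier transforms of the real test
functions vanishes almost everywhere. -/
theorem Tempered.ae_eq_zero {h : E3 → ℂ} (hh : Tempered h)
    (H : ∀ g : SchwartzMap E3 ℂ, IsTestTransform g → ∫ ξ, h ξ * g ξ = 0) :
    h =ᵐ[volume] 0 := by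
  -- Translating the test function on the physical side multiplies `g` by a character. The
  -- hypothesis applied to all translates therefore says that the Fourier integral of `h * g` is
  -- identically zero.
  have key : ∀ g : SchwartzMap E3 ℂ, IsTestTransform g → ∀ᵐ ξ, h ξ * g ξ = 0 := by
    intro g hg
    apply ae_eq_zero_of_fourier_eq_zero (hh.2 g)
    intro y
    rw [Real.fourier_eq]
    set G : SchwartzMap E3 ℂ := 𝓕⁻ (SchwartzMap.compSubConstCLM ℂ (-y) (𝓕 g)) with hG
    have hFG : 𝓕 G = SchwartzMap.compSubConstCLM ℂ (-y) (𝓕 g) := by rw [hG]; simp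
    have hGT : IsTestTransform G := by
      refine ⟨?_, fun x => ?_⟩
      · rw [hFG]
        have := hg.1.comp_homeomorph (Homeomorph.addRight y)
        convert this using 1
        ext x; simp
      · rw [hFG]; simpa using hg.2 (x + y)
    have hval : ∀ ξ, G ξ = (Real.fourierChar (-(inner ℝ ξ y)) : ℂ) * g ξ := by
      intro ξ
      have e1 : 𝓕⁻ (𝓕 g : SchwartzMap E3 ℂ) = g := by simp
      have e2 : g ξ = 𝓕⁻ ((𝓕 g : SchwartzMap E3 ℂ) : E3 → ℂ) ξ := by
        conv_lhs => rw [← e1]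
        rw [SchwartzMap.fourierInv_coe]
      rw [hG, SchwartzMap.fourierInv_coe, e2, Real.fourierInv_eq, Real.fourierInv_eq,
        ← integral_const_mul]
      rw [← integral_sub_right_eq_self _ y]
      refine integral_congr_ae (Eventually.of_forall fun x => ?_)
      simp only [SchwartzMap.compSubConstCLM_apply, sub_neg_eq_add, sub_add_cancel,
        inner_sub_left, Circle.smul_def, smul_eq_mul]
      rw [sub_eq_add_neg, AddChar.map_add_eq_mul, real_inner_comm y ξ]
      push_cast; ring
    have := H G hGT
    rw [← this]
    refine integral_congr_ae (Eventually.of_forall fun x => ?_)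
    simp only [hval, Circle.smul_def, smul_eq_mul]
    ring
  -- It remains to find admissible `g` without zeros on a given ball. The transform of a nonnegative
  -- bump concentrated near 0 has positive real part there.
  have hex : ∀ n : ℕ, ∃ g : SchwartzMap E3 ℂ, IsTestTransform g ∧ ∀ ξ, ‖ξ‖ ≤ n → g ξ ≠ 0 := by
    intro n
    -- On the support |x| < 1/(8(n+1)), so for |ξ| ≤ n the phase 2π⟨x, ξ⟩ is at most π/4 and its
    -- cosine is nonnegative.
    let φ : ContDiffBump (0 : E3) := ⟨1 / (16 * (n + 1)), 1 / (8 * (n + 1)), by positivity, by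
      apply one_div_lt_one_div_of_lt <;> [positivity; nlinarith [(n.cast_nonneg : (0 : ℝ) ≤ n)]]⟩
    have h1 : HasCompactSupport (Complex.ofRealCLM ∘ φ) := φ.hasCompactSupport.comp_left rfl
    have h2 : ContDiff ℝ ∞ (Complex.ofRealCLM ∘ φ) :=
      Complex.ofRealCLM.contDiff.comp φ.contDiff
    set G : SchwartzMap E3 ℂ := 𝓕⁻ (h1.toSchwartzMap h2) with hG
    have hFG : 𝓕 G = h1.toSchwartzMap h2 := by rw [hG]; simp
    refine ⟨G, ⟨?_, fun x => ?_⟩, fun ξ hξ h0 => ?_⟩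
    · rw [hFG]; exact h1
    · rw [hFG]; simp
    · have hint : Integrable (fun x => (Real.fourierChar (inner ℝ x ξ) : ℂ) * (φ x : ℂ)) := by
        have := (Real.fourierIntegral_convergent_iff (μ := (volume : Measure E3)) (-ξ)).2
          (h1.toSchwartzMap h2).integrable
        simpa [Circle.smul_def] using this
      have hre : (G ξ).re = ∫ x, Real.cos (2 * Real.pi * inner ℝ x ξ) * φ x := by
        rw [hG, SchwartzMap.fourierInv_coe, Real.fourierInv_eq]
        have : ∀ x, Real.fourierChar (inner ℝ x ξ) • (h1.toSchwartzMap h2) x =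
            (Real.fourierChar (inner ℝ x ξ) : ℂ) * (φ x : ℂ) := fun x => by
          simp [Circle.smul_def]
        simp only [this]
        have h3 := integral_re hint
        simp only [RCLike.re_to_complex] at h3
        rw [← h3]
        refine integral_congr_ae (Eventually.of_forall fun x => ?_)
        simp only [Complex.re_mul_ofReal, Real.fourierChar_apply]
        congr 1
        rw [Complex.exp_ofReal_mul_I_re]
      have hpos : 0 < ∫ x, Real.cos (2 * Real.pi * inner ℝ x ξ) * φ x := by
        have hc : Continuous fun x => Real.cos (2 * Real.pi * inner ℝ x ξ) * φ x :=
          (by fun_prop : Continuous fun x : E3 => Real.cos (2 * Real.pi * inner ℝ x ξ)).mul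
            φ.continuous
        refine hc.integral_pos_of_hasCompactSupport_nonneg_nonzero
          φ.hasCompactSupport.mul_left (fun x => ?_) (x := 0) ?_
        · by_cases hx : x ∈ Metric.ball (0 : E3) φ.rOut
          · refine mul_nonneg (Real.cos_nonneg_of_mem_Icc ?_) φ.nonneg
            have hx' : ‖x‖ < 1 / (8 * (n + 1)) := by
              have h6 : ‖x‖ < φ.rOut := by simpa using hx
              exact h6
            have hin : |inner ℝ x ξ| ≤ 1 / 8 := by
              refine (abs_real_inner_le_norm x ξ).trans ?_
              calc ‖x‖ * ‖ξ‖ ≤ 1 / (8 * (n + 1)) * (n + 1) := by gcongr; linarith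
                _ = 1 / 8 := by field_simp
            obtain ⟨h5, h6⟩ := abs_le.1 hin
            have := Real.pi_pos
            constructor <;> nlinarith
          · have : φ x = 0 := φ.zero_of_le_dist (by simpa using hx)
            simp [this]
        · have : φ 0 = 1 := φ.one_of_mem_closedBall (by simp [φ.rIn_pos.le])
          simp [this]
      rw [h0] at hre
      simp only [Complex.zero_re] at hre
      linarith
  choose g hg hgn using hex
  filter_upwards [ae_all_iff.2 fun n => key (g n) (hg n)] with ξ hξ
  obtain ⟨n, hn⟩ := exists_nat_ge ‖ξ‖
  exact (mul_eq_zero.1 (hξ n)).resolve_right (hgn n ξ hn)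

/-! ### The L² transform of real functions and its pairing with test functions. -/

open Classical in
/-- The Fourier transform of a real square-integrable function (and `0` otherwise). -/
def ft (f : E3 → ℝ) : E3 → ℂ :=
  if h : MemLp (fun x => (f x : ℂ)) 2 volume then
    (𝓕 (h.toLp _) : Lp ℂ 2 (volume : Measure E3)) else 0

theorem ft_eq {f : E3 → ℝ} (hf : MemLp f 2 volume) :
    ft f = (𝓕 (hf.ofReal (K := ℂ)).toLp : Lp ℂ 2 (volume : Measure E3)) := by
  have : MemLp (fun x => (f x : ℂ)) 2 volume := hf.ofReal (K := ℂ)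
  simp [ft, this]

theorem memLp_ft (f : E3 → ℝ) : MemLp (ft f) 2 volume := by
  unfold ft
  split_ifs
  · exact Lp.memLp _
  · exact MemLp.zero

/-- The L² transform is not given by an integral, so the multiplication formula is read off from its
agreement with the transform of tempered distributions. -/
theorem Lp_integral_fourier_mul (F : Lp ℂ 2 (volume : Measure E3)) (g : SchwartzMap E3 ℂ) :
    ∫ ξ, (𝓕 F : Lp ℂ 2 (volume : Measure E3)) ξ * g ξ = ∫ x, F x * 𝓕 g x := by
  have h := congrArg (fun T => T g) (Lp.fourier_toTemperedDistribution_eq F)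
  simp only [TemperedDistribution.fourier_apply, Lp.toTemperedDistribution_apply,
    smul_eq_mul] at h
  simp only [mul_comm _ (g _), mul_comm _ (𝓕 g _)]
  exact h.symm

theorem integral_ft_mul {f : E3 → ℝ} (hf : MemLp f 2 volume) (g : SchwartzMap E3 ℂ) :
    ∫ ξ, ft f ξ * g ξ = ∫ x, (f x : ℂ) * 𝓕 g x := by
  rw [ft_eq hf, Lp_integral_fourier_mul]
  refine integral_congr_ae ?_
  filter_upwards [(hf.ofReal (K := ℂ)).coeFn_toLp] with x hx
  rw [hx]; rfl

theorem ft_congr {f g : E3 → ℝ} (h : f =ᵐ[volume] g) : ft f = ft g := by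
  by_cases hf : MemLp f 2 volume
  · have hg : MemLp g 2 volume := hf.ae_eq h
    rw [ft_eq hf, ft_eq hg]
    have : (hf.ofReal (K := ℂ)).toLp = (hg.ofReal (K := ℂ)).toLp := by
      refine MemLp.toLp_congr _ _ ?_
      filter_upwards [h] with x hx
      rw [hx]
    rw [this]
  · have hg : ¬ MemLp g 2 volume := fun hg => hf (hg.ae_eq h.symm)
    have a1 : ¬ MemLp (fun x => (f x : ℂ)) 2 volume := fun h => hf (by simpa using h.re)
    have a2 : ¬ MemLp (fun x => (g x : ℂ)) 2 volume := fun h => hg (by simpa using h.re)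
    simp [ft, a1, a2]

/-- Plancherel's identity for real functions. -/
theorem integral_mul_eq_re_ft {f g : E3 → ℝ} (hf : MemLp f 2 volume) (hg : MemLp g 2 volume) :
    ∫ x, f x * g x = ∫ ξ, ((starRingEnd ℂ) (ft f ξ) * ft g ξ).re := by
  have h := Lp.inner_fourier_eq (hf.ofReal (K := ℂ)).toLp (hg.ofReal (K := ℂ)).toLp
  rw [L2.inner_def, L2.inner_def, ← ft_eq hf, ← ft_eq hg] at h
  have e : ∫ x, inner ℂ ((hf.ofReal (K := ℂ)).toLp _ x) ((hg.ofReal (K := ℂ)).toLp _ x)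
      = ((∫ x, f x * g x : ℝ) : ℂ) := by
    rw [← integral_complex_ofReal]
    refine integral_congr_ae ?_
    filter_upwards [(hf.ofReal (K := ℂ)).coeFn_toLp, (hg.ofReal (K := ℂ)).coeFn_toLp] with x h1 h2
    rw [h1, h2]; simp [mul_comm]
  rw [e] at h
  have h' := congrArg Complex.re h
  rw [Complex.ofReal_re] at h'
  rw [← h']
  have hint : Integrable fun ξ => (inner ℂ (ft f ξ) (ft g ξ) : ℂ) := by
    simp only [RCLike.inner_apply']
    exact (memLp_ft f).star.integrable_mul (memLp_ft g)
  have h3 := integral_re hint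
  simp only [RCLike.re_to_complex] at h3
  rw [← h3]
  simp [mul_comm]

/-- `χ` is a real test function and `g` is its inverse Fourier transform. -/
def IsTestPair (χ : E3 → ℝ) (g : SchwartzMap E3 ℂ) : Prop :=
  ContDiff ℝ ∞ χ ∧ HasCompactSupport χ ∧ ∀ x, (χ x : ℂ) = 𝓕 g x

theorem IsTestTransform.exists_pair {g : SchwartzMap E3 ℂ} (hg : IsTestTransform g) :
    ∃ χ, IsTestPair χ g := by
  refine ⟨fun x => (𝓕 g x).re, ?_, ?_, fun x => ?_⟩
  · exact Complex.reCLM.contDiff.comp (𝓕 g).smooth'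
  · exact hg.1.comp_left (g := Complex.re) rfl
  · apply Complex.ext <;> simp [hg.2 x]

theorem exists_testPair {χ : E3 → ℝ} (h1 : ContDiff ℝ ∞ χ) (h2 : HasCompactSupport χ) :
    ∃ g, IsTestPair χ g := by
  have h3 : HasCompactSupport (Complex.ofRealCLM ∘ χ) := h2.comp_left rfl
  have h4 : ContDiff ℝ ∞ (Complex.ofRealCLM ∘ χ) := by fun_prop
  exact ⟨𝓕⁻ (h3.toSchwartzMap h4), h1, h2, fun x => by simp⟩

/-- Multiplication of a Schwartz function by `-2πi ξⱼ`. -/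
def mulFreq (j : Fin 3) (g : SchwartzMap E3 ℂ) : SchwartzMap E3 ℂ :=
  -(2 * Real.pi * Complex.I) • SchwartzMap.smulLeftCLM ℂ (inner ℝ · (basisVec j)) g

theorem mulFreq_apply (j : Fin 3) (g : SchwartzMap E3 ℂ) (ξ : E3) :
    mulFreq j g ξ = -(2 * Real.pi * Complex.I * ξ j) * g ξ := by
  have : (inner ℝ · (basisVec j) : E3 → ℝ).HasTemperateGrowth := by fun_prop
  have e : inner ℝ ξ (basisVec j) = ξ j := by simp [basisVec, PiLp.inner_apply]
  simp [mulFreq, this, e]; ring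

open LineDeriv in
theorem IsTestPair.partialD {χ : E3 → ℝ} {g : SchwartzMap E3 ℂ} (h : IsTestPair χ g) (j : Fin 3) :
    IsTestPair (partialD j χ) (mulFreq j g) := by
  refine ⟨?_, ?_, fun x => ?_⟩
  · unfold SecondGradeFluid.partialD
    exact (h.1.fderiv_right (m := ∞) le_rfl).clm_apply contDiff_const
  · exact h.2.1.fderiv_apply (𝕜 := ℝ) (basisVec j)
  · rw [mulFreq, ← SchwartzMap.lineDerivOp_fourier_eq, SchwartzMap.lineDerivOp_apply_eq_fderiv]
    have e2 : ((𝓕 g : SchwartzMap E3 ℂ) : E3 → ℂ) = Complex.ofRealCLM ∘ χ := by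
      ext y; exact (h.2.2 y).symm
    rw [e2, fderiv_comp _ Complex.ofRealCLM.differentiableAt
      (h.1.differentiable (by simp)).differentiableAt]
    simp [SecondGradeFluid.partialD]

/-- This is the bridge used throughout: an identity tested against real `χ` becomes an identity
between transforms, to which `Tempered.ae_eq_zero` applies. -/
theorem IsTestPair.integral_ft {χ : E3 → ℝ} {g : SchwartzMap E3 ℂ} (h : IsTestPair χ g)
    {f : E3 → ℝ} (hf : MemLp f 2 volume) :
    ∫ ξ, ft f ξ * g ξ = ((∫ x, f x * χ x : ℝ) : ℂ) := by
  rw [integral_ft_mul hf, ← integral_complex_ofReal]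
  refine integral_congr_ae (Eventually.of_forall fun x => ?_)
  simp [h.2.2 x]

/-! ### Square-integrable weak derivatives. -/

/-- `f` and `g` are square-integrable and `g` is the weak partial derivative `∂ⱼ f`. -/
structure IsWD (j : Fin 3) (f g : E3 → ℝ) : Prop where
  left : MemLp f 2 volume
  right : MemLp g 2 volume
  weak : HasWeakPartial j f g

/-- Testing with `χ` turns the weak derivative into multiplication of the test transform by -2πiξⱼ.
The difference of the two sides then annihilates all test transforms. -/
theorem IsWD.ft_eq {j : Fin 3} {f g : E3 → ℝ} (h : IsWD j f g) :
    ∀ᵐ ξ, ft g ξ = 2 * Real.pi * Complex.I * ξ j * ft f ξ := by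
  have hp : (fun ξ : E3 => -(2 * Real.pi * Complex.I * ξ j) : E3 → ℂ).HasTemperateGrowth := by
    have h1 : (fun ξ : E3 => ((ξ j : ℝ) : ℂ)).HasTemperateGrowth :=
      (Complex.ofRealCLM ∘L (EuclideanSpace.proj j : E3 →L[ℝ] ℝ)).hasTemperateGrowth
    exact ((Function.HasTemperateGrowth.const (2 * Real.pi * Complex.I : ℂ)).mul h1).neg
  have hT := (tempered_of_memLp (memLp_ft g)).add ((tempered_of_memLp (memLp_ft f)).mul hp)
  have := hT.ae_eq_zero ?_
  · filter_upwards [this] with ξ hξ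
    simp only [Pi.zero_apply] at hξ
    linear_combination hξ
  intro φ hφ
  obtain ⟨χ, hχ⟩ := hφ.exists_pair
  have e1 := hχ.integral_ft h.right
  have e2 := (hχ.partialD j).integral_ft h.left
  rw [h.weak.2.2 χ hχ.1 hχ.2.1] at e2
  simp only [add_mul]
  rw [integral_add ((tempered_of_memLp (memLp_ft g)).2 φ)
    (((tempered_of_memLp (memLp_ft f)).mul hp).2 φ), e1]
  simp only [mulFreq_apply] at e2
  have e3 : ∫ ξ, -(2 * Real.pi * Complex.I * ξ j) * ft f ξ * φ ξ =
    ∫ ξ, ft f ξ * (-(2 * Real.pi * Complex.I * ξ j) * φ ξ) := by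
    congr 1; ext ξ; ring
  rw [e3, e2]
  push_cast; ring

/-- The candidate is the real part of the inverse transform of 2πiξⱼ f̂. Since test functions are
real, taking real parts in the tested identity loses nothing, and it need not be shown that the
imaginary part vanishes. -/
theorem exists_isWD {j : Fin 3} {f : E3 → ℝ} (hf : MemLp f 2 volume)
    (h : MemLp (fun ξ : E3 => (ξ j : ℂ) * ft f ξ) 2 volume) : ∃ g, IsWD j f g := by
  have hk := h.const_mul (2 * Real.pi * Complex.I)
  set K : Lp ℂ 2 (volume : Measure E3) := 𝓕⁻ hk.toLp with hK
  have hre : MemLp (fun x => (K x).re) 2 volume := (Lp.memLp K).re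
  refine ⟨fun x => (K x).re, hf, hre, hf.locallyIntegrable one_le_two,
    hre.locallyIntegrable one_le_two, fun χ h1 h2 => ?_⟩
  obtain ⟨g, hg⟩ := exists_testPair h1 h2
  have e1 := (hg.partialD j).integral_ft hf
  have e2 := Lp_integral_fourier_mul K g
  have e3 : 𝓕 K = hk.toLp := by rw [hK]; exact FourierTransform.fourier_fourierInv_eq _
  rw [e3] at e2
  have e4 : ∫ ξ, hk.toLp _ ξ * g ξ = - ∫ ξ, ft f ξ * mulFreq j g ξ := by
    rw [← integral_neg]
    refine integral_congr_ae ?_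
    filter_upwards [hk.coeFn_toLp] with ξ hξ
    rw [hξ, mulFreq_apply]; ring
  rw [e4, e1] at e2
  have hint : Integrable fun x => K x * 𝓕 g x := (Lp.memLp K).integrable_mul ((𝓕 g).memLp 2)
  have h3 := integral_re hint
  simp only [RCLike.re_to_complex] at h3
  have e5 := congrArg Complex.re e2
  rw [← h3] at e5
  simp only [← hg.2.2, Complex.re_mul_ofReal] at e5
  rw [← e5]
  simp [SecondGradeFluid.partialD]

/-- Integration by parts for two functions of `H¹`. -/
theorem IsWD.integral_mul {j : Fin 3} {f f' g g' : E3 → ℝ} (hf : IsWD j f f') (hg : IsWD j g g') :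
    ∫ x, f x * g' x = - ∫ x, f' x * g x := by
  rw [integral_mul_eq_re_ft hf.left hg.right, integral_mul_eq_re_ft hf.right hg.left,
    ← integral_neg]
  refine integral_congr_ae ?_
  filter_upwards [hf.ft_eq, hg.ft_eq] with ξ h1 h2
  rw [h1, h2]
  simp
  ring

/-- Fourier inversion for a square-integrable function with integrable transform. -/
theorem ae_eq_fourierInv_ft {f : E3 → ℝ} (hf : MemLp f 2 volume) (hi : Integrable (ft f)) :
    ∀ᵐ x, (f x : ℂ) = 𝓕⁻ (ft f) x := by
  have hc : Continuous (𝓕⁻ (ft f)) := by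
    have : Continuous (𝓕 (ft f)) := VectorFourier.fourierIntegral_continuous
      Real.continuous_fourierChar (by exact continuous_inner) hi
    have e : 𝓕⁻ (ft f) = fun x => 𝓕 (ft f) (-x) := by
      ext x; exact Real.fourierInv_eq_fourier_neg _ _
    rw [e]; exact this.comp continuous_neg
  refine ae_eq_of_integral_contDiff_smul_eq ?_ hc.locallyIntegrable ?_
  · exact (hf.ofReal (K := ℂ)).locallyIntegrable one_le_two
  intro χ h1 h2
  obtain ⟨g, hg⟩ := exists_testPair h1 h2
  have e1 := integral_ft_mul hf g
  have e2 := integral_fourier_mul_schwartz hi (𝓕⁻ g)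
  simp only [FourierTransform.fourier_fourierInv_eq] at e2
  rw [e1] at e2
  rw [← integral_neg_eq_self] at e2
  simp only [Complex.real_smul, hg.2.2, mul_comm (𝓕 g _)]
  rw [← e2]
  refine integral_congr_ae (Eventually.of_forall fun x => ?_)
  simp only
  rw [Real.fourierInv_eq_fourier_neg, SchwartzMap.fourierInv_coe, Real.fourierInv_eq_fourier_neg,
    neg_neg]
  rfl

theorem HasWeakPartial.ae_unique {j : Fin 3} {f g g' : E3 → ℝ} (h : HasWeakPartial j f g)
    (h' : HasWeakPartial j f g') : g =ᵐ[volume] g' := by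
  refine ae_eq_of_integral_contDiff_smul_eq h.2.1 h'.2.1 fun χ h1 h2 => ?_
  have e1 := h.2.2 χ h1 h2
  have e2 := h'.2.2 χ h1 h2
  simp only [smul_eq_mul, mul_comm (χ _)]
  linarith

theorem HasWeakPartial.congr {j : Fin 3} {f f' g g' : E3 → ℝ} (h : HasWeakPartial j f g)
    (hf : f =ᵐ[volume] f') (hg : g =ᵐ[volume] g') : HasWeakPartial j f' g' := by
  refine ⟨h.1.congr hf, h.2.1.congr hg, fun χ h1 h2 => ?_⟩
  have e1 : ∫ x, f' x * partialD j χ x = ∫ x, f x * partialD j χ x :=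
    integral_congr_ae (by filter_upwards [hf] with x hx; rw [hx])
  have e2 : ∫ x, g' x * χ x = ∫ x, g x * χ x :=
    integral_congr_ae (by filter_upwards [hg] with x hx; rw [hx])
  rw [e1, e2, h.2.2 χ h1 h2]

/-- `weakPartial` is an arbitrary choice, so uniqueness of weak derivatives is what lets it be
replaced by a concrete representative. -/
theorem HasWeakPartial.weakPartial_ae {j : Fin 3} {f f' g : E3 → ℝ} (h : HasWeakPartial j f g)
    (hf : f =ᵐ[volume] f') : weakPartial j f' =ᵐ[volume] g := by
  have h' : ∃ g, HasWeakPartial j f' g := ⟨g, h.congr hf .rfl⟩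
  rw [weakPartial, dif_pos h']
  exact h'.choose_spec.ae_unique (h.congr hf .rfl)

theorem partialD_mul {j : Fin 3} {φ χ : E3 → ℝ} (hφ : Differentiable ℝ φ)
    (hχ : Differentiable ℝ χ) (x : E3) :
    partialD j (fun y => φ y * χ y) x = partialD j φ x * χ x + φ x * partialD j χ x := by
  unfold partialD
  rw [fderiv_fun_mul (hφ x) (hχ x)]
  simp; ring

theorem continuous_partialD {j : Fin 3} {φ : E3 → ℝ} (hφ : ContDiff ℝ ∞ φ) :
    Continuous (partialD j φ) :=
  (hφ.continuous_fderiv (by simp)).clm_apply continuous_const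

theorem memLp_mul_bounded {f w : E3 → ℝ} (hf : MemLp f 2 volume) (hw : Continuous w) {C : ℝ}
    (hC : ∀ x, |w x| ≤ C) : MemLp (fun x => f x * w x) 2 volume := by
  refine hf.of_le_mul (c := C) (hf.1.mul hw.aestronglyMeasurable)
    (Eventually.of_forall fun x => ?_)
  rw [norm_mul, mul_comm, Real.norm_eq_abs, Real.norm_eq_abs]
  exact mul_le_mul_of_nonneg_right (hC x) (abs_nonneg _)

theorem memLp_test {χ : E3 → ℝ} (h1 : Continuous χ) (h2 : HasCompactSupport χ) :
    MemLp χ 2 volume := h1.memLp_of_hasCompactSupport h2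

/-- Product of an `H¹` function with a smooth function that is bounded with its derivative. -/
theorem IsWD.mul_smooth {j : Fin 3} {f g φ : E3 → ℝ} (h : IsWD j f g) (hφ : ContDiff ℝ ∞ φ)
    {C : ℝ} (hC : ∀ x, |φ x| ≤ C) (hC' : ∀ x, |partialD j φ x| ≤ C) :
    IsWD j (fun x => f x * φ x) (fun x => g x * φ x + f x * partialD j φ x) := by
  have m1 := memLp_mul_bounded h.left hφ.continuous hC
  have m2 := (memLp_mul_bounded h.right hφ.continuous hC).add
    (memLp_mul_bounded h.left (continuous_partialD hφ) hC')
  refine ⟨m1, m2, m1.locallyIntegrable one_le_two, m2.locallyIntegrable one_le_two,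
    fun χ h1 h2 => ?_⟩
  have h3 : ContDiff ℝ ∞ fun x => φ x * χ x := hφ.mul h1
  have h4 : HasCompactSupport fun x => φ x * χ x := h2.mul_left
  have e := h.weak.2.2 _ h3 h4
  have hd1 := hφ.differentiable (by simp)
  have hd2 := h1.differentiable (by simp)
  simp only [partialD_mul hd1 hd2] at e
  have i1 : Integrable fun x => f x * (partialD j φ x * χ x) :=
    h.left.integrable_mul (memLp_test ((continuous_partialD hφ).mul h1.continuous) h2.mul_left)
  have i2 : Integrable fun x => f x * (φ x * partialD j χ x) :=
    h.left.integrable_mul (memLp_test (hφ.continuous.mul (continuous_partialD h1))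
      (h2.fderiv_apply (𝕜 := ℝ) (basisVec j)).mul_left)
  have i3 : Integrable fun x => g x * (φ x * χ x) :=
    h.right.integrable_mul (memLp_test (hφ.continuous.mul h1.continuous) h2.mul_left)
  simp only [mul_add] at e
  rw [integral_add i1 i2] at e
  simp only [add_mul, mul_assoc]
  rw [integral_add i3 i1]
  linarith

/-- Product of two `H¹` functions, when it is again in `H¹`. -/
theorem IsWD.mul {j : Fin 3} {f f' g g' : E3 → ℝ} (hf : IsWD j f f') (hg : IsWD j g g')
    (m1 : MemLp (fun x => f x * g x) 2 volume)
    (m2 : MemLp (fun x => f' x * g x + f x * g' x) 2 volume) :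
    IsWD j (fun x => f x * g x) (fun x => f' x * g x + f x * g' x) := by
  refine ⟨m1, m2, m1.locallyIntegrable one_le_two, m2.locallyIntegrable one_le_two,
    fun χ h1 h2 => ?_⟩
  have h2' := h2.fderiv_apply (𝕜 := ℝ) (basisVec j)
  obtain ⟨C, hC⟩ := h1.continuous.bounded_above_of_compact_support h2
  obtain ⟨C', hC'⟩ := (continuous_partialD (j := j) h1).bounded_above_of_compact_support h2'
  have k1 : ∀ x, |χ x| ≤ max C C' := fun x => (hC x).trans (le_max_left _ _)
  have k2 : ∀ x, |partialD j χ x| ≤ max C C' := fun x => (hC' x).trans (le_max_right _ _)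
  -- Attaching the test function to `g` keeps both factors in H¹, so the product rule reduces to
  -- integration by parts of `f` against `g χ`.
  have e := hf.integral_mul (hg.mul_smooth h1 k1 k2)
  have i1 : Integrable fun x => f x * (g' x * χ x) :=
    hf.left.integrable_mul (memLp_mul_bounded hg.right h1.continuous k1)
  have i2 : Integrable fun x => f x * (g x * partialD j χ x) :=
    hf.left.integrable_mul (memLp_mul_bounded hg.left (continuous_partialD h1) k2)
  have i3 : Integrable fun x => f' x * (g x * χ x) :=
    hf.right.integrable_mul (memLp_mul_bounded hg.left h1.continuous k1)
  simp only [mul_add] at e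
  rw [integral_add i1 i2] at e
  simp only [add_mul, mul_assoc]
  rw [integral_add i3 i1]
  linarith

/-! ### Plane waves and integration by parts against them. -/

/-- The plane wave `cos (2π ⟨x, ξ⟩ + θ)`. -/
def wave (ξ : E3) (θ : ℝ) (x : E3) : ℝ := Real.cos (2 * Real.pi * inner ℝ x ξ + θ)

theorem contDiff_wave (ξ : E3) (θ : ℝ) : ContDiff ℝ ∞ (wave ξ θ) :=
  Real.contDiff_cos.comp ((contDiff_const.mul (contDiff_id.inner ℝ contDiff_const)).add
    contDiff_const)

theorem abs_wave_le (ξ : E3) (θ : ℝ) (x : E3) : |wave ξ θ x| ≤ 1 := Real.abs_cos_le_one _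

/-- The free phase `θ` closes the family under differentiation: a derivative costs a factor 2πξⱼ and
shifts the phase by π/2. Bounds uniform in `θ` can thus be iterated. -/
theorem partialD_wave (j : Fin 3) (ξ : E3) (θ : ℝ) (x : E3) :
    partialD j (wave ξ θ) x = 2 * Real.pi * ξ j * wave ξ (θ + Real.pi / 2) x := by
  have h1 : HasFDerivAt (fun x : E3 => inner ℝ x ξ) (innerSL ℝ ξ) x := by
    have := (innerSL ℝ ξ).hasFDerivAt (x := x)
    simpa [real_inner_comm] using this
  have h2 := ((h1.const_mul (2 * Real.pi)).add_const θ).cos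
  unfold partialD
  have h3 : fderiv ℝ (wave ξ θ) x = _ := h2.fderiv
  rw [h3]
  have e : inner ℝ ξ (basisVec j) = ξ j := by simp [basisVec, PiLp.inner_apply]
  simp only [wave, ← add_assoc, Real.cos_add_pi_div_two]
  simp [e]
  ring

theorem IsWD.mul_wave {j : Fin 3} {f g : E3 → ℝ} (h : IsWD j f g) (ξ : E3) (θ : ℝ) :
    IsWD j (fun x => f x * wave ξ θ x)
      (fun x => g x * wave ξ θ x + f x * (2 * Real.pi * ξ j * wave ξ (θ + Real.pi / 2) x)) := by
  have := h.mul_smooth (contDiff_wave ξ θ) (C := max 1 (|2 * Real.pi * ξ j|))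
    (fun x => (abs_wave_le _ _ _).trans (le_max_left _ _)) (fun x => ?_)
  · simpa only [partialD_wave] using this
  · rw [partialD_wave, abs_mul]
    refine le_trans ?_ (le_max_right _ _)
    exact mul_le_of_le_one_right (abs_nonneg _) (abs_wave_le _ _ _)

/-- The integral `∫ f g cos (2π ⟨x, ξ⟩ + θ)`. -/
def waveInt (ξ : E3) (θ : ℝ) (f g : E3 → ℝ) : ℝ := ∫ x, f x * g x * wave ξ θ x

theorem waveInt_comm (ξ : E3) (θ : ℝ) (f g : E3 → ℝ) : waveInt ξ θ f g = waveInt ξ θ g f := by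
  simp only [waveInt, mul_comm (f _)]

theorem integrable_wave (ξ : E3) (θ : ℝ) {f g : E3 → ℝ} (hf : MemLp f 2 volume)
    (hg : MemLp g 2 volume) : Integrable fun x => f x * g x * wave ξ θ x :=
  (hf.integrable_mul hg).mul_bdd (c := 1)
    (contDiff_wave ξ θ).continuous.aestronglyMeasurable
    (Eventually.of_forall (abs_wave_le ξ θ))

theorem waveInt_sum {ι : Type*} (s : Finset ι) (ξ : E3) (θ : ℝ) {f : E3 → ℝ} {g : ι → E3 → ℝ}
    (hf : MemLp f 2 volume) (hg : ∀ i ∈ s, MemLp (g i) 2 volume) :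
    waveInt ξ θ f (fun x => ∑ i ∈ s, g i x) = ∑ i ∈ s, waveInt ξ θ f (g i) := by
  simp only [waveInt, Finset.mul_sum, Finset.sum_mul]
  exact integral_finsetSum _ fun i hi => integrable_wave ξ θ hf (hg i hi)

/-- Integration by parts against a plane wave. -/
theorem IsWD.waveInt_eq {j : Fin 3} {f f' g g' : E3 → ℝ} (hf : IsWD j f f') (hg : IsWD j g g')
    (ξ : E3) (θ : ℝ) :
    waveInt ξ θ f g' =
      -waveInt ξ θ f' g - 2 * Real.pi * ξ j * waveInt ξ (θ + Real.pi / 2) f g := by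
  have e := (hf.mul_wave ξ θ).integral_mul hg
  have e1 : ∫ x, f x * wave ξ θ x * g' x = waveInt ξ θ f g' := by
    simp only [waveInt]; congr 1; ext x; ring
  have e2 : ∫ x, (f' x * wave ξ θ x + f x * (2 * Real.pi * ξ j * wave ξ (θ + Real.pi / 2) x)) * g x
      = waveInt ξ θ f' g
        + 2 * Real.pi * ξ j * waveInt ξ (θ + Real.pi / 2) f g := by
    simp only [waveInt]
    rw [← integral_const_mul, ← integral_add (integrable_wave ξ θ hf.right hg.left)
      ((integrable_wave ξ _ hf.left hg.left).const_mul _)]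
    congr 1; ext x; ring
  rw [e1, e2] at e
  rw [e]; ring

theorem abs_waveInt_le (ξ : E3) (θ : ℝ) {f g : E3 → ℝ} (hf : MemLp f 2 volume)
    (hg : MemLp g 2 volume) {H : ℝ} (h1 : ∫ x, f x ^ 2 ≤ H) (h2 : ∫ x, g x ^ 2 ≤ H) :
    |waveInt ξ θ f g| ≤ H := by
  have i1 := hf.integrable_sq
  have i2 := hg.integrable_sq
  calc |waveInt ξ θ f g| ≤ ∫ x, (f x ^ 2 + g x ^ 2) / 2 := by
        unfold waveInt
        rw [← Real.norm_eq_abs]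
        refine norm_integral_le_of_norm_le ((i1.add i2).div_const 2)
          (Eventually.of_forall fun x => ?_)
        rw [norm_mul, norm_mul]
        simp only [Real.norm_eq_abs]
        have := abs_wave_le ξ θ x
        calc |f x| * |g x| * |wave ξ θ x| ≤ |f x| * |g x| :=
              mul_le_of_le_one_right (by positivity) this
          _ ≤ _ := by nlinarith [sq_nonneg (|f x| - |g x|), sq_abs (f x), sq_abs (g x)]
    _ = ((∫ x, f x ^ 2) + ∫ x, g x ^ 2) / 2 := by
        rw [integral_div, integral_add i1 i2]
    _ ≤ H := by linarith

/-! ### Cancellations in the inertial force at low frequency. -/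

/-- A divergence-free field `v` with `d i j = ∂ⱼ vᵢ`, `s i j k = ∂ₖ ∂ⱼ vᵢ`, `l i j = ∂ⱼ Δ vᵢ`,
all square-integrable. -/
structure IsRegular (v : Fin 3 → E3 → ℝ) (d : Fin 3 → Fin 3 → E3 → ℝ)
    (s : Fin 3 → Fin 3 → Fin 3 → E3 → ℝ) (l : Fin 3 → Fin 3 → E3 → ℝ) : Prop where
  wd_v : ∀ i j, IsWD j (v i) (d i j)
  wd_d : ∀ i j k, IsWD k (d i j) (s i j k)
  symm : ∀ i j k, s i j k =ᵐ[volume] s i k j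
  wd_lap : ∀ i j, IsWD j (fun x => ∑ k, s i k k x) (l i j)
  div : ∀ᵐ x, ∑ i, d i i x = 0

/-- The inertial force `v·∇v - α v·∇Δv + α ∑ₖ vₖ ∇Δvₖ`. -/
def inertia (α : ℝ) (v : Fin 3 → E3 → ℝ) (d l : Fin 3 → Fin 3 → E3 → ℝ) (i : Fin 3) (x : E3) : ℝ :=
  ∑ j, (v j x * d i j x - α * (v j x * l i j x) + α * (v j x * l j i x))

section

variable {α : ℝ} {v : Fin 3 → E3 → ℝ} {d : Fin 3 → Fin 3 → E3 → ℝ}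
  {s : Fin 3 → Fin 3 → Fin 3 → E3 → ℝ} {l : Fin 3 → Fin 3 → E3 → ℝ}

theorem IsRegular.memLp_v (h : IsRegular v d s l) (i : Fin 3) : MemLp (v i) 2 volume :=
  (h.wd_v i 0).left

theorem IsRegular.memLp_d (h : IsRegular v d s l) (i j : Fin 3) : MemLp (d i j) 2 volume :=
  (h.wd_v i j).right

theorem IsRegular.memLp_s (h : IsRegular v d s l) (i j k : Fin 3) : MemLp (s i j k) 2 volume :=
  (h.wd_d i j k).right

theorem IsRegular.memLp_l (h : IsRegular v d s l) (i j : Fin 3) : MemLp (l i j) 2 volume :=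
  (h.wd_lap i j).right

theorem IsRegular.integrable_inertia (h : IsRegular v d s l) (i : Fin 3) :
    Integrable (inertia α v d l i) :=
  integrable_finsetSum _ fun j _ =>
    (((h.memLp_v j).integrable_mul (h.memLp_d i j)).sub
      (((h.memLp_v j).integrable_mul (h.memLp_l i j)).const_mul α)).add
      (((h.memLp_v j).integrable_mul (h.memLp_l j i)).const_mul α)

theorem IsRegular.sum_waveInt_div (h : IsRegular v d s l) (ξ : E3) (θ : ℝ) {f : E3 → ℝ}
    (hf : MemLp f 2 volume) : ∑ j, waveInt ξ θ (d j j) f = 0 := by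
  simp only [waveInt_comm ξ θ _ f]
  rw [← waveInt_sum _ _ _ hf fun i _ => h.memLp_d i i]
  unfold waveInt
  rw [← integral_zero E3 ℝ]
  refine integral_congr_ae ?_
  filter_upwards [h.div] with x hx
  simp [hx]

/-- Since v is divergence-free, v·∇f is the divergence of f v, so the derivative falls on the wave
alone and produces a factor of ξ. -/
theorem IsRegular.convection_eq (h : IsRegular v d s l) (ξ : E3) (θ : ℝ) {f : E3 → ℝ}
    {g : Fin 3 → E3 → ℝ} (hg : ∀ j, IsWD j f (g j)) :
    ∑ j, waveInt ξ θ (v j) (g j) =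
      -∑ j, 2 * Real.pi * ξ j * waveInt ξ (θ + Real.pi / 2) (v j) f := by
  have e : ∀ j, waveInt ξ θ (v j) (g j) = _ := fun j => (h.wd_v j j).waveInt_eq (hg j) ξ θ
  simp only [e, Finset.sum_sub_distrib, Finset.sum_neg_distrib]
  rw [h.sum_waveInt_div ξ θ (hg 0).left]
  ring

/-- Moving one derivative off Δvᵢ leaves only vⱼ and first derivatives, which the H¹ energy
controls. -/
theorem IsRegular.elongation_eq (h : IsRegular v d s l) (ξ : E3) (θ : ℝ) (i j : Fin 3) :
    waveInt ξ θ (v j) (fun x => ∑ k, s i k k x) =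
      -∑ k, (waveInt ξ θ (d j k) (d i k)
        + 2 * Real.pi * ξ k * waveInt ξ (θ + Real.pi / 2) (v j) (d i k)) := by
  rw [waveInt_sum _ _ _ (h.memLp_v j) fun k _ => h.memLp_s i k k, ← Finset.sum_neg_distrib]
  refine Finset.sum_congr rfl fun k _ => ?_
  rw [(h.wd_v j k).waveInt_eq (h.wd_d i k k)]
  ring

/-- This term has no convective structure; the orthogonality of `a` to `ξ` replaces it. Whenever ∂ⱼ
lands on the wave, the factor ξⱼ is summed against aⱼ and vanishes. What survives carries a factor
ξₖ and two first derivatives. -/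
theorem IsRegular.stretch_eq (h : IsRegular v d s l) (ξ : E3) (θ : ℝ) {a : Fin 3 → ℝ}
    (ha : ∑ j, a j * ξ j = 0) (i : Fin 3) :
    ∑ j, a j * waveInt ξ θ (v i) (l i j) =
      ∑ j, ∑ k, a j * (2 * Real.pi * ξ k * waveInt ξ (θ + Real.pi / 2) (d i j) (d i k)) := by
  have hL : MemLp (fun x => ∑ k, s i k k x) 2 volume := (h.wd_lap i 0).left
  have e1 : ∑ j, a j * waveInt ξ θ (v i) (l i j)
      = -∑ j, a j * waveInt ξ θ (d i j) (fun x => ∑ k, s i k k x) := by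
    have e : ∀ j, waveInt ξ θ (v i) (l i j) = _ := fun j => (h.wd_v i j).waveInt_eq (h.wd_lap i j) ξ θ
    have z : ∑ j, a j * (2 * Real.pi * ξ j *
        waveInt ξ (θ + Real.pi / 2) (v i) (fun x => ∑ k, s i k k x)) = 0 := by
      have : ∀ j, a j * (2 * Real.pi * ξ j *
        waveInt ξ (θ + Real.pi / 2) (v i) (fun x => ∑ k, s i k k x)) = a j * ξ j *
        (2 * Real.pi * waveInt ξ (θ + Real.pi / 2) (v i) (fun x => ∑ k, s i k k x)) :=
        fun j => by ring
      simp only [this]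
      rw [← Finset.sum_mul, ha, zero_mul]
    simp only [e, mul_sub, Finset.sum_sub_distrib]
    rw [z, sub_zero, ← Finset.sum_neg_distrib]
    exact Finset.sum_congr rfl fun j _ => by ring
  -- By symmetry of second derivatives, ∂ₖ∂ⱼvᵢ ∂ₖvᵢ is half of ∂ⱼ(∂ₖvᵢ)². Integrating by parts turns
  -- it into a multiple of a·ξ = 0.
  have e2 : ∀ k, ∑ j, a j * waveInt ξ θ (s i j k) (d i k) = 0 := by
    intro k
    have q : ∀ j, 2 * waveInt ξ θ (s i j k) (d i k)
        = - (2 * Real.pi * ξ j * waveInt ξ (θ + Real.pi / 2) (d i k) (d i k)) := by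
      intro j
      have c : waveInt ξ θ (s i j k) (d i k) = waveInt ξ θ (s i k j) (d i k) := by
        refine integral_congr_ae ?_
        filter_upwards [h.symm i j k] with x hx
        rw [hx]
      have := (h.wd_d i k j).waveInt_eq (h.wd_d i k j) ξ θ
      rw [waveInt_comm ξ θ (d i k) (s i k j)] at this
      rw [c]; linarith
    have : 2 * ∑ j, a j * waveInt ξ θ (s i j k) (d i k) = -(∑ j, a j * ξ j) *
        (2 * Real.pi * waveInt ξ (θ + Real.pi / 2) (d i k) (d i k)) := by
      rw [Finset.mul_sum, ← Finset.sum_neg_distrib, Finset.sum_mul]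
      refine Finset.sum_congr rfl fun j _ => ?_
      linear_combination a j * q j
    rw [ha] at this
    linarith
  have e3 : ∀ j k, waveInt ξ θ (d i j) (s i k k) = -waveInt ξ θ (s i j k) (d i k)
      - 2 * Real.pi * ξ k * waveInt ξ (θ + Real.pi / 2) (d i j) (d i k) :=
    fun j k => (h.wd_d i j k).waveInt_eq (h.wd_d i k k) ξ θ
  have e4 : ∑ j, ∑ k, a j * waveInt ξ θ (s i j k) (d i k) = 0 := by
    rw [Finset.sum_comm]; exact Finset.sum_eq_zero fun k _ => e2 k
  rw [e1]
  have e5 : ∀ j, a j * waveInt ξ θ (d i j) (fun x => ∑ k, s i k k x) =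
      -∑ k, a j * waveInt ξ θ (s i j k) (d i k) - ∑ k, a j * (2 * Real.pi * ξ k *
        waveInt ξ (θ + Real.pi / 2) (d i j) (d i k)) := by
    intro j
    rw [waveInt_sum _ _ _ (h.memLp_d i j) fun k _ => h.memLp_s i k k, Finset.mul_sum,
      ← Finset.sum_neg_distrib, ← Finset.sum_sub_distrib]
    refine Finset.sum_congr rfl fun k _ => ?_
    rw [e3]; ring
  simp only [e5, Finset.sum_sub_distrib, Finset.sum_neg_distrib, e4]
  ring

theorem IsRegular.integral_inertia_wave (h : IsRegular v d s l) (ξ : E3) (θ : ℝ) (a : Fin 3 → ℝ) :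
    ∑ i, a i * ∫ x, inertia α v d l i x * wave ξ θ x =
      ∑ i, a i * ∑ j, waveInt ξ θ (v j) (d i j) - α * ∑ i, a i * ∑ j, waveInt ξ θ (v j) (l i j)
        + α * ∑ i, ∑ j, a j * waveInt ξ θ (v i) (l i j) := by
  have e : ∀ i, ∫ x, inertia α v d l i x * wave ξ θ x = ∑ j, (waveInt ξ θ (v j) (d i j)
      - α * waveInt ξ θ (v j) (l i j) + α * waveInt ξ θ (v j) (l j i)) := by
    intro i
    have i1 := fun j => integrable_wave ξ θ (h.memLp_v j) (h.memLp_d i j)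
    have i2 := fun j => (integrable_wave ξ θ (h.memLp_v j) (h.memLp_l i j)).const_mul α
    have i3 := fun j => (integrable_wave ξ θ (h.memLp_v j) (h.memLp_l j i)).const_mul α
    have e0 : ∀ x, inertia α v d l i x * wave ξ θ x = ∑ j, (v j x * d i j x * wave ξ θ x
        - α * (v j x * l i j x * wave ξ θ x) + α * (v j x * l j i x * wave ξ θ x)) := by
      intro x
      rw [inertia, Finset.sum_mul]
      exact Finset.sum_congr rfl fun j _ => by ring
    simp only [e0]
    have i4 : ∀ j, Integrable fun x => v j x * d i j x * wave ξ θ x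
        - α * (v j x * l i j x * wave ξ θ x) := fun j => (i1 j).sub (i2 j)
    refine (integral_finsetSum _ fun j _ => (i4 j).add (i3 j)).trans ?_
    refine Finset.sum_congr rfl fun j _ => ?_
    simp only [Pi.add_apply]
    rw [integral_add (i4 j) (i3 j), integral_sub (i1 j) (i2 j), integral_const_mul,
      integral_const_mul]
    rfl
  simp only [e, Finset.sum_add_distrib, Finset.sum_sub_distrib, ← Finset.mul_sum, mul_add, mul_sub]
  congr 1
  · congr 1
    rw [Finset.mul_sum]
    exact Finset.sum_congr rfl fun i _ => by ring
  · rw [Finset.sum_comm' (t' := Finset.univ) (s' := fun _ => Finset.univ) (by simp), Finset.mul_sum]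
    simp only [Finset.mul_sum]
    exact Finset.sum_congr rfl fun i _ => Finset.sum_congr rfl fun j _ => by ring

theorem abs_sum3_le {f : Fin 3 → ℝ} {C : ℝ} (h : ∀ i, |f i| ≤ C) : |∑ i, f i| ≤ 3 * C := by
  refine (Finset.abs_sum_le_sum_abs _ _).trans ?_
  refine (Finset.sum_le_card_nsmul _ _ C fun i _ => h i).trans ?_
  simp

theorem abs_coord_le (ξ : E3) (j : Fin 3) : |ξ j| ≤ ‖ξ‖ := by
  simpa using PiLp.norm_apply_le ξ j

/-- The low-frequency bound for the inertial force, tested against solenoidal plane waves. -/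
theorem IsRegular.abs_inertia_wave_le (h : IsRegular v d s l) (hα : 0 ≤ α) {H : ℝ}
    (h1 : ∀ i, ∫ x, v i x ^ 2 ≤ H) (h2 : ∀ i j, ∫ x, d i j x ^ 2 ≤ H) (ξ : E3) (θ : ℝ)
    {a : Fin 3 → ℝ} (ha : ∑ j, a j * ξ j = 0) {A : ℝ} (hA : ∀ i, |a i| ≤ A) :
    |∑ i, a i * ∫ x, inertia α v d l i x * wave ξ θ x| ≤
      2000 * (1 + α) * (A * (‖ξ‖ * (1 + ‖ξ‖)) * H) := by
  have hA0 : 0 ≤ A := (abs_nonneg _).trans (hA 0)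
  have hH0 : 0 ≤ H := (integral_nonneg fun x => sq_nonneg _).trans (h1 0)
  have hπ := Real.pi_pos
  have hπ4 := Real.pi_lt_d2
  -- The constant 7 is an upper bound for 2π.
  have fr : ∀ (j : Fin 3) {y : ℝ}, |y| ≤ H → |2 * Real.pi * ξ j * y| ≤ 7 * ‖ξ‖ * H := by
    intro j y hy
    rw [abs_mul, abs_mul, abs_of_pos (by positivity : 0 < 2 * Real.pi)]
    have := abs_coord_le ξ j
    gcongr
    linarith
  have am : ∀ (i : Fin 3) {y B : ℝ}, |y| ≤ B → |a i * y| ≤ A * B := by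
    intro i y B hy
    rw [abs_mul]
    exact mul_le_mul (hA i) hy (abs_nonneg _) hA0
  rw [h.integral_inertia_wave]
  have c1 : |∑ i, a i * ∑ j, waveInt ξ θ (v j) (d i j)| ≤ 3 * (A * (3 * (7 * ‖ξ‖ * H))) := by
    refine abs_sum3_le fun i => am i ?_
    rw [h.convection_eq ξ θ (h.wd_v i), abs_neg]
    exact abs_sum3_le fun j => fr j (abs_waveInt_le _ _ (h.memLp_v j) (h.memLp_v i) (h1 j) (h1 i))
  have c2 : |∑ i, a i * ∑ j, waveInt ξ θ (v j) (l i j)| ≤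
      3 * (A * (3 * (7 * ‖ξ‖ * (3 * (H + 7 * ‖ξ‖ * H))))) := by
    refine abs_sum3_le fun i => am i ?_
    rw [h.convection_eq ξ θ (h.wd_lap i), abs_neg]
    refine abs_sum3_le fun j => ?_
    have : |waveInt ξ (θ + Real.pi / 2) (v j) (fun x => ∑ k, s i k k x)|
        ≤ 3 * (H + 7 * ‖ξ‖ * H) := by
      rw [h.elongation_eq, abs_neg]
      refine abs_sum3_le fun k => (abs_add_le _ _).trans (add_le_add ?_ (fr k ?_))
      · exact abs_waveInt_le _ _ (h.memLp_d _ _) (h.memLp_d _ _) (h2 _ _) (h2 _ _)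
      · exact abs_waveInt_le _ _ (h.memLp_v _) (h.memLp_d _ _) (h1 _) (h2 _ _)
    rw [abs_mul, abs_mul, abs_of_pos (by positivity : 0 < 2 * Real.pi)]
    have := abs_coord_le ξ j
    gcongr
    linarith
  have c3 : |∑ i, ∑ j, a j * waveInt ξ θ (v i) (l i j)| ≤ 3 * (3 * (3 * (A * (7 * ‖ξ‖ * H)))) := by
    refine abs_sum3_le fun i => ?_
    rw [h.stretch_eq ξ θ ha]
    refine abs_sum3_le fun j => abs_sum3_le fun k => am j (fr k ?_)
    exact abs_waveInt_le _ _ (h.memLp_d _ _) (h.memLp_d _ _) (h2 _ _) (h2 _ _)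
  set X := ‖ξ‖ with hX
  have hX0 : 0 ≤ X := norm_nonneg _
  have p1 : 0 ≤ A * X * H := by positivity
  have p2 : 0 ≤ A * X ^ 2 * H := by positivity
  have t := abs_add_le (∑ i, a i * ∑ j, waveInt ξ θ (v j) (d i j)
    - α * ∑ i, a i * ∑ j, waveInt ξ θ (v j) (l i j))
    (α * ∑ i, ∑ j, a j * waveInt ξ θ (v i) (l i j))
  have t' := abs_sub (∑ i, a i * ∑ j, waveInt ξ θ (v j) (d i j))
    (α * ∑ i, a i * ∑ j, waveInt ξ θ (v j) (l i j))
  rw [abs_mul, abs_of_nonneg hα] at t t'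
  have q2 := mul_le_mul_of_nonneg_left c2 hα
  have q3 := mul_le_mul_of_nonneg_left c3 hα
  have p3 : 0 ≤ α * (A * X * H) := by positivity
  have p4 : 0 ≤ α * (A * X ^ 2 * H) := by positivity
  nlinarith

end

/-! ### Linearity and injectivity of the transform. -/

theorem ft_add {f g : E3 → ℝ} (hf : MemLp f 2 volume) (hg : MemLp g 2 volume) :
    ft (fun x => f x + g x) =ᵐ[volume] fun ξ => ft f ξ + ft g ξ := by
  have hfg : MemLp (fun x => f x + g x) 2 volume := hf.add hg
  rw [ft_eq hf, ft_eq hg, ft_eq hfg]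
  have : (hfg.ofReal (K := ℂ)).toLp = (hf.ofReal (K := ℂ)).toLp + (hg.ofReal (K := ℂ)).toLp := by
    rw [← MemLp.toLp_add]
    exact MemLp.toLp_congr _ _ (Eventually.of_forall fun x => by simp)
  rw [this, FourierTransform.fourier_add]
  exact Lp.coeFn_add _ _

theorem ft_zero : ft (fun _ => 0) =ᵐ[volume] 0 := by
  refine (tempered_of_memLp (memLp_ft _)).ae_eq_zero fun g hg => ?_
  obtain ⟨χ, hχ⟩ := hg.exists_pair
  rw [hχ.integral_ft MemLp.zero']
  simp

theorem ft_sum {ι : Type*} (s : Finset ι) {f : ι → E3 → ℝ} (hf : ∀ i, MemLp (f i) 2 volume) :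
    ft (fun x => ∑ i ∈ s, f i x) =ᵐ[volume] fun ξ => ∑ i ∈ s, ft (f i) ξ := by
  classical
  induction s using Finset.induction_on with
  | empty => simpa using! ft_zero
  | insert a s ha ih =>
    simp only [Finset.sum_insert ha]
    filter_upwards [ih, ft_add (hf a) (memLp_finsetSum s fun i _ => hf i)] with ξ h1 h2
    rw [h2, h1]

theorem ae_eq_of_ft_ae_eq {f g : E3 → ℝ} (hf : MemLp f 2 volume) (hg : MemLp g 2 volume)
    (h : ft f =ᵐ[volume] ft g) : f =ᵐ[volume] g := by
  refine ae_eq_of_integral_contDiff_smul_eq (hf.locallyIntegrable one_le_two)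
    (hg.locallyIntegrable one_le_two) fun χ h1 h2 => ?_
  obtain ⟨γ, hγ⟩ := exists_testPair h1 h2
  have e1 := hγ.integral_ft hf
  have e2 := hγ.integral_ft hg
  rw [integral_congr_ae (g := fun ξ => ft g ξ * γ ξ)
    (by filter_upwards [h] with ξ hξ; rw [hξ]), e2] at e1
  simp only [smul_eq_mul, mul_comm (χ _)]
  exact_mod_cast e1.symm

/-! ### Test fields of the form `curl (χ e_l)` -/

/-- The `i`-th component of the Fourier symbol of `χ ↦ curl (χ e_l)`. -/
def curlSymbol (l i : Fin 3) (ξ : E3) : ℂ :=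
  if i = l + 1 then -(2 * Real.pi * Complex.I * ξ (l + 2))
  else if i = l + 2 then 2 * Real.pi * Complex.I * ξ (l + 1) else 0

/-- The test field `χ e_l`. -/
def axisField (l : Fin 3) (χ : E3 → ℝ) (x : E3) : E3 := EuclideanSpace.single l (χ x)

theorem isTestField_axisField (l : Fin 3) {χ : E3 → ℝ} (h1 : ContDiff ℝ ∞ χ)
    (h2 : HasCompactSupport χ) : IsTestField (axisField l χ) := by
  have e : axisField l χ = fun x => χ x • (EuclideanSpace.single l (1 : ℝ) : E3) := by
    ext x i; simp [axisField]
  rw [e]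
  exact ⟨h1.smul contDiff_const, h2.smul_right⟩

/-- Indices in `Fin 3` are added modulo 3, so l + 1 and l + 2 are the other two axes in cyclic
order, and one formula covers all three directions. -/
theorem curl_axisField (l : Fin 3) (χ : E3 → ℝ) (x : E3) (i : Fin 3) :
    curl (axisField l χ) x i = if i = l + 1 then partialD (l + 2) χ x
      else if i = l + 2 then -partialD (l + 1) χ x else 0 := by
  have z : ∀ j, partialD j (fun _ : E3 => (0 : ℝ)) x = 0 := by intro j; simp [partialD]
  fin_cases l <;> fin_cases i <;> simp [curl, axisField, z]

theorem IsTestPair.neg {χ : E3 → ℝ} {g : SchwartzMap E3 ℂ} (h : IsTestPair χ g) :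
    IsTestPair (fun x => -χ x) (-g) :=
  ⟨h.1.neg, h.2.1.neg, fun x => by
    rw [FourierTransform.fourier_neg]; simp [h.2.2 x]⟩

theorem isTestPair_zero : IsTestPair (fun _ => 0) 0 :=
  ⟨contDiff_const, HasCompactSupport.zero, fun x => by
    rw [FourierTransform.fourier_zero]; simp⟩

theorem IsTestPair.curl {χ : E3 → ℝ} {g : SchwartzMap E3 ℂ} (h : IsTestPair χ g) (l i : Fin 3) :
    ∃ γ, IsTestPair (fun x => curl (axisField l χ) x i) γ ∧ ∀ ξ, γ ξ = curlSymbol l i ξ * g ξ := by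
  by_cases h1 : i = l + 1
  · refine ⟨mulFreq (l + 2) g, ?_, fun ξ => ?_⟩
    · simpa only [curl_axisField, h1, if_true] using! h.partialD (l + 2)
    · simp [mulFreq_apply, curlSymbol, h1]
  by_cases h2 : i = l + 2
  · refine ⟨-mulFreq (l + 1) g, ?_, fun ξ => ?_⟩
    · have : l + 2 ≠ l + 1 := by fin_cases l <;> decide
      simpa only [curl_axisField, h2, this, if_true, if_false] using! (h.partialD (l + 1)).neg
    · simp [mulFreq_apply, curlSymbol, h2]
  · refine ⟨0, ?_, fun ξ => ?_⟩
    · simpa only [curl_axisField, h1, h2, if_false] using! isTestPair_zero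
    · simp [curlSymbol, h1, h2]

theorem two_le_infty : (2 : WithTop ℕ∞) ≤ ((⊤ : ℕ∞) : WithTop ℕ∞) := WithTop.coe_le_coe.2 (le_top : (2 : ℕ∞) ≤ ⊤)

theorem partialD_comm {χ : E3 → ℝ} (h : ContDiff ℝ ∞ χ) (j k : Fin 3) (x : E3) :
    partialD j (partialD k χ) x = partialD k (partialD j χ) x := by
  have hd : DifferentiableAt ℝ (fderiv ℝ χ) x :=
    ((h.fderiv_right (m := ∞) le_rfl).differentiable (by simp)) x
  have e : ∀ a b : Fin 3, partialD a (partialD b χ) x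
      = fderiv ℝ (fderiv ℝ χ) x (basisVec a) (basisVec b) := by
    intro a b
    unfold partialD
    rw [fderiv_clm_apply hd (by fun_prop)]
    simp
  rw [e, e]
  exact (h.contDiffAt.isSymmSndFDerivAt
    (by rw [minSmoothness_of_isRCLikeNormedField]; exact two_le_infty)).eq _ _

theorem IsTestPair.partialD_partialD {χ : E3 → ℝ} {g : SchwartzMap E3 ℂ} (h : IsTestPair χ g)
    (k : Fin 3) : IsTestPair (SecondGradeFluid.partialD k (SecondGradeFluid.partialD k χ))
      (mulFreq k (mulFreq k g)) := (h.partialD k).partialD k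

theorem laplacian_apply_coord {F : E3 → E3} (hF : ∀ i, ContDiff ℝ ∞ fun x => F x i) (x : E3)
    (i : Fin 3) : (Δ F) x i = ∑ k, partialD k (partialD k fun y => F y i) x := by
  have hF' : ContDiff ℝ ∞ F := contDiff_euclidean.2 hF
  have h1 := ContDiffAt.laplacian_CLM_comp_left (l := (EuclideanSpace.proj i : E3 →L[ℝ] ℝ))
    (hF'.contDiffAt (x := x) |>.of_le two_le_infty)
  have h2 : (Δ F) x i = (Δ (fun y => F y i)) x := by
    simpa [Function.comp_def] using h1.symm
  rw [h2, InnerProductSpace.laplacian_eq_iteratedFDeriv_orthonormalBasis _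
    (EuclideanSpace.basisFun (Fin 3) ℝ)]
  refine Finset.sum_congr rfl fun k _ => ?_
  rw [iteratedFDeriv_two_apply]
  have hd : DifferentiableAt ℝ (fderiv ℝ fun y => F y i) x :=
    (((hF i).fderiv_right (m := ∞) le_rfl).differentiable (by simp)) x
  have e : partialD k (partialD k fun y => F y i) x
      = fderiv ℝ (fderiv ℝ fun y => F y i) x (basisVec k) (basisVec k) := by
    unfold partialD
    rw [fderiv_clm_apply hd (by fun_prop)]
    simp
  rw [e]
  simp [basisVec]

/-- The divergence of a curl vanishes by symmetry of mixed partials. These are the only solenoidal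
tests that the proof inserts in the weak formulation. -/
theorem isSolenoidalTestField_curl (l : Fin 3) {χ : E3 → ℝ} (h1 : ContDiff ℝ ∞ χ)
    (h2 : HasCompactSupport χ) : IsSolenoidalTestField (curl (axisField l χ)) := by
  obtain ⟨g, hg⟩ := exists_testPair h1 h2
  choose γ hγ _ using hg.curl l
  refine ⟨⟨contDiff_euclidean.2 fun i => (hγ i).1, ?_⟩, fun x => ?_⟩
  · have hc : ∀ i, HasCompactSupport fun x => curl (axisField l χ) x i := fun i => (hγ i).2.1
    have hK : IsCompact (⋃ i, tsupport fun x => curl (axisField l χ) x i) :=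
      isCompact_iUnion fun i => hc i
    refine HasCompactSupport.intro hK fun x hx => ?_
    ext i
    have : x ∉ tsupport fun x => curl (axisField l χ) x i := fun h => hx (mem_iUnion.2 ⟨i, h⟩)
    simpa using image_eq_zero_of_notMem_tsupport this
  · have z : partialD l (fun _ : E3 => (0 : ℝ)) x = 0 := by simp [partialD]
    have e1 : (fun y => curl (axisField l χ) y l) = fun _ => 0 := by
      ext y; rw [curl_axisField]; fin_cases l <;> simp
    have e2 : (fun y => curl (axisField l χ) y (l + 1)) = partialD (l + 2) χ := by
      ext y; rw [curl_axisField]; simp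
    have e3 : (fun y => curl (axisField l χ) y (l + 2)) = fun y => -partialD (l + 1) χ y := by
      ext y; rw [curl_axisField]; fin_cases l <;> simp
    have e4 : partialD (l + 2) (fun y => -partialD (l + 1) χ y) x
        = -partialD (l + 2) (partialD (l + 1) χ) x := by
      conv_lhs => unfold partialD
      rw [fderiv_fun_neg]; rfl
    have e5 : ∑ i, partialD i (fun y => curl (axisField l χ) y i) x
        = partialD l (fun y => curl (axisField l χ) y l) x
          + partialD (l + 1) (fun y => curl (axisField l χ) y (l + 1)) x
          + partialD (l + 2) (fun y => curl (axisField l χ) y (l + 2)) x := by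
      rw [Fin.sum_univ_three]; fin_cases l <;> simp <;> ring
    rw [e5, e1, e2, e3, z, e4, partialD_comm h1 (l + 1) (l + 2)]
    ring

/-! ### Fields of V and V₂ in frequency variables. -/

/-- The Fourier transform of the `i`-th component of `v`. -/
def ftc (v : E3 → E3) (i : Fin 3) : E3 → ℂ := ft fun x => v x i

theorem memLp_ftc (v : E3 → E3) (i : Fin 3) : MemLp (ftc v i) 2 volume := memLp_ft _

theorem memLp_coord {v : E3 → E3} (hv : MemLp v 2 volume) (i : Fin 3) :
    MemLp (fun x => v x i) 2 volume :=
  (EuclideanSpace.proj i : E3 →L[ℝ] ℝ).comp_memLp' hv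

theorem MemH1.exists_isWD {v : E3 → E3} (h : MemH1 v) (i j : Fin 3) :
    IsWD j (fun x => v x i) (weakPartial j fun x => v x i) := by
  obtain ⟨g, hg, hw⟩ := h.2 i j
  have e := hw.weakPartial_ae .rfl
  exact ⟨memLp_coord h.1 i, hg.ae_eq e.symm, hw.congr .rfl e.symm⟩

theorem MemV.freq_div {v : E3 → E3} (h : MemV v) : ∀ᵐ ξ : E3, ∑ i, (ξ i : ℂ) * ftc v i ξ = 0 := by
  have h1 := ft_sum Finset.univ fun i => (h.1.exists_isWD i i).right
  have h2 : ft (fun x => ∑ i, weakPartial i (fun x => v x i) x) = ft fun _ => 0 :=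
    ft_congr (by filter_upwards [h.2] with x hx using hx)
  rw [h2] at h1
  have h3 : ∀ i, ∀ᵐ ξ, _ := fun i => (h.1.exists_isWD i i).ft_eq
  filter_upwards [h1, ft_zero, ae_all_iff.2 h3] with ξ e1 e2 e3
  rw [e2] at e1
  simp only [e3, Pi.zero_apply] at e1
  have : (2 * Real.pi * Complex.I : ℂ) ≠ 0 := by simp [Real.pi_ne_zero]
  refine (mul_eq_zero.1 (?_ : (2 * Real.pi * Complex.I : ℂ) * _ = 0)).resolve_left this
  rw [e1, Finset.mul_sum]
  exact Finset.sum_congr rfl fun i _ => by simp only [ftc]; ring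

/-- The symbol `1 + 4π² α |ξ|²` of `1 - α Δ`. -/
def stressSymbol (α : ℝ) (ξ : E3) : ℝ := 1 + 4 * Real.pi ^ 2 * α * ‖ξ‖ ^ 2

theorem norm_sq_coord (ξ : E3) : ‖ξ‖ ^ 2 = ∑ k, ξ k ^ 2 := by
  rw [EuclideanSpace.norm_sq_eq]; simp

theorem stressSymbol_pos {α : ℝ} (hα : 0 ≤ α) (ξ : E3) : 0 < stressSymbol α ξ := by
  unfold stressSymbol; positivity

theorem hasTemperateGrowth_coord (j : Fin 3) :
    (fun ξ : E3 => ((ξ j : ℝ) : ℂ)).HasTemperateGrowth :=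
  (Complex.ofRealCLM ∘L (EuclideanSpace.proj j : E3 →L[ℝ] ℝ)).hasTemperateGrowth

theorem hasTemperateGrowth_curlSymbol (l i : Fin 3) : (curlSymbol l i).HasTemperateGrowth := by
  unfold curlSymbol
  split_ifs
  · exact ((Function.HasTemperateGrowth.const _).mul (hasTemperateGrowth_coord _)).neg
  · exact (Function.HasTemperateGrowth.const _).mul (hasTemperateGrowth_coord _)
  · exact Function.HasTemperateGrowth.const _

theorem hasTemperateGrowth_normSq : (fun ξ : E3 => ((‖ξ‖ ^ 2 : ℝ) : ℂ)).HasTemperateGrowth := by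
  have : (fun ξ : E3 => ((‖ξ‖ ^ 2 : ℝ) : ℂ)) = fun ξ => ∑ k, ((ξ k : ℝ) : ℂ) * ((ξ k : ℝ) : ℂ) := by
    ext ξ; rw [norm_sq_coord]; push_cast; exact Finset.sum_congr rfl fun k _ => by ring
  rw [this]
  exact Function.HasTemperateGrowth.sum fun k _ =>
    (hasTemperateGrowth_coord k).mul (hasTemperateGrowth_coord k)

theorem hasTemperateGrowth_stressSymbol (α : ℝ) :
    (fun ξ : E3 => (stressSymbol α ξ : ℂ)).HasTemperateGrowth := by
  have : (fun ξ : E3 => (stressSymbol α ξ : ℂ))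
      = fun ξ => 1 + ((4 * Real.pi ^ 2 * α : ℝ) : ℂ) * ((‖ξ‖ ^ 2 : ℝ) : ℂ) := by
    ext ξ; simp [stressSymbol]
  rw [this]
  exact (Function.HasTemperateGrowth.const _).add
    ((Function.HasTemperateGrowth.const _).mul hasTemperateGrowth_normSq)

theorem sum_mulFreq_mulFreq (g : SchwartzMap E3 ℂ) (ξ : E3) :
    ∑ k, mulFreq k (mulFreq k g) ξ = -((4 * Real.pi ^ 2 * ‖ξ‖ ^ 2 : ℝ) : ℂ) * g ξ := by
  rw [norm_sq_coord]
  simp only [mulFreq_apply]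
  push_cast
  rw [Finset.mul_sum, ← Finset.sum_neg_distrib, Finset.sum_mul]
  refine Finset.sum_congr rfl fun k _ => ?_
  linear_combination (4 * Real.pi ^ 2 * (ξ k : ℂ) ^ 2 * g ξ) * Complex.I_sq

theorem integral_sum_mul_testPair {v : E3 → E3} (hv : MemLp v 2 volume) {F : E3 → E3}
    {γ : Fin 3 → SchwartzMap E3 ℂ} (hγ : ∀ i, IsTestPair (fun x => F x i) (γ i)) :
    ((∫ x, ⟪v x, F x⟫_ℝ : ℝ) : ℂ) = ∑ i, ∫ ξ, ftc v i ξ * γ i ξ := by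
  simp only [ftc, fun i => (hγ i).integral_ft (memLp_coord hv i)]
  have e : ∀ x, ⟪v x, F x⟫_ℝ = ∑ i, v x i * F x i := fun x => by
    simp [PiLp.inner_apply, mul_comm]
  simp only [e]
  rw [integral_finsetSum]
  · push_cast; rfl
  · exact fun i _ => (memLp_coord hv i).integrable_mul
      (memLp_test (hγ i).1.continuous (hγ i).2.1)

theorem IsTestPair.stress {α : ℝ} {F : E3 → E3} {γ : Fin 3 → SchwartzMap E3 ℂ}
    (hγ : ∀ i, IsTestPair (fun x => F x i) (γ i)) :
    ∃ δ : Fin 3 → SchwartzMap E3 ℂ,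
      (∀ i, IsTestPair (fun x => (F x - α • (Δ F) x) i) (δ i)) ∧
      ∀ i ξ, δ i ξ = stressSymbol α ξ * γ i ξ := by
  refine ⟨fun i => γ i - (α : ℂ) • ∑ k, mulFreq k (mulFreq k (γ i)), fun i => ?_, fun i ξ => ?_⟩
  · have e : (fun x => (F x - α • (Δ F) x) i) = fun x => F x i
        - α * ∑ k, SecondGradeFluid.partialD k (SecondGradeFluid.partialD k fun y => F y i) x := by
      ext x; simp [laplacian_apply_coord fun i => (hγ i).1]
    have hk := fun k => (hγ i).partialD_partialD k
    rw [e]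
    refine ⟨(hγ i).1.sub (contDiff_const.mul (ContDiff.sum fun k _ => (hk k).1)), ?_, fun x => ?_⟩
    · refine (hγ i).2.1.sub (HasCompactSupport.mul_left ?_)
      simp only [Fin.sum_univ_three]
      exact ((hk 0).2.1.add (hk 1).2.1).add (hk 2).2.1
    · beta_reduce
      rw [sub_eq_add_neg (γ i), FourierTransform.fourier_add, FourierTransform.fourier_neg,
        FourierTransform.fourier_smul, FourierTransform.fourier_sum]
      simp [(hγ i).2.2 x, (hk _).2.2 x, sub_eq_add_neg]
  · have := sum_mulFreq_mulFreq (γ i) ξ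
    simp [this, stressSymbol]
    ring

/-- Testing with `χ e_l` moves curl and 1 - αΔ onto the test function, where they act as symbols.
The resulting product is identified with the transform of the l-th component of an L² field. -/
theorem MemV2.memLp_curl {α : ℝ} {v : E3 → E3} (h : MemV2 α v) (l : Fin 3) :
    MemLp (fun ξ => (stressSymbol α ξ : ℂ) * ∑ i, curlSymbol l i ξ * ftc v i ξ) 2 volume := by
  obtain ⟨g, hg, hc⟩ := h.2
  have hv : MemLp v 2 volume := h.1.1.1
  have hT : ∀ i, Tempered (fun ξ => curlSymbol l i ξ * ftc v i ξ) := fun i =>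
    (tempered_of_memLp (memLp_ft _)).mul (hasTemperateGrowth_curlSymbol l i)
  have hS := (Tempered.sum Finset.univ fun i _ => hT i).mul (hasTemperateGrowth_stressSymbol α)
  have hG := tempered_of_memLp (memLp_ft fun x => g x l)
  have key := (hS.add (hG.const_mul (-1))).ae_eq_zero ?_
  · refine (memLp_ft fun x => g x l).ae_eq ?_
    filter_upwards [key] with ξ hξ
    simp only [Pi.zero_apply] at hξ
    linear_combination -hξ
  intro φ hφ
  obtain ⟨χ, hχ⟩ := hφ.exists_pair
  choose γ hγ hγv using hχ.curl l
  obtain ⟨δ, hδ, hδv⟩ := IsTestPair.stress (α := α) hγ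
  have e1 := integral_sum_mul_testPair hv hδ
  rw [hc _ (isTestField_axisField l hχ.1 hχ.2.1)] at e1
  have e2 : ∫ x, ⟪g x, axisField l χ x⟫_ℝ = ∫ x, g x l * χ x := by
    congr 1; ext x; simp [axisField, PiLp.inner_apply, mul_comm]
  rw [e2, ← hχ.integral_ft (memLp_coord hg l)] at e1
  have e3 : ∫ ξ, (stressSymbol α ξ : ℂ) * (∑ i, curlSymbol l i ξ * ftc v i ξ) * φ ξ
      = ∑ i, ∫ ξ, ftc v i ξ * δ i ξ := by
    rw [← integral_finsetSum _ fun i _ => (tempered_of_memLp (memLp_ftc v i)).2 (δ i)]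
    congr 1; ext ξ
    simp only [hδv, hγv, Finset.mul_sum, Finset.sum_mul]
    exact Finset.sum_congr rfl fun i _ => by ring
  simp only [add_mul]
  rw [integral_add (hS.2 φ) ((hG.const_mul (-1)).2 φ), e3, ← e1]
  simp only [neg_mul, one_mul, integral_neg]
  ring

theorem curlSymbol_sum (l : Fin 3) (ξ : E3) (V : Fin 3 → ℂ) :
    ∑ i, curlSymbol l i ξ * V i
      = -(2 * Real.pi * Complex.I) * (ξ (l + 2) * V (l + 1) - ξ (l + 1) * V (l + 2)) := by
  rw [Fin.sum_univ_three]
  fin_cases l <;> simp [curlSymbol] <;> ring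

theorem norm_cross_eq (ξ : E3) (V : Fin 3 → ℂ) (l : Fin 3) :
    ‖∑ i, curlSymbol l i ξ * V i‖
      = 2 * Real.pi * ‖(ξ (l + 2) : ℂ) * V (l + 1) - ξ (l + 1) * V (l + 2)‖ := by
  rw [curlSymbol_sum, norm_mul]
  simp [abs_of_pos Real.pi_pos]

/-- A vector orthogonal to `ξ` is controlled by its cross product with `ξ`. -/
theorem norm_mul_le_cross (ξ : E3) (V : Fin 3 → ℂ) (hV : ∑ i, (ξ i : ℂ) * V i = 0) (b : Fin 3) :
    ‖ξ‖ * ‖V b‖ ≤ ∑ l : Fin 3, ‖∑ i, curlSymbol l i ξ * V i‖ := by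
  set X : Fin 3 → ℂ := fun l => (ξ (l + 2) : ℂ) * V (l + 1) - ξ (l + 1) * V (l + 2) with hX
  -- This is the triple product identity for ξ × (ξ × V), in which the term along ξ drops out
  -- because ξ·V = 0.
  have h1 : (‖ξ‖ ^ 2 : ℝ) * V b = ξ (b + 1) * X (b + 2) - ξ (b + 2) * X (b + 1) := by
    rw [norm_sq_coord]
    push_cast
    rw [Fin.sum_univ_three] at hV ⊢
    fin_cases b <;> simp [hX] at hV ⊢
    · linear_combination (ξ 0 : ℂ) * hV
    · linear_combination (ξ 1 : ℂ) * hV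
    · linear_combination (ξ 2 : ℂ) * hV
  have h2 : ‖ξ‖ ^ 2 * ‖V b‖ ≤ ‖ξ‖ * (‖X (b + 2)‖ + ‖X (b + 1)‖) := by
    have := congrArg norm h1
    rw [norm_mul, Complex.norm_real, Real.norm_of_nonneg (by positivity)] at this
    rw [this]
    refine (norm_sub_le _ _).trans ?_
    simp only [norm_mul, Complex.norm_real, Real.norm_eq_abs, mul_add]
    gcongr <;> exact abs_coord_le _ _
  have h3 : ‖ξ‖ * ‖V b‖ ≤ ‖X (b + 2)‖ + ‖X (b + 1)‖ := by
    rcases (norm_nonneg ξ).eq_or_lt with h0 | h0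
    · rw [← h0, zero_mul]; positivity
    · refine le_of_mul_le_mul_left ?_ h0
      calc _ = ‖ξ‖ ^ 2 * ‖V b‖ := by ring
        _ ≤ _ := h2
  have h4 : ∀ l, ‖X l‖ ≤ ‖∑ i, curlSymbol l i ξ * V i‖ := fun l => by
    rw [norm_cross_eq]
    have : 1 ≤ 2 * Real.pi := by have := Real.pi_gt_three; linarith
    exact le_mul_of_one_le_left (norm_nonneg _) this
  refine h3.trans ?_
  rw [Fin.sum_univ_three]
  have q := fun l => (norm_nonneg (X l)).trans (h4 l)
  have q0 := q 0
  have q1 := q 1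
  have q2 := q 2
  have r0 := h4 0
  have r1 := h4 1
  have r2 := h4 2
  fin_cases b <;> simp only [Fin.reduceFinMk, Fin.reduceAdd, Fin.zero_eta, Fin.mk_one, Fin.isValue, zero_add] <;> linarith

/-- For a solenoidal field |ξ||v̂| is bounded by the curl components, and the symbol of 1 - αΔ
supplies the other two powers of |ξ|. This is the embedding of V₂ in H³. -/
theorem MemV2.memLp_cube {α : ℝ} (hα : 0 < α) {v : E3 → E3} (h : MemV2 α v) (i : Fin 3) :
    MemLp (fun ξ => (‖ξ‖ ^ 3 : ℝ) * ftc v i ξ) 2 volume := by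
  have hs : MemLp (fun ξ => ∑ l : Fin 3, ‖(stressSymbol α ξ : ℂ) * ∑ i, curlSymbol l i ξ * ftc v i ξ‖)
      2 volume := memLp_finsetSum _ fun l _ => (h.memLp_curl l).norm
  refine hs.of_le_mul (c := 1 / (4 * Real.pi ^ 2 * α)) ?_ ?_
  · exact (by fun_prop : Continuous fun ξ : E3 => ((‖ξ‖ ^ 3 : ℝ) : ℂ)).aestronglyMeasurable.mul
      (memLp_ft _).1
  · filter_upwards [h.1.freq_div] with ξ hξ
    have h1 := norm_mul_le_cross ξ (fun i => ftc v i ξ) hξ i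
    have hpos := stressSymbol_pos hα.le ξ
    have h2 : 4 * Real.pi ^ 2 * α * ‖ξ‖ ^ 2 ≤ stressSymbol α ξ := by unfold stressSymbol; linarith
    rw [Real.norm_of_nonneg (Finset.sum_nonneg fun l _ => norm_nonneg _)]
    simp only [norm_mul, Complex.norm_real, Real.norm_of_nonneg hpos.le, norm_norm, norm_pow,
      ← Finset.mul_sum]
    have hc : 0 < 4 * Real.pi ^ 2 * α := by positivity
    rw [one_div, ← div_eq_inv_mul, le_div_iff₀ hc]
    calc ‖ξ‖ ^ 3 * ‖ftc v i ξ‖ * (4 * Real.pi ^ 2 * α)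
        = (4 * Real.pi ^ 2 * α * ‖ξ‖ ^ 2) * (‖ξ‖ * ‖ftc v i ξ‖) := by ring
      _ ≤ _ := by gcongr

/-- Multipliers of at most cubic growth keep the transform of a `V₂` field square-integrable. -/
theorem MemV2.memLp_mul {α : ℝ} (hα : 0 < α) {v : E3 → E3} (h : MemV2 α v) (i : Fin 3)
    {p : E3 → ℂ} (hp : Continuous p) {C : ℝ} (hC : ∀ ξ, ‖p ξ‖ ≤ C * (1 + ‖ξ‖ ^ 3)) :
    MemLp (fun ξ => p ξ * ftc v i ξ) 2 volume := by
  have hs := (memLp_ft fun x => v x i).norm.add (h.memLp_cube hα i).norm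
  refine hs.of_le_mul (c := C) (hp.aestronglyMeasurable.mul (memLp_ft _).1)
    (Eventually.of_forall fun ξ => ?_)
  have e : ((fun ξ => ‖ft (fun x => v x i) ξ‖) + fun ξ => ‖(‖ξ‖ ^ 3 : ℝ) * ftc v i ξ‖) ξ
      = (1 + ‖ξ‖ ^ 3) * ‖ftc v i ξ‖ := by
    simp [ftc]; ring
  rw [e, norm_mul, Real.norm_of_nonneg (by positivity), ← mul_assoc]
  gcongr
  exact hC ξ

theorem pow_le_one_add_cube {x : ℝ} (hx : 0 ≤ x) : 1 + x + x ^ 2 ≤ 3 * (1 + x ^ 3) := by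
  rcases le_total x 1 with h | h
  · have : x ^ 2 ≤ 1 := pow_le_one₀ hx h
    have : 0 ≤ x ^ 3 := by positivity
    linarith
  · have h1 : x ≤ x ^ 3 := le_self_pow₀ h (by norm_num)
    have h2 : x ^ 2 ≤ x ^ 3 := pow_le_pow_right₀ h (by norm_num)
    linarith

/-- Cauchy–Schwarz against (1+|ξ|²)⁻¹, which is square-integrable in dimension three. -/
theorem MemV2.integrable_ftc {α : ℝ} (hα : 0 < α) {v : E3 → E3} (h : MemV2 α v) (i : Fin 3) :
    Integrable (ftc v i) := by
  have h1 : MemLp (fun ξ => ((1 + ‖ξ‖ ^ 2 : ℝ) : ℂ) * ftc v i ξ) 2 volume := by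
    refine h.memLp_mul hα i (C := 3) (by fun_prop) fun ξ => ?_
    rw [Complex.norm_real, Real.norm_of_nonneg (by positivity)]
    have := pow_le_one_add_cube (norm_nonneg ξ)
    have := norm_nonneg ξ
    linarith
  have h2 : MemLp (fun ξ : E3 => (((1 + ‖ξ‖ ^ 2)⁻¹ : ℝ) : ℂ)) 2 volume := by
    have hc : Continuous fun ξ : E3 => (((1 + ‖ξ‖ ^ 2)⁻¹ : ℝ) : ℂ) :=
      Complex.continuous_ofReal.comp
        ((by fun_prop : Continuous fun ξ : E3 => 1 + ‖ξ‖ ^ 2).inv₀ fun ξ => by positivity)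
    rw [memLp_two_iff_integrable_sq_norm hc.aestronglyMeasurable]
    have h3 := integrable_rpow_neg_one_add_norm_sq (E := E3) (μ := volume) (r := 4)
      (by simp; norm_num)
    refine h3.congr (Eventually.of_forall fun ξ => ?_)
    simp only [Complex.norm_real, Real.norm_eq_abs]
    rw [sq_abs, inv_pow, ← Real.rpow_natCast (1 + ‖ξ‖ ^ 2) 2, ← Real.rpow_neg (by positivity)]
    norm_num
  refine (h2.integrable_mul h1).congr (Eventually.of_forall fun ξ => ?_)
  simp only [Pi.mul_apply]
  rw [← mul_assoc, ← Complex.ofReal_mul, inv_mul_cancel₀ (by positivity)]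
  simp

/-- A field of `V₂` has square-integrable derivatives of third order. -/
theorem MemV2.exists_isRegular {α : ℝ} (hα : 0 < α) {v : E3 → E3} (h : MemV2 α v) :
    ∃ d s l, IsRegular (fun i x => v x i) d s l ∧
      (∀ i j, weakPartial j (fun x => v x i) =ᵐ[volume] d i j) ∧
      (∀ i j, weakPartial j (fun x => weakLaplacian v x i) =ᵐ[volume] l i j) := by
  have hd := fun i j => h.1.1.exists_isWD i j
  set d : Fin 3 → Fin 3 → E3 → ℝ := fun i j => weakPartial j fun x => v x i with hd_def
  have c1 : ∀ (ξ : E3) j, ‖((ξ j : ℝ) : ℂ)‖ ≤ ‖ξ‖ := fun ξ j => by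
    rw [Complex.norm_real]; exact abs_coord_le ξ j
  have c2 : ∀ k, Continuous fun ξ : E3 => ((ξ k : ℝ) : ℂ) := fun k =>
    (hasTemperateGrowth_coord k).1.continuous
  have hπ : ‖(2 * Real.pi * Complex.I : ℂ)‖ = 2 * Real.pi := by simp [abs_of_pos Real.pi_pos]
  -- Higher derivatives are constructed in frequency space, as multipliers of at most cubic growth;
  -- their symmetry then follows from that of the symbols.
  have hs : ∀ i j k, ∃ g, IsWD k (d i j) g := by
    intro i j k
    refine exists_isWD (hd i j).right ?_
    have hm := h.memLp_mul hα i (p := fun ξ => ξ k * (2 * Real.pi * Complex.I * ξ j))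
      (C := 2 * Real.pi * 3) ((c2 k).mul (continuous_const.mul (c2 j))) fun ξ => by
        rw [norm_mul, norm_mul, hπ]
        have := pow_le_one_add_cube (norm_nonneg ξ)
        have := norm_nonneg ξ
        calc ‖((ξ k : ℝ) : ℂ)‖ * (2 * Real.pi * ‖((ξ j : ℝ) : ℂ)‖)
            ≤ ‖ξ‖ * (2 * Real.pi * ‖ξ‖) := by gcongr <;> exact c1 _ _
          _ = 2 * Real.pi * ‖ξ‖ ^ 2 := by ring
          _ ≤ 2 * Real.pi * (3 * (1 + ‖ξ‖ ^ 3)) := by gcongr; linarith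
          _ = _ := by ring
    refine hm.ae_eq ?_
    filter_upwards [(hd i j).ft_eq] with ξ e
    rw [e, ftc]; ring
  choose s hs using hs
  have fs : ∀ i j k, ∀ᵐ ξ, ft (s i j k) ξ
      = 2 * Real.pi * Complex.I * ξ k * (2 * Real.pi * Complex.I * ξ j * ftc v i ξ) := by
    intro i j k
    filter_upwards [(hs i j k).ft_eq, (hd i j).ft_eq] with ξ e1 e2
    rw [e1, e2, ftc]
  have hlap : ∀ i, MemLp (fun x => ∑ k, s i k k x) 2 volume := fun i =>
    memLp_finsetSum _ fun k _ => (hs i k k).right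
  have flap : ∀ i, ∀ᵐ ξ, ft (fun x => ∑ k, s i k k x) ξ
      = -((4 * Real.pi ^ 2 * ‖ξ‖ ^ 2 : ℝ) : ℂ) * ftc v i ξ := by
    intro i
    filter_upwards [ft_sum Finset.univ fun k => (hs i k k).right,
      ae_all_iff.2 fun k => fs i k k] with ξ e1 e2
    rw [e1, norm_sq_coord]
    simp only [e2]
    push_cast
    rw [Finset.mul_sum, ← Finset.sum_neg_distrib, Finset.sum_mul]
    refine Finset.sum_congr rfl fun k _ => ?_
    linear_combination (4 * Real.pi ^ 2 * (ξ k : ℂ) ^ 2 * ftc v i ξ) * Complex.I_sq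
  have hl : ∀ i j, ∃ g, IsWD j (fun x => ∑ k, s i k k x) g := by
    intro i j
    refine exists_isWD (hlap i) ?_
    have hm := h.memLp_mul hα i (p := fun ξ => ξ j * -((4 * Real.pi ^ 2 * ‖ξ‖ ^ 2 : ℝ) : ℂ))
      (C := 4 * Real.pi ^ 2) ((c2 j).mul (by fun_prop)) fun ξ => by
        rw [norm_mul, norm_neg, Complex.norm_real (4 * Real.pi ^ 2 * ‖ξ‖ ^ 2),
          Real.norm_of_nonneg (by positivity)]
        calc ‖((ξ j : ℝ) : ℂ)‖ * (4 * Real.pi ^ 2 * ‖ξ‖ ^ 2)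
            ≤ ‖ξ‖ * (4 * Real.pi ^ 2 * ‖ξ‖ ^ 2) := by gcongr; exact c1 _ _
          _ = 4 * Real.pi ^ 2 * ‖ξ‖ ^ 3 := by ring
          _ ≤ _ := by gcongr; linarith
    refine hm.ae_eq ?_
    filter_upwards [flap i] with ξ e
    rw [e]; ring
  choose l hl using hl
  refine ⟨d, s, l, ⟨hd, hs, fun i j k => ?_, hl, h.1.2⟩, fun i j => .rfl, fun i j => ?_⟩
  · refine ae_eq_of_ft_ae_eq (hs i j k).right (hs i k j).right ?_
    filter_upwards [fs i j k, fs i k j] with ξ e1 e2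
    rw [e1, e2]; ring
  · refine (hl i j).weak.weakPartial_ae ?_
    have e : ∀ k, weakPartial k (weakPartial k fun y => v y i) =ᵐ[volume] s i k k := fun k =>
      (hs i k k).weak.weakPartial_ae .rfl
    filter_upwards [ae_all_iff.2 e] with x hx
    simp [weakLaplacian, hx]

/-! ### The weak formulation in frequency variables. -/

theorem pairGrad_testPair {w : E3 → E3} (hw : MemH1 w) {F : E3 → E3}
    {γ : Fin 3 → SchwartzMap E3 ℂ} (hγ : ∀ i, IsTestPair (fun x => F x i) (γ i)) :
    ((pairGrad w F : ℝ) : ℂ)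
      = ∑ i, ∫ ξ, ((4 * Real.pi ^ 2 * ‖ξ‖ ^ 2 : ℝ) : ℂ) * ftc w i ξ * γ i ξ := by
  have hd := fun i j => hw.exists_isWD i j
  have e1 : pairGrad w F = ∑ i, ∑ j, ∫ x, weakPartial j (fun y => w y i) x *
      partialD j (fun y => F y i) x := by
    have hi : ∀ i j, Integrable fun x => weakPartial j (fun y => w y i) x *
        partialD j (fun y => F y i) x := fun i j =>
      (hd i j).right.integrable_mul (memLp_test ((hγ i).partialD j).1.continuous
        ((hγ i).partialD j).2.1)
    unfold pairGrad
    rw [integral_finsetSum _ fun i _ => integrable_finsetSum _ fun j _ => hi i j]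
    exact Finset.sum_congr rfl fun i _ => integral_finsetSum _ fun j _ => hi i j
  rw [e1]
  push_cast
  refine Finset.sum_congr rfl fun i _ => ?_
  have e2 : ∀ j, ((∫ x, weakPartial j (fun y => w y i) x * partialD j (fun y => F y i) x : ℝ) : ℂ)
      = ∫ ξ, -(ftc w i ξ * mulFreq j (mulFreq j (γ i)) ξ) := by
    intro j
    rw [← ((hγ i).partialD j).integral_ft (hd i j).right]
    refine integral_congr_ae ?_
    filter_upwards [(hd i j).ft_eq] with ξ hξ
    rw [hξ]
    simp only [mulFreq_apply, ftc]
    ring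
  simp only [e2]
  have i0 : ∀ j, Integrable fun ξ => -(ftc w i ξ * mulFreq j (mulFreq j (γ i)) ξ) := fun j =>
    ((tempered_of_memLp (memLp_ftc w i)).2 _).neg
  rw [← integral_finsetSum _ fun j _ => i0 j]
  congr 1
  ext ξ
  rw [Finset.sum_neg_distrib, ← Finset.mul_sum, sum_mulFreq_mulFreq]
  push_cast
  ring

/-- The inertial force is only known to be integrable, as a sum of products of L² functions, so its
transform is the classical continuous and bounded one. This still pairs with Schwartz functions. -/
theorem inertia_testPair {α : ℝ} {v : E3 → E3} {d s l} (h : IsRegular (fun i x => v x i) d s l)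
    (hd : ∀ i j, weakPartial j (fun x => v x i) =ᵐ[volume] d i j)
    (hl : ∀ i j, weakPartial j (fun x => weakLaplacian v x i) =ᵐ[volume] l i j)
    {F : E3 → E3} {γ : Fin 3 → SchwartzMap E3 ℂ} (hγ : ∀ i, IsTestPair (fun x => F x i) (γ i)) :
    ((trilinear v v F - α * trilinear v (weakLaplacian v) F
      + α * trilinear F (weakLaplacian v) v : ℝ) : ℂ)
      = ∑ i, ∫ ξ, 𝓕 (fun x => (inertia α (fun i x => v x i) d l i x : ℂ)) ξ * γ i ξ := by
  have hb : ∀ i {f g : E3 → ℝ}, MemLp f 2 volume → MemLp g 2 volume →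
      Integrable fun x => f x * g x * F x i := by
    intro i f g hf hg
    obtain ⟨C, hC⟩ := (hγ i).1.continuous.bounded_above_of_compact_support (hγ i).2.1
    exact (hf.integrable_mul hg).mul_bdd (c := C) (hγ i).1.continuous.aestronglyMeasurable
      (Eventually.of_forall hC)
  have t1 : trilinear v v F = ∑ i, ∑ j, ∫ x, v x j * d i j x * F x i := by
    have : trilinear v v F = ∫ x, ∑ i, ∑ j, v x j * d i j x * F x i := by
      refine integral_congr_ae ?_
      filter_upwards [ae_all_iff.2 fun i => ae_all_iff.2 fun j => hd i j] with x hx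
      simp only [hx]
    have hi : ∀ i j, Integrable fun x => v x j * d i j x * F x i := fun i j =>
      hb i (h.memLp_v j) (h.memLp_d i j)
    rw [this, integral_finsetSum _ fun i _ => integrable_finsetSum _ fun j _ => hi i j]
    exact Finset.sum_congr rfl fun i _ => integral_finsetSum _ fun j _ => hi i j
  have t2 : trilinear v (weakLaplacian v) F = ∑ i, ∑ j, ∫ x, v x j * l i j x * F x i := by
    have : trilinear v (weakLaplacian v) F = ∫ x, ∑ i, ∑ j, v x j * l i j x * F x i := by
      refine integral_congr_ae ?_
      filter_upwards [ae_all_iff.2 fun i => ae_all_iff.2 fun j => hl i j] with x hx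
      simp only [hx]
    have hi : ∀ i j, Integrable fun x => v x j * l i j x * F x i := fun i j =>
      hb i (h.memLp_v j) (h.memLp_l i j)
    rw [this, integral_finsetSum _ fun i _ => integrable_finsetSum _ fun j _ => hi i j]
    exact Finset.sum_congr rfl fun i _ => integral_finsetSum _ fun j _ => hi i j
  have t3 : trilinear F (weakLaplacian v) v = ∑ i, ∑ j, ∫ x, v x j * l j i x * F x i := by
    have : trilinear F (weakLaplacian v) v = ∫ x, ∑ i, ∑ j, v x j * l j i x * F x i := by
      refine integral_congr_ae ?_
      filter_upwards [ae_all_iff.2 fun i => ae_all_iff.2 fun j => hl i j] with x hx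
      simp only [hx]
      rw [Finset.sum_comm]
      exact Finset.sum_congr rfl fun i _ => Finset.sum_congr rfl fun j _ => by ring
    have hi : ∀ i j, Integrable fun x => v x j * l j i x * F x i := fun i j =>
      hb i (h.memLp_v j) (h.memLp_l j i)
    rw [this, integral_finsetSum _ fun i _ => integrable_finsetSum _ fun j _ => hi i j]
    exact Finset.sum_congr rfl fun i _ => integral_finsetSum _ fun j _ => hi i j
  have e : ∀ i, ∫ ξ, 𝓕 (fun x => (inertia α (fun i x => v x i) d l i x : ℂ)) ξ * γ i ξ
      = ((∑ j, (∫ x, v x j * d i j x * F x i) - α * ∑ j, (∫ x, v x j * l i j x * F x i)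
        + α * ∑ j, (∫ x, v x j * l j i x * F x i) : ℝ) : ℂ) := by
    intro i
    have hn : Integrable fun x => (inertia α (fun i x => v x i) d l i x : ℂ) :=
      (h.integrable_inertia i).ofReal
    rw [integral_fourier_mul_schwartz hn, Finset.mul_sum,
      Finset.mul_sum, ← Finset.sum_sub_distrib, ← Finset.sum_add_distrib]
    have i1 := fun j => hb i (h.memLp_v j) (h.memLp_d i j)
    have i2 := fun j => (hb i (h.memLp_v j) (h.memLp_l i j)).const_mul α
    have i3 := fun j => (hb i (h.memLp_v j) (h.memLp_l j i)).const_mul α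
    have i4 : ∀ j, Integrable fun x => v x j * d i j x * F x i - α * (v x j * l i j x * F x i) :=
      fun j => (i1 j).sub (i2 j)
    have e0 : ∀ j, (∫ x, v x j * d i j x * F x i) - α * (∫ x, v x j * l i j x * F x i)
        + α * (∫ x, v x j * l j i x * F x i) = ∫ x, (v x j * d i j x * F x i
          - α * (v x j * l i j x * F x i) + α * (v x j * l j i x * F x i)) := by
      intro j
      rw [integral_add (i4 j) (i3 j), integral_sub (i1 j) (i2 j), integral_const_mul,
        integral_const_mul]
    simp only [e0]
    have i5 : ∀ j, Integrable fun x => v x j * d i j x * F x i - α * (v x j * l i j x * F x i)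
        + α * (v x j * l j i x * F x i) := fun j => (i4 j).add (i3 j)
    rw [← integral_finsetSum _ fun j _ => i5 j, ← integral_complex_ofReal]
    refine integral_congr_ae (Eventually.of_forall fun x => ?_)
    simp only [← (hγ i).2.2 x, inertia]
    rw [← Complex.ofReal_mul, Finset.sum_mul]
    congr 1
    exact Finset.sum_congr rfl fun j _ => by ring
  simp only [e]
  rw [t1, t2, t3]
  push_cast
  rw [Finset.sum_add_distrib, Finset.sum_sub_distrib, Finset.mul_sum, Finset.mul_sum]

theorem tempered_fourier {f : E3 → ℂ} (hf : Integrable f) : Tempered (𝓕 f) := by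
  have hc : Continuous (𝓕 f) := VectorFourier.fourierIntegral_continuous
    Real.continuous_fourierChar (by exact continuous_inner) hf
  exact tempered_of_bounded hc.aestronglyMeasurable (C := ∫ x, ‖f x‖) fun ξ =>
    VectorFourier.norm_fourierIntegral_le_integral_norm _ _ _ _ _

/-- A vector parallel to `ξ` is orthogonal to every vector orthogonal to `ξ`. -/
theorem sum_mul_eq_zero_of_parallel {ξ : E3} (hξ : ξ ≠ 0) {Z V : Fin 3 → ℂ}
    (hZ : ∀ l, ∑ i, curlSymbol l i ξ * Z i = 0) (hV : ∑ i, (ξ i : ℂ) * V i = 0) :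
    ∑ i, Z i * V i = 0 := by
  have hc : -(2 * Real.pi * Complex.I : ℂ) ≠ 0 := by simp [Real.pi_ne_zero]
  have h : ∀ l : Fin 3, (ξ (l + 2) : ℂ) * Z (l + 1) - ξ (l + 1) * Z (l + 2) = 0 := fun l => by
    have := hZ l
    rw [curlSymbol_sum] at this
    exact (mul_eq_zero.1 this).resolve_left hc
  have h0 := h 0
  have h1 := h 1
  have h2 := h 2
  simp at h0 h1 h2
  have hn : ((‖ξ‖ ^ 2 : ℝ) : ℂ) ≠ 0 := by
    simp [hξ]
  -- After multiplication by |ξ|², the sum is (ξ·Z)(ξ·V) plus terms containing the components of ξ ×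
  -- Z; both vanish.
  refine (mul_eq_zero.1 (?_ : ((‖ξ‖ ^ 2 : ℝ) : ℂ) * _ = 0)).resolve_left hn
  rw [norm_sq_coord]
  push_cast
  simp only [Fin.sum_univ_three] at hV ⊢
  linear_combination (ξ 0 * Z 0 + ξ 1 * Z 1 + ξ 2 * Z 2 : ℂ) * hV
    + h0 * (-(ξ 1 : ℂ) * V 2 + ξ 2 * V 1) + h1 * (-(ξ 2 : ℂ) * V 0 + ξ 0 * V 2)
    + h2 * (-(ξ 0 : ℂ) * V 1 + ξ 1 * V 0)

/-- The weak formulation at a fixed time, frequency by frequency. -/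
theorem weakForm_freq {α μ : ℝ} {v w : E3 → E3} (hv : MemV2 α v) (hw : MemV w) {d s l}
    (h : IsRegular (fun i x => v x i) d s l)
    (hd : ∀ i j, weakPartial j (fun x => v x i) =ᵐ[volume] d i j)
    (hl : ∀ i j, weakPartial j (fun x => weakLaplacian v x i) =ᵐ[volume] l i j)
    (hweak : ∀ φ : E3 → E3, IsSolenoidalTestField φ →
      pairL2 w φ + α * pairGrad w φ + μ * pairGrad v φ
        + trilinear v v φ - α * trilinear v (weakLaplacian v) φ
        + α * trilinear φ (weakLaplacian v) v = 0) :
    ∀ᵐ ξ : E3, ∑ i, ((stressSymbol α ξ : ℂ) * ftc w i ξ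
      + ((4 * Real.pi ^ 2 * μ * ‖ξ‖ ^ 2 : ℝ) : ℂ) * ftc v i ξ
      + 𝓕 (fun x => (inertia α (fun i x => v x i) d l i x : ℂ)) ξ)
        * (starRingEnd ℂ) (ftc v i ξ) = 0 := by
  set n : Fin 3 → E3 → ℂ := fun i => 𝓕 (fun x => (inertia α (fun i x => v x i) d l i x : ℂ))
    with hn
  have hT1 : ∀ i, Tempered fun ξ => (stressSymbol α ξ : ℂ) * ftc w i ξ := fun i =>
    (tempered_of_memLp (memLp_ftc w i)).mul (hasTemperateGrowth_stressSymbol α)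
  have hT2 : ∀ (c : ℝ) (v : E3 → E3) i, Tempered fun ξ =>
      ((4 * Real.pi ^ 2 * c * ‖ξ‖ ^ 2 : ℝ) : ℂ) * ftc v i ξ := by
    intro c v i
    have := ((tempered_of_memLp (memLp_ftc v i)).mul hasTemperateGrowth_normSq).const_mul
      ((4 * Real.pi ^ 2 * c : ℝ) : ℂ)
    refine this.congr (Eventually.of_forall fun ξ => ?_)
    push_cast; ring
  have hT3 : ∀ i, Tempered (n i) := fun i => tempered_fourier (h.integrable_inertia i).ofReal
  have hT : ∀ i, Tempered fun ξ => (stressSymbol α ξ : ℂ) * ftc w i ξ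
      + ((4 * Real.pi ^ 2 * μ * ‖ξ‖ ^ 2 : ℝ) : ℂ) * ftc v i ξ + n i ξ := fun i =>
    ((hT1 i).add (hT2 μ v i)).add (hT3 i)
  -- Tests of the form curl(χ e_m) determine the curl of the residual and nothing more. A pressure
  -- gradient, being parallel to ξ, is invisible to them.
  have hcurl : ∀ l : Fin 3, ∀ᵐ ξ : E3, ∑ i, curlSymbol l i ξ * ((stressSymbol α ξ : ℂ) * ftc w i ξ
      + ((4 * Real.pi ^ 2 * μ * ‖ξ‖ ^ 2 : ℝ) : ℂ) * ftc v i ξ + n i ξ) = 0 := by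
    intro m
    have hS := Tempered.sum Finset.univ fun i _ => (hT i).mul (hasTemperateGrowth_curlSymbol m i)
    refine hS.ae_eq_zero fun φ hφ => ?_
    obtain ⟨χ, hχ⟩ := hφ.exists_pair
    choose γ hγ hγv using hχ.curl m
    have e := hweak _ (isSolenoidalTestField_curl m hχ.1 hχ.2.1)
    have e1 := integral_sum_mul_testPair hw.1.1 hγ
    have e2 := pairGrad_testPair hw.1 hγ
    have e3 := pairGrad_testPair hv.1.1 hγ
    have e4 := inertia_testPair (α := α) h hd hl hγ
    have e5 : ((0 : ℝ) : ℂ) = _ := congrArg Complex.ofReal e.symm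
    unfold pairL2 at e5
    have i1 := fun i => (tempered_of_memLp (memLp_ftc w i)).2 (γ i)
    have hT2' : ∀ (v : E3 → E3) i, Tempered fun ξ =>
        ((4 * Real.pi ^ 2 * ‖ξ‖ ^ 2 : ℝ) : ℂ) * ftc v i ξ := fun v i => by
      simpa using hT2 1 v i
    have i2 := fun i => ((hT2' w i).2 (γ i)).const_mul (α : ℂ)
    have i3 := fun i => ((hT2' v i).2 (γ i)).const_mul (μ : ℂ)
    have i4 := fun i => (hT3 i).2 (γ i)
    have i12 : ∀ i, Integrable fun ξ => ftc w i ξ * γ i ξ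
      + (α : ℂ) * (((4 * Real.pi ^ 2 * ‖ξ‖ ^ 2 : ℝ) : ℂ) * ftc w i ξ * γ i ξ) :=
      fun i => (i1 i).add (i2 i)
    have i123 : ∀ i, Integrable fun ξ => ftc w i ξ * γ i ξ
      + (α : ℂ) * (((4 * Real.pi ^ 2 * ‖ξ‖ ^ 2 : ℝ) : ℂ) * ftc w i ξ * γ i ξ)
      + (μ : ℂ) * (((4 * Real.pi ^ 2 * ‖ξ‖ ^ 2 : ℝ) : ℂ) * ftc v i ξ * γ i ξ) :=
      fun i => (i12 i).add (i3 i)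
    have e6 : ∫ ξ, (∑ i, curlSymbol m i ξ * ((stressSymbol α ξ : ℂ) * ftc w i ξ
        + ((4 * Real.pi ^ 2 * μ * ‖ξ‖ ^ 2 : ℝ) : ℂ) * ftc v i ξ + n i ξ)) * φ ξ
        = ∑ i, ((∫ ξ, ftc w i ξ * γ i ξ)
          + α * (∫ ξ, ((4 * Real.pi ^ 2 * ‖ξ‖ ^ 2 : ℝ) : ℂ) * ftc w i ξ * γ i ξ)
          + μ * (∫ ξ, ((4 * Real.pi ^ 2 * ‖ξ‖ ^ 2 : ℝ) : ℂ) * ftc v i ξ * γ i ξ)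
          + ∫ ξ, n i ξ * γ i ξ) := by
      have e7 : ∀ i, (∫ ξ, ftc w i ξ * γ i ξ)
          + α * (∫ ξ, ((4 * Real.pi ^ 2 * ‖ξ‖ ^ 2 : ℝ) : ℂ) * ftc w i ξ * γ i ξ)
          + μ * (∫ ξ, ((4 * Real.pi ^ 2 * ‖ξ‖ ^ 2 : ℝ) : ℂ) * ftc v i ξ * γ i ξ)
          + ∫ ξ, n i ξ * γ i ξ = ∫ ξ, (ftc w i ξ * γ i ξ
          + (α : ℂ) * (((4 * Real.pi ^ 2 * ‖ξ‖ ^ 2 : ℝ) : ℂ) * ftc w i ξ * γ i ξ)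
          + (μ : ℂ) * (((4 * Real.pi ^ 2 * ‖ξ‖ ^ 2 : ℝ) : ℂ) * ftc v i ξ * γ i ξ)
          + n i ξ * γ i ξ) := by
        intro i
        rw [integral_add (i123 i) (i4 i), integral_add (i12 i) (i3 i), integral_add (i1 i) (i2 i),
          integral_const_mul, integral_const_mul]
      simp only [e7]
      have i1234 : ∀ i, Integrable fun ξ => ftc w i ξ * γ i ξ
          + (α : ℂ) * (((4 * Real.pi ^ 2 * ‖ξ‖ ^ 2 : ℝ) : ℂ) * ftc w i ξ * γ i ξ)
          + (μ : ℂ) * (((4 * Real.pi ^ 2 * ‖ξ‖ ^ 2 : ℝ) : ℂ) * ftc v i ξ * γ i ξ)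
          + n i ξ * γ i ξ := fun i => (i123 i).add (i4 i)
      rw [← integral_finsetSum _ fun i _ => i1234 i]
      refine integral_congr_ae (Eventually.of_forall fun ξ => ?_)
      simp only [Finset.sum_mul, hγv, stressSymbol]
      refine Finset.sum_congr rfl fun i _ => ?_
      push_cast
      ring
    rw [e6]
    simp only [Finset.sum_add_distrib, ← Finset.mul_sum]
    rw [← e1, ← e2, ← e3, hn, ← e4]
    rw [Complex.ofReal_zero] at e5
    rw [e5]
    push_cast
    ring
  -- A vanishing cross product with ξ forces parallelism only for ξ ≠ 0, which excludes a null set.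
  have h0 : ∀ᵐ ξ : E3, ξ ≠ 0 := by
    simp [ae_iff, measure_singleton]
  filter_upwards [ae_all_iff.2 hcurl, hv.1.freq_div, h0] with ξ h1 h2 h3
  refine sum_mul_eq_zero_of_parallel h3 (Z := fun i => _) h1 ?_
  have := congrArg (starRingEnd ℂ) h2
  simpa using this

/-! ### Densities in frequency space, and the work of the inertial force. -/

/-- `(1 + 4π² α |ξ|²) |v̂(ξ)|²`. -/
def energyDensity (α : ℝ) (v : E3 → E3) (ξ : E3) : ℝ := stressSymbol α ξ * ∑ i, ‖ftc v i ξ‖ ^ 2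

/-- `(1 + 4π² α |ξ|²) Re ⟨ŵ(ξ), v̂(ξ)⟩`. -/
def crossDensity (α : ℝ) (w v : E3 → E3) (ξ : E3) : ℝ :=
  stressSymbol α ξ * ∑ i, (ftc w i ξ * (starRingEnd ℂ) (ftc v i ξ)).re

/-- The transform of the inertial force paired with that of `v`. -/
def inertiaDensity (α : ℝ) (v : E3 → E3) (d l : Fin 3 → Fin 3 → E3 → ℝ) (ξ : E3) : ℂ :=
  ∑ i, 𝓕 (fun x => (inertia α (fun i x => v x i) d l i x : ℂ)) ξ * (starRingEnd ℂ) (ftc v i ξ)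

section

variable {α μ : ℝ} {v w : E3 → E3} {d : Fin 3 → Fin 3 → E3 → ℝ}
  {s : Fin 3 → Fin 3 → Fin 3 → E3 → ℝ} {l : Fin 3 → Fin 3 → E3 → ℝ}

/-- The kernel is cos - i sin, and cos(x + π/2) = -sin x, so the imaginary part is the wave of phase
π/2 with a plus sign. -/
theorem fourier_eq_waveInt {f : E3 → ℝ} (hf : Integrable f) (ξ : E3) :
    𝓕 (fun x => (f x : ℂ)) ξ = ((∫ x, f x * wave ξ 0 x : ℝ) : ℂ)
      + ((∫ x, f x * wave ξ (Real.pi / 2) x : ℝ) : ℂ) * Complex.I := by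
  have hi : ∀ θ, Integrable fun x => f x * wave ξ θ x := fun θ =>
    hf.mul_bdd (c := 1) (contDiff_wave ξ θ).continuous.aestronglyMeasurable
      (Eventually.of_forall (abs_wave_le ξ θ))
  rw [← integral_complex_ofReal, ← integral_complex_ofReal, ← integral_mul_const,
    ← integral_add (hi _).ofReal ((hi _).ofReal.mul_const _), Real.fourier_eq]
  refine integral_congr_ae (Eventually.of_forall fun x => ?_)
  simp only [Circle.smul_def, Real.fourierChar_apply, smul_eq_mul, wave, Real.cos_add_pi_div_two,
    add_zero]
  have e : (((2 * Real.pi * -inner ℝ x ξ : ℝ) : ℂ)) * Complex.I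
    = -((2 * Real.pi * inner ℝ x ξ : ℝ) : ℂ) * Complex.I := by push_cast; ring
  rw [e, Complex.exp_mul_I, Complex.cos_neg, Complex.sin_neg]
  push_cast
  ring

/-- The real and imaginary parts of v̂(ξ) are each orthogonal to ξ, hence admissible amplitudes for
the plane-wave bound. Two parts times two phases give four pairings, whence 8000 = 4 · 2000. -/
theorem IsRegular.abs_inertiaDensity_le (h : IsRegular (fun i x => v x i) d s l) (hα : 0 ≤ α)
    {H : ℝ} (h1 : ∀ i, ∫ x, v x i ^ 2 ≤ H) (h2 : ∀ i j, ∫ x, d i j x ^ 2 ≤ H) {ξ : E3}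
    (hξ : ∑ i, (ξ i : ℂ) * ftc v i ξ = 0) :
    ‖inertiaDensity α v d l ξ‖ ≤ 8000 * (1 + α) * (‖ξ‖ * (1 + ‖ξ‖)) * H *
      Real.sqrt (∑ i, ‖ftc v i ξ‖ ^ 2) := by
  set A := Real.sqrt (∑ i, ‖ftc v i ξ‖ ^ 2) with hA
  set p : Fin 3 → ℝ := fun i => (ftc v i ξ).re with hp
  set q : Fin 3 → ℝ := fun i => (ftc v i ξ).im with hq
  have hle : ∀ i, ‖ftc v i ξ‖ ≤ A := fun i => by
    apply Real.le_sqrt_of_sq_le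
    exact Finset.single_le_sum (f := fun i => ‖ftc v i ξ‖ ^ 2) (fun i _ => by positivity)
      (Finset.mem_univ i)
  have hpA : ∀ i, |p i| ≤ A := fun i => (Complex.abs_re_le_norm _).trans (hle i)
  have hqA : ∀ i, |q i| ≤ A := fun i => (Complex.abs_im_le_norm _).trans (hle i)
  have hp0 : ∑ i, p i * ξ i = 0 := by
    have := congrArg Complex.re hξ
    simpa [mul_comm] using this
  have hq0 : ∑ i, q i * ξ i = 0 := by
    have := congrArg Complex.im hξ
    simpa [mul_comm] using this
  set N : ℝ → Fin 3 → ℝ := fun θ i => ∫ x, inertia α (fun i x => v x i) d l i x * wave ξ θ x with hN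
  set B := 2000 * (1 + α) * (A * (‖ξ‖ * (1 + ‖ξ‖)) * H) with hB
  have bp : ∀ θ, |∑ i, p i * N θ i| ≤ B := fun θ => h.abs_inertia_wave_le hα h1 h2 ξ θ hp0 hpA
  have bq : ∀ θ, |∑ i, q i * N θ i| ≤ B := fun θ => h.abs_inertia_wave_le hα h1 h2 ξ θ hq0 hqA
  have e : inertiaDensity α v d l ξ = ((∑ i, p i * N 0 i : ℝ) : ℂ)
      + ((∑ i, p i * N (Real.pi / 2) i : ℝ) : ℂ) * Complex.I
      - ((∑ i, q i * N 0 i : ℝ) : ℂ) * Complex.I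
      + ((∑ i, q i * N (Real.pi / 2) i : ℝ) : ℂ) := by
    unfold inertiaDensity
    push_cast
    rw [Finset.sum_mul, Finset.sum_mul, ← Finset.sum_add_distrib, ← Finset.sum_sub_distrib,
      ← Finset.sum_add_distrib]
    refine Finset.sum_congr rfl fun i _ => ?_
    rw [fourier_eq_waveInt (h.integrable_inertia i)]
    have : (starRingEnd ℂ) (ftc v i ξ) = (p i : ℂ) - (q i : ℂ) * Complex.I := by
      apply Complex.ext <;> simp [hp, hq]
    rw [this]
    linear_combination (-(N (Real.pi / 2) i : ℂ) * q i) * Complex.I_sq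
  rw [e]
  calc _ ≤ |∑ i, p i * N 0 i| + |∑ i, p i * N (Real.pi / 2) i| + |∑ i, q i * N 0 i|
        + |∑ i, q i * N (Real.pi / 2) i| := by
        refine (norm_add_le _ _).trans (add_le_add ((norm_sub_le _ _).trans (add_le_add
          ((norm_add_le _ _).trans (add_le_add ?_ ?_)) ?_)) ?_) <;>
        simp only [norm_mul, Complex.norm_I, mul_one, Complex.norm_real, Real.norm_eq_abs, le_refl]
    _ ≤ 4 * B := by linarith [bp 0, bp (Real.pi / 2), bq 0, bq (Real.pi / 2)]
    _ = _ := by rw [hB]; ring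

/-- Fourier inversion with an integrable transform. Boundedness is needed to test the merely
integrable inertial force against v itself. -/
theorem MemV2.exists_bound (hα : 0 < α) (hv : MemV2 α v) : ∃ C, ∀ i, ∀ᵐ x, |v x i| ≤ C := by
  refine ⟨∑ i, ∫ ξ, ‖ftc v i ξ‖, fun i => ?_⟩
  filter_upwards [ae_eq_fourierInv_ft (memLp_coord hv.1.1.1 i) (hv.integrable_ftc hα i)] with x hx
  have h1 : ‖(v x i : ℂ)‖ ≤ ∫ ξ, ‖ftc v i ξ‖ := by
    rw [hx, Real.fourierInv_eq_fourier_neg]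
    exact VectorFourier.norm_fourierIntegral_le_integral_norm _ _ _ _ _
  rw [Complex.norm_real, Real.norm_eq_abs] at h1
  exact h1.trans (Finset.single_le_sum (f := fun i => ∫ ξ, ‖ftc v i ξ‖)
    (fun i _ => integral_nonneg fun _ => norm_nonneg _) (Finset.mem_univ i))

theorem memLp_mul_ae_bounded {f g : E3 → ℝ} (hf : MemLp f 2 volume)
    (hg : AEStronglyMeasurable g volume) {C : ℝ} (hC : ∀ᵐ x, |g x| ≤ C) :
    MemLp (fun x => f x * g x) 2 volume := by
  refine hf.of_le_mul (c := C) (hf.1.mul hg) ?_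
  filter_upwards [hC] with x hx
  rw [norm_mul, mul_comm, Real.norm_eq_abs, Real.norm_eq_abs]
  exact mul_le_mul_of_nonneg_right hx (abs_nonneg _)

/-- The inertial force does no work. -/
theorem IsRegular.integral_inertia_mul (h : IsRegular (fun i x => v x i) d s l) {C : ℝ}
    (hC : ∀ i, ∀ᵐ x, |v x i| ≤ C) :
    ∑ i, ∫ x, inertia α (fun i x => v x i) d l i x * v x i = 0 := by
  have hm := fun i => (h.memLp_v i).1
  have i0 : ∀ i, Integrable fun x => inertia α (fun i x => v x i) d l i x * v x i := fun i =>
    (h.integrable_inertia i).mul_bdd (c := C) (hm i) (hC i)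
  have hvv : ∀ i j, MemLp (fun x => v x j * v x i) 2 volume := fun i j =>
    memLp_mul_ae_bounded (h.memLp_v j) (hm i) (hC i)
  have hwd : ∀ i j, IsWD j (fun x => v x j * v x i)
      (fun x => d j j x * v x i + v x j * d i j x) := by
    intro i j
    refine (h.wd_v j j).mul (h.wd_v i j) (hvv i j) ?_
    refine (memLp_mul_ae_bounded (h.memLp_d j j) (hm i) (hC i)).add ?_
    simpa only [mul_comm] using! memLp_mul_ae_bounded (h.memLp_d i j) (hm j) (hC j)
  have i1 : ∀ i j, Integrable fun x => v x j * v x i * d i j x := fun i j =>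
    (hvv i j).integrable_mul (h.memLp_d i j)
  have i2 : ∀ i j, Integrable fun x => d j j x * (v x i * v x i) := fun i j =>
    (h.memLp_d j j).integrable_mul (hvv i i)
  -- This is vⱼ vᵢ ∂ⱼvᵢ = ½ vⱼ ∂ⱼ(vᵢ²), integrated by parts; summed over j, it involves only the
  -- divergence.
  have e1 : ∀ i j, 2 * ∫ x, v x j * v x i * d i j x = -∫ x, d j j x * (v x i * v x i) := by
    intro i j
    have e := (hwd i j).integral_mul (h.wd_v i j)
    have e' : ∫ x, (d j j x * v x i + v x j * d i j x) * v x i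
        = (∫ x, d j j x * (v x i * v x i)) + ∫ x, v x j * v x i * d i j x := by
      rw [← integral_add (i2 i j) (i1 i j)]
      congr 1; ext x; ring
    rw [e'] at e
    linarith
  have e2 : ∑ i, ∑ j, ∫ x, v x j * v x i * d i j x = 0 := by
    have : 2 * ∑ i, ∑ j, ∫ x, v x j * v x i * d i j x = 0 := by
      simp only [Finset.mul_sum, e1]
      refine Finset.sum_eq_zero fun i _ => ?_
      rw [Finset.sum_neg_distrib, ← integral_finsetSum _ fun j _ => i2 i j, neg_eq_zero,
        ← integral_zero E3 ℝ]
      refine integral_congr_ae ?_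
      filter_upwards [h.div] with x hx
      simp only [← Finset.sum_mul, hx, zero_mul]
    linarith
  rw [← integral_finsetSum _ fun i _ => i0 i, ← e2]
  have e3 : ∑ i, ∑ j, ∫ x, v x j * v x i * d i j x = ∫ x, ∑ i, ∑ j, v x j * v x i * d i j x := by
    rw [integral_finsetSum _ fun i _ => integrable_finsetSum _ fun j _ => i1 i j]
    exact Finset.sum_congr rfl fun i _ => (integral_finsetSum _ fun j _ => i1 i j).symm
  rw [e3]
  -- The two terms with `α` cancel pointwise in the double sum, since exchanging i and j maps one to
  -- the other. Only the convective term is left.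
  refine integral_congr_ae (Eventually.of_forall fun x => ?_)
  simp only [inertia, Fin.sum_univ_three]
  ring

/-- Because v̂ is integrable, Parseval reduces to Fubini: the transform moves onto the conjugate of
v̂, where inversion returns v. The integral is then the work of the inertial force. -/
theorem MemV2.integral_inertiaDensity (hα : 0 < α) (hv : MemV2 α v)
    (h : IsRegular (fun i x => v x i) d s l) :
    Integrable (inertiaDensity α v d l) ∧ ∫ ξ, inertiaDensity α v d l ξ = 0 := by
  obtain ⟨C, hC⟩ := hv.exists_bound hα
  have hn : ∀ i, Integrable fun x => (inertia α (fun i x => v x i) d l i x : ℂ) := fun i =>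
    (h.integrable_inertia i).ofReal
  have hf := fun i => hv.integrable_ftc hα i
  have hcf : ∀ i, Integrable fun ξ => (starRingEnd ℂ) (ftc v i ξ) := fun i =>
    Complex.conjCLE.toContinuousLinearMap.integrable_comp (hf i)
  have i1 : ∀ i, Integrable fun ξ => 𝓕 (fun x => (inertia α (fun i x => v x i) d l i x : ℂ)) ξ
      * (starRingEnd ℂ) (ftc v i ξ) := fun i =>
    (hcf i).bdd_mul (tempered_fourier (hn i)).1 (c := ∫ x, ‖(inertia α (fun i x => v x i) d l i x : ℂ)‖)
      (Eventually.of_forall fun ξ => VectorFourier.norm_fourierIntegral_le_integral_norm _ _ _ _ _)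
  refine ⟨integrable_finsetSum _ fun i _ => i1 i, ?_⟩
  unfold inertiaDensity
  rw [integral_finsetSum _ fun i _ => i1 i]
  have e : ∀ i, ∫ ξ, 𝓕 (fun x => (inertia α (fun i x => v x i) d l i x : ℂ)) ξ
      * (starRingEnd ℂ) (ftc v i ξ)
      = ((∫ x, inertia α (fun i x => v x i) d l i x * v x i : ℝ) : ℂ) := by
    intro i
    rw [integral_fourier_mul_flip (hn i) (hcf i), ← integral_complex_ofReal]
    refine integral_congr_ae ?_
    filter_upwards [ae_eq_fourierInv_ft (memLp_coord hv.1.1.1 i) (hf i)] with x hx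
    have : 𝓕 (fun ξ => (starRingEnd ℂ) (ftc v i ξ)) x = (v x i : ℂ) := by
      have h2 := congrArg (starRingEnd ℂ) hx
      rw [Complex.conj_ofReal] at h2
      rw [h2, Real.fourierInv_eq, Real.fourier_eq, ← integral_conj]
      refine integral_congr_ae (Eventually.of_forall fun ξ => ?_)
      simp only [Circle.smul_def, smul_eq_mul, map_mul, AddChar.map_neg_eq_inv, Circle.coe_inv_eq_conj]
      rfl
    rw [this]; push_cast; rfl
  simp only [e]
  rw [← Complex.ofReal_sum, h.integral_inertia_mul hC, Complex.ofReal_zero]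

end

/-! ### Energy identity and low-frequency estimate at a fixed time. -/

/-- The weak formulation at a fixed time. -/
def WeakFormAt (α μ : ℝ) (v w : E3 → E3) : Prop :=
  ∀ φ : E3 → E3, IsSolenoidalTestField φ →
    pairL2 w φ + α * pairGrad w φ + μ * pairGrad v φ
      + trilinear v v φ - α * trilinear v (weakLaplacian v) φ
      + α * trilinear φ (weakLaplacian v) v = 0

section

variable {α μ : ℝ} {v w : E3 → E3}

theorem ftc_aesm (v : E3 → E3) (i : Fin 3) : AEStronglyMeasurable (ftc v i) volume := (memLp_ftc v i).1

theorem continuous_stressSymbol (α : ℝ) : Continuous (stressSymbol α) := by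
  unfold stressSymbol; fun_prop

theorem stressSymbol_ge_one (hα : 0 ≤ α) (ξ : E3) : 1 ≤ stressSymbol α ξ := by
  unfold stressSymbol
  have : 0 ≤ 4 * Real.pi ^ 2 * α * ‖ξ‖ ^ 2 := by positivity
  linarith

theorem energyDensity_nonneg (hα : 0 ≤ α) (v : E3 → E3) (ξ : E3) : 0 ≤ energyDensity α v ξ :=
  mul_nonneg (stressSymbol_pos hα ξ).le (Finset.sum_nonneg fun i _ => by positivity)

theorem normSq_le_energyDensity (hα : 0 ≤ α) (v : E3 → E3) (ξ : E3) :
    ∑ i, ‖ftc v i ξ‖ ^ 2 ≤ energyDensity α v ξ :=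
  le_mul_of_one_le_left (Finset.sum_nonneg fun i _ => by positivity) (stressSymbol_ge_one hα ξ)

theorem integrable_ftc_sq (v : E3 → E3) (i : Fin 3) : Integrable fun ξ => ‖ftc v i ξ‖ ^ 2 :=
  (memLp_two_iff_integrable_sq_norm (ftc_aesm v i)).1 (memLp_ftc v i)

/-- `H¹` regularity gives a square-integrable `ξ v̂`. -/
theorem MemH1.memLp_freq (h : MemH1 v) (i j : Fin 3) :
    MemLp (fun ξ : E3 => (ξ j : ℂ) * ftc v i ξ) 2 volume := by
  have h1 := (memLp_ft (weakPartial j fun x => v x i)).const_mul (2 * Real.pi * Complex.I)⁻¹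
  refine h1.ae_eq ?_
  filter_upwards [(h.exists_isWD i j).ft_eq] with ξ hξ
  have hc : (2 * Real.pi * Complex.I : ℂ) ≠ 0 := by simp [Real.pi_ne_zero]
  rw [hξ, ftc]
  field_simp

theorem MemH1.integrable_freq_sq (h : MemH1 v) :
    Integrable fun ξ : E3 => ‖ξ‖ ^ 2 * ∑ i, ‖ftc v i ξ‖ ^ 2 := by
  have : ∀ i j, Integrable fun ξ : E3 => ‖(ξ j : ℂ) * ftc v i ξ‖ ^ 2 := fun i j =>
    (memLp_two_iff_integrable_sq_norm (h.memLp_freq i j).1).1 (h.memLp_freq i j)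
  refine (integrable_finsetSum Finset.univ fun i _ =>
    integrable_finsetSum Finset.univ fun j _ => this i j).congr (Eventually.of_forall fun ξ => ?_)
  simp only [norm_mul, mul_pow, Complex.norm_real, Real.norm_eq_abs, sq_abs]
  rw [Finset.mul_sum]
  exact Finset.sum_congr rfl fun i _ => by rw [← Finset.sum_mul, ← norm_sq_coord]

theorem MemH1.integrable_energyDensity (h : MemH1 v) : Integrable (energyDensity α v) := by
  have h1 := (integrable_finsetSum Finset.univ fun i _ => integrable_ftc_sq v i).add
    (h.integrable_freq_sq.const_mul (4 * Real.pi ^ 2 * α))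
  refine h1.congr (Eventually.of_forall fun ξ => ?_)
  simp only [Pi.add_apply, energyDensity, stressSymbol]
  ring

theorem sqNormL2_eq (hv : MemLp v 2 volume) : sqNormL2 v = ∫ ξ, ∑ i, ‖ftc v i ξ‖ ^ 2 := by
  have e : ∀ i, ∫ ξ, ‖ftc v i ξ‖ ^ 2 = ∫ x, v x i * v x i := fun i => by
    rw [integral_mul_eq_re_ft (memLp_coord hv i) (memLp_coord hv i)]
    congr 1; ext ξ
    rw [← Complex.normSq_eq_conj_mul_self, Complex.ofReal_re, Complex.normSq_eq_norm_sq]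
    rfl
  rw [integral_finsetSum _ fun i _ => integrable_ftc_sq v i]
  simp only [e]
  have hi : ∀ i, Integrable fun x => v x i * v x i := fun i =>
    (memLp_coord hv i).integrable_mul (memLp_coord hv i)
  rw [← integral_finsetSum _ fun i _ => hi i]
  unfold sqNormL2
  congr 1; ext x
  rw [norm_sq_coord]
  exact Finset.sum_congr rfl fun i _ => by ring

theorem MemH1.integral_partial_sq (h : MemH1 v) (i j : Fin 3) :
    ∫ x, weakPartial j (fun y => v y i) x ^ 2
      = ∫ ξ : E3, 4 * Real.pi ^ 2 * (ξ j ^ 2 * ‖ftc v i ξ‖ ^ 2) := by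
  have hd := h.exists_isWD i j
  simp only [sq (weakPartial j _ _)]
  rw [integral_mul_eq_re_ft hd.right hd.right]
  refine integral_congr_ae ?_
  filter_upwards [hd.ft_eq] with ξ hξ
  rw [← Complex.normSq_eq_conj_mul_self, Complex.ofReal_re, Complex.normSq_eq_norm_sq, hξ]
  simp only [norm_mul, Complex.norm_real, Complex.norm_I, Real.norm_eq_abs, mul_pow, sq_abs, ftc,
    Complex.norm_ofNat]
  ring

theorem MemH1.integrable_coord_freq (h : MemH1 v) (i j : Fin 3) :
    Integrable fun ξ : E3 => 4 * Real.pi ^ 2 * (ξ j ^ 2 * ‖ftc v i ξ‖ ^ 2) := by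
  refine (((memLp_two_iff_integrable_sq_norm (h.memLp_freq i j).1).1
    (h.memLp_freq i j)).const_mul (4 * Real.pi ^ 2)).congr (Eventually.of_forall fun ξ => ?_)
  simp [mul_pow]

theorem MemH1.sqNormGrad_eq (h : MemH1 v) :
    sqNormGrad v = ∫ ξ : E3, 4 * Real.pi ^ 2 * (‖ξ‖ ^ 2 * ∑ i, ‖ftc v i ξ‖ ^ 2) := by
  have hd := fun i j => (h.exists_isWD i j).right.integrable_sq
  unfold sqNormGrad
  rw [integral_finsetSum _ fun i _ => integrable_finsetSum _ fun j _ => hd i j]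
  simp only [integral_finsetSum _ fun j _ => hd _ j, h.integral_partial_sq]
  simp only [← integral_finsetSum _ fun j _ => h.integrable_coord_freq _ j]
  rw [← integral_finsetSum _ fun i _ => integrable_finsetSum _ fun j _ => h.integrable_coord_freq i j]
  congr 1; ext ξ
  rw [Finset.mul_sum, Finset.mul_sum]
  refine Finset.sum_congr rfl fun i _ => ?_
  rw [norm_sq_coord, Finset.sum_mul, Finset.mul_sum]

theorem MemH1.sqNormH1_eq (h : MemH1 v) : sqNormH1 α v = ∫ ξ, energyDensity α v ξ := by
  unfold sqNormH1
  rw [sqNormL2_eq h.1, h.sqNormGrad_eq, ← integral_const_mul, ← integral_add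
    (integrable_finsetSum Finset.univ fun i _ => integrable_ftc_sq v i)
    ((h.integrable_freq_sq.const_mul _).const_mul _)]
  congr 1; ext ξ
  unfold energyDensity stressSymbol
  ring

/-- The factor 1 + 1/α yields one bound for both v and its gradient, as
`IsRegular.abs_inertia_wave_le` requires. -/
theorem MemH1.partial_bounds (hα : 0 < α) (h : MemH1 v) :
    (∀ i, ∫ x, v x i ^ 2 ≤ (1 + 1 / α) * ∫ ξ, energyDensity α v ξ) ∧
    ∀ i j, ∫ x, weakPartial j (fun y => v y i) x ^ 2
      ≤ (1 + 1 / α) * ∫ ξ, energyDensity α v ξ := by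
  have hE : 0 ≤ ∫ ξ, energyDensity α v ξ := integral_nonneg fun ξ => energyDensity_nonneg hα.le v ξ
  have hE2 : 0 ≤ 1 / α * ∫ ξ, energyDensity α v ξ := by positivity
  have hi := h.integrable_energyDensity (α := α)
  constructor
  · intro i
    have e : ∫ x, v x i ^ 2 = ∫ ξ, ‖ftc v i ξ‖ ^ 2 := by
      simp only [sq (v _ i)]
      rw [integral_mul_eq_re_ft (memLp_coord h.1 i) (memLp_coord h.1 i)]
      congr 1; ext ξ
      rw [← Complex.normSq_eq_conj_mul_self, Complex.ofReal_re, Complex.normSq_eq_norm_sq]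
      rfl
    have : ∫ ξ, ‖ftc v i ξ‖ ^ 2 ≤ ∫ ξ, energyDensity α v ξ := by
      refine integral_mono (integrable_ftc_sq v i) hi fun ξ => ?_
      exact (Finset.single_le_sum (f := fun i => ‖ftc v i ξ‖ ^ 2) (fun i _ => by positivity)
        (Finset.mem_univ i)).trans (normSq_le_energyDensity hα.le v ξ)
    rw [e]; linarith
  · intro i j
    rw [h.integral_partial_sq]
    have : ∫ ξ : E3, 4 * Real.pi ^ 2 * (ξ j ^ 2 * ‖ftc v i ξ‖ ^ 2)
        ≤ ∫ ξ, 1 / α * energyDensity α v ξ := by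
      refine integral_mono (h.integrable_coord_freq i j) (hi.const_mul _) fun ξ => ?_
      have h1 : ‖ftc v i ξ‖ ^ 2 ≤ ∑ i, ‖ftc v i ξ‖ ^ 2 :=
        Finset.single_le_sum (f := fun i => ‖ftc v i ξ‖ ^ 2) (fun i _ => by positivity)
          (Finset.mem_univ i)
      have h2 : ξ j ^ 2 ≤ ‖ξ‖ ^ 2 := by
        rw [← sq_abs]; gcongr; exact abs_coord_le ξ j
      have h3 : 4 * Real.pi ^ 2 * α * ‖ξ‖ ^ 2 ≤ stressSymbol α ξ := by unfold stressSymbol; linarith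
      simp only [energyDensity]
      rw [one_div, ← div_eq_inv_mul, le_div_iff₀ hα]
      calc 4 * Real.pi ^ 2 * (ξ j ^ 2 * ‖ftc v i ξ‖ ^ 2) * α
          = (4 * Real.pi ^ 2 * α * ξ j ^ 2) * ‖ftc v i ξ‖ ^ 2 := by ring
        _ ≤ (4 * Real.pi ^ 2 * α * ‖ξ‖ ^ 2) * ∑ i, ‖ftc v i ξ‖ ^ 2 := by gcongr
        _ ≤ _ := by gcongr
    have := this.trans_eq (integral_const_mul (1 / α) _)
    linarith

theorem aestronglyMeasurable_crossDensity (α : ℝ) (w v : E3 → E3) :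
    AEStronglyMeasurable (crossDensity α w v) volume := by
  refine (continuous_stressSymbol α).aestronglyMeasurable.mul ?_
  simp only [Fin.sum_univ_three]
  have : ∀ i, AEStronglyMeasurable (fun ξ => (ftc w i ξ * (starRingEnd ℂ) (ftc v i ξ)).re) volume :=
    fun i => Complex.continuous_re.comp_aestronglyMeasurable
      ((ftc_aesm w i).mul (Complex.continuous_conj.comp_aestronglyMeasurable (ftc_aesm v i)))
  exact ((this 0).add (this 1)).add (this 2)

theorem MemH1.integrable_crossDensity (hα : 0 ≤ α) (hw : MemH1 w) (hv : MemH1 v) :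
    Integrable (crossDensity α w v) := by
  refine ((hw.integrable_energyDensity (α := α)).add (hv.integrable_energyDensity (α := α))).mono'
    (aestronglyMeasurable_crossDensity α w v) (Eventually.of_forall fun ξ => ?_)
  · have hs := (stressSymbol_pos hα ξ).le
    simp only [Pi.add_apply, crossDensity, energyDensity]
    rw [norm_mul, Real.norm_of_nonneg hs, ← mul_add, ← Finset.sum_add_distrib]
    refine mul_le_mul_of_nonneg_left ((norm_sum_le _ _).trans (Finset.sum_le_sum fun i _ => ?_)) hs
    rw [Real.norm_eq_abs]
    refine (Complex.abs_re_le_norm _).trans ?_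
    rw [norm_mul, RCLike.norm_conj]
    nlinarith [sq_nonneg (‖ftc w i ξ‖ - ‖ftc v i ξ‖), sq_nonneg (‖ftc w i ξ‖ + ‖ftc v i ξ‖)]

/-- The dissipation density `4π² |ξ|² |v̂(ξ)|²`. -/
def dissipationDensity (v : E3 → E3) (ξ : E3) : ℝ :=
  4 * Real.pi ^ 2 * (‖ξ‖ ^ 2 * ∑ i, ‖ftc v i ξ‖ ^ 2)

theorem crossDensity_ae_eq {d s l} (hv : MemV2 α v) (hw : MemV w)
    (h : IsRegular (fun i x => v x i) d s l)
    (hd : ∀ i j, weakPartial j (fun x => v x i) =ᵐ[volume] d i j)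
    (hl : ∀ i j, weakPartial j (fun x => weakLaplacian v x i) =ᵐ[volume] l i j)
    (hweak : WeakFormAt α μ v w) :
    ∀ᵐ ξ, crossDensity α w v ξ = -μ * dissipationDensity v ξ - (inertiaDensity α v d l ξ).re := by
  filter_upwards [weakForm_freq hv hw h hd hl hweak] with ξ hξ
  have e : ∀ i, ftc v i ξ * (starRingEnd ℂ) (ftc v i ξ) = ((‖ftc v i ξ‖ ^ 2 : ℝ) : ℂ) := fun i => by
    rw [Complex.mul_conj, Complex.normSq_eq_norm_sq]
  simp only [add_mul, Finset.sum_add_distrib, mul_assoc, e] at hξ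
  have h2 := congrArg Complex.re hξ
  simp only [← Finset.mul_sum, Complex.add_re, Complex.re_ofReal_mul, Complex.zero_re,
    Complex.re_sum, ← Complex.ofReal_sum, Complex.ofReal_re] at h2
  simp only [crossDensity, dissipationDensity, inertiaDensity, Complex.re_sum]
  linear_combination h2

/-- The energy identity at a fixed time. -/
theorem MemV2.energy_identity (hα : 0 < α) (hv : MemV2 α v) (hw : MemV w)
    (hweak : WeakFormAt α μ v w) :
    ∫ ξ, crossDensity α w v ξ = -μ * ∫ ξ, dissipationDensity v ξ := by
  obtain ⟨d, s, l, h, hd, hl⟩ := hv.exists_isRegular hα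
  obtain ⟨hi, hz⟩ := hv.integral_inertiaDensity hα h
  have i1 : Integrable fun ξ => -μ * dissipationDensity v ξ :=
    (hv.1.1.integrable_freq_sq.const_mul _).const_mul _
  have i2 : Integrable fun ξ => (inertiaDensity α v d l ξ).re := hi.re
  rw [integral_congr_ae (crossDensity_ae_eq hv hw h hd hl hweak), integral_sub i1 i2,
    integral_const_mul]
  have := integral_re hi
  simp only [RCLike.re_to_complex] at this ⊢
  rw [this, hz]
  simp

/-- The modulus `|v̂(ξ)|`. -/
def amplitude (v : E3 → E3) (ξ : E3) : ℝ := Real.sqrt (∑ i, ‖ftc v i ξ‖ ^ 2)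

theorem amplitude_nonneg (v : E3 → E3) (ξ : E3) : 0 ≤ amplitude v ξ := Real.sqrt_nonneg _

theorem amplitude_sq (v : E3 → E3) (ξ : E3) : amplitude v ξ ^ 2 = ∑ i, ‖ftc v i ξ‖ ^ 2 :=
  Real.sq_sqrt (Finset.sum_nonneg fun i _ => by positivity)

theorem memLp_amplitude (v : E3 → E3) : MemLp (amplitude v) 2 volume := by
  have hs := integrable_finsetSum Finset.univ fun i _ => integrable_ftc_sq v i
  have hm : AEStronglyMeasurable (amplitude v) volume :=
    Real.continuous_sqrt.comp_aestronglyMeasurable hs.1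
  rw [memLp_two_iff_integrable_sq hm]
  exact hs.congr (Eventually.of_forall fun ξ => (amplitude_sq v ξ).symm)

theorem integrableOn_amplitude (v : E3 → E3) (ρ : ℝ) :
    IntegrableOn (amplitude v) (Metric.closedBall 0 ρ) := by
  have : IsFiniteMeasure (volume.restrict (Metric.closedBall (0 : E3) ρ)) :=
    ⟨by rw [Measure.restrict_apply_univ]; exact measure_closedBall_lt_top⟩
  exact ((memLp_amplitude v).restrict _).integrable one_le_two

/-- Cauchy–Schwarz on the ball of volume 4πρ³/3. The resulting ρ^(3/2), times the factor ρ from the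
inertial force, squares to the ρ⁵ behind the limiting rate 5/2. -/
theorem MemH1.setIntegral_amplitude_le (hα : 0 ≤ α) (hv : MemH1 v) {ρ : ℝ} (hρ : 0 < ρ) :
    ∫ ξ in Metric.closedBall 0 ρ, amplitude v ξ ≤ Real.sqrt (ρ ^ 3 * (Real.pi * 4 / 3))
      * Real.sqrt (∫ ξ in Metric.closedBall 0 ρ, energyDensity α v ξ) := by
  set B := Metric.closedBall (0 : E3) ρ with hB
  have : IsFiniteMeasure (volume.restrict B) := ⟨by simpa using measure_closedBall_lt_top⟩
  have hh := integral_mul_le_Lp_mul_Lq_of_nonneg (μ := volume.restrict B)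
    (Real.HolderConjugate.two_two) (f := fun _ => (1 : ℝ)) (g := amplitude v)
    (Eventually.of_forall fun _ => zero_le_one) (Eventually.of_forall (amplitude_nonneg v))
    (by simpa using memLp_const 1) (by simpa using (memLp_amplitude v).restrict B)
  simp only [one_mul, Real.one_rpow, ← Real.sqrt_eq_rpow] at hh
  refine hh.trans ?_
  have v1 : ∫ _ in B, (1 : ℝ) = ρ ^ 3 * (Real.pi * 4 / 3) := by
    rw [setIntegral_const, smul_eq_mul, mul_one, measureReal_def, hB,
      EuclideanSpace.volume_closedBall_fin_three, ENNReal.toReal_mul, ENNReal.toReal_pow,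
      ENNReal.toReal_ofReal hρ.le, ENNReal.toReal_ofReal (by positivity)]
  rw [v1]
  refine mul_le_mul_of_nonneg_left (Real.sqrt_le_sqrt ?_) (Real.sqrt_nonneg _)
  refine integral_mono_of_nonneg (Eventually.of_forall fun ξ => ?_)
    (hv.integrable_energyDensity (α := α)).integrableOn (Eventually.of_forall fun ξ => ?_)
  · have := amplitude_nonneg v ξ
    simp only [Pi.zero_apply]; positivity
  · simp only [Real.rpow_ofNat]
    rw [amplitude_sq]
    exact normSq_le_energyDensity hα v ξ

/-- The rate of change of the low-frequency energy at a fixed time. -/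
theorem MemV2.low_frequency_bound (hα : 0 < α) (hμ : 0 < μ) (hv : MemV2 α v) (hw : MemV w)
    (hweak : WeakFormAt α μ v w) {ρ : ℝ} (hρ : 0 < ρ) (hρ1 : ρ ≤ 1) :
    ∫ ξ in Metric.closedBall 0 ρ, crossDensity α w v ξ ≤
      16000 * (1 + α) * (1 + 1 / α) * Real.sqrt (Real.pi * 4 / 3) * (∫ ξ, energyDensity α v ξ) *
        (ρ * Real.sqrt (ρ ^ 3)) *
        Real.sqrt (∫ ξ in Metric.closedBall 0 ρ, energyDensity α v ξ) := by
  obtain ⟨d, s, l, h, hd, hl⟩ := hv.exists_isRegular hα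
  obtain ⟨c1, c2⟩ := hv.1.1.partial_bounds hα
  obtain ⟨H, hH⟩ : ∃ H, H = (1 + 1 / α) * ∫ ξ, energyDensity α v ξ := ⟨_, rfl⟩
  have b1 : ∀ i, ∫ x, v x i ^ 2 ≤ H := fun i => (c1 i).trans_eq hH.symm
  have b2 : ∀ i j, ∫ x, weakPartial j (fun y => v y i) x ^ 2 ≤ H :=
    fun i j => (c2 i j).trans_eq hH.symm
  have b2' : ∀ i j, ∫ x, d i j x ^ 2 ≤ H := fun i j => by
    refine le_of_eq_of_le (integral_congr_ae ?_) (b2 i j)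
    filter_upwards [hd i j] with x hx; rw [hx]
  have hH0 : 0 ≤ H := (integral_nonneg fun x => sq_nonneg _).trans (b1 0)
  -- Only an upper bound is needed, so the dissipation is dropped. For |ξ| ≤ ρ ≤ 1 the factor
  -- |ξ|(1+|ξ|) is at most 2ρ, which doubles the constant 8000.
  have pointwise : ∀ᵐ ξ ∂(volume.restrict (Metric.closedBall (0 : E3) ρ)),
      crossDensity α w v ξ ≤ 8000 * (1 + α) * (2 * ρ) * H * amplitude v ξ := by
    filter_upwards [ae_restrict_of_ae (crossDensity_ae_eq hv hw h hd hl hweak),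
      ae_restrict_of_ae hv.1.freq_div,
      ae_restrict_mem Metric.isClosed_closedBall.measurableSet] with ξ e1 e2 e3
    have hξ : ‖ξ‖ ≤ ρ := by simpa using e3
    have n1 := h.abs_inertiaDensity_le hα.le b1 b2' e2
    have n2 := Complex.abs_re_le_norm (inertiaDensity α v d l ξ)
    have n3 := neg_abs_le (inertiaDensity α v d l ξ).re
    have n4 : 0 ≤ μ * dissipationDensity v ξ := by
      unfold dissipationDensity
      have : 0 ≤ ∑ i, ‖ftc v i ξ‖ ^ 2 := Finset.sum_nonneg fun i _ => by positivity
      positivity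
    have hA0 := amplitude_nonneg v ξ
    change _ ≤ _ * amplitude v ξ at n1
    have n5 : 8000 * (1 + α) * (‖ξ‖ * (1 + ‖ξ‖)) * H * amplitude v ξ
        ≤ 8000 * (1 + α) * (2 * ρ) * H * amplitude v ξ := by
      have : ‖ξ‖ * (1 + ‖ξ‖) ≤ 2 * ρ := by nlinarith [norm_nonneg ξ]
      gcongr
    linarith
  have step1 := integral_mono_ae (hw.1.integrable_crossDensity hα.le hv.1.1).integrableOn
    ((integrableOn_amplitude v ρ).const_mul (8000 * (1 + α) * (2 * ρ) * H)) pointwise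
  rw [integral_const_mul] at step1
  refine step1.trans ((mul_le_mul_of_nonneg_left (hv.1.1.setIntegral_amplitude_le hα.le hρ)
    (by positivity)).trans_eq ?_)
  rw [Real.sqrt_mul (by positivity), hH]
  ring

end

/-! ### Bilinear forms along absolutely continuous curves -/

section Curve

variable {H : Type*} [NormedAddCommGroup H] [NormedSpace ℝ H] [CompleteSpace H]

theorem hasDerivWithinAt_zero_of_sq_bound {G : ℝ → ℝ} {T C : ℝ}
    (h : ∀ s ∈ Icc 0 T, ∀ t ∈ Icc s T, |G t - G s| ≤ C * (t - s) ^ 2) {x : ℝ} (hx : x ∈ Ico 0 T) :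
    HasDerivWithinAt G 0 (Ici x) x := by
  rw [hasDerivWithinAt_iff_isLittleO]
  have h1 : (fun t => G t - G x - (t - x) • (0 : ℝ)) =O[𝓝[Ici x] x] fun t => (t - x) ^ 2 := by
    refine Asymptotics.IsBigO.of_bound C ?_
    have : Icc x T ∈ 𝓝[Ici x] x := Icc_mem_nhdsGE_of_mem ⟨le_rfl, hx.2⟩
    filter_upwards [this] with t ht
    have := h x ⟨hx.1, hx.2.le⟩ t ht
    rw [smul_zero, sub_zero, Real.norm_eq_abs, Real.norm_of_nonneg (sq_nonneg _)]
    exact this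
  refine h1.trans_isLittleO ?_
  have h2 : (fun t : ℝ => t - x) =o[𝓝[Ici x] x] fun _ => (1 : ℝ) := by
    rw [Asymptotics.isLittleO_one_iff]
    have : Tendsto (fun t : ℝ => t - x) (𝓝 x) (𝓝 (x - x)) := by
      exact (continuous_id.sub continuous_const).tendsto x
    rw [sub_self] at this
    exact this.mono_left nhdsWithin_le_nhds
  have h3 := h2.mul_isBigO (Asymptotics.isBigO_refl (fun t : ℝ => t - x) (𝓝[Ici x] x))
  simpa [sq] using! h3

/-- The curve has its derivative only in integrated form, so the chain rule is proved without
differentiating it. The defect between the two sides changes by O((t-s)²) over [s, t]; hence its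
right derivative is zero and it is constant. -/
theorem bilinear_sub_eq_integral (a : H →L[ℝ] H →L[ℝ] ℝ) (ha : ∀ x y, a x y = a y x)
    {U U' : ℝ → H} {T M : ℝ} (hT : 0 < T)
    (hm : AEStronglyMeasurable U' (volume.restrict (Ioo 0 T)))
    (hM : ∀ᵐ t ∂(volume.restrict (Ioo 0 T)), ‖U' t‖ ≤ M)
    (hU : ∀ t ∈ Icc 0 T, U t = U 0 + ∫ s in (0 : ℝ)..t, U' s) :
    ContinuousOn (fun t => a (U t) (U t)) (Icc 0 T) ∧
    IntervalIntegrable (fun t => a (U' t) (U t)) volume 0 T ∧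
    ∀ t ∈ Icc 0 T, a (U t) (U t) - a (U 0) (U 0) = 2 * ∫ τ in (0 : ℝ)..t, a (U' τ) (U τ) := by
  have hM' : ∀ᵐ t ∂volume, t ∈ Ioc 0 T → ‖U' t‖ ≤ M := by
    rwa [← Measure.restrict_congr_set Ioo_ae_eq_Ioc.symm, ae_restrict_iff' measurableSet_Ioc] at hM
  have hI : IntervalIntegrable U' volume 0 T := by
    rw [intervalIntegrable_iff_integrableOn_Ioo_of_le hT.le]
    exact ⟨hm, HasFiniteIntegral.restrict_of_bounded M (by simp) hM⟩
  -- The bound holds only almost everywhere, so its sign comes from (0, T) having positive measure.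
  have hM0 : 0 ≤ M := by
    rw [ae_restrict_iff' measurableSet_Ioo] at hM
    by_contra hneg
    have hz : ∀ᵐ t ∂(volume : Measure ℝ), t ∉ Ioo 0 T := by
      filter_upwards [hM] with t ht h2
      exact hneg ((norm_nonneg _).trans (ht h2))
    have := measure_eq_zero_iff_ae_notMem.2 hz
    simp [hT.not_ge] at this
  have hsub : ∀ s ∈ Icc 0 T, ∀ t ∈ Icc s T, IntervalIntegrable U' volume s t := fun s hs t ht =>
    hI.mono_set (by
      rw [uIcc_of_le ht.1, uIcc_of_le hT.le]; exact Icc_subset_Icc hs.1 ht.2)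
  have hdiff : ∀ s ∈ Icc 0 T, ∀ t ∈ Icc s T, U t - U s = ∫ τ in s..t, U' τ := fun s hs t ht => by
    rw [hU t ⟨hs.1.trans ht.1, ht.2⟩, hU s hs, add_sub_add_left_eq_sub,
      intervalIntegral.integral_interval_sub_left]
    · exact hsub 0 ⟨le_rfl, hT.le⟩ t ⟨hs.1.trans ht.1, ht.2⟩
    · exact hsub 0 ⟨le_rfl, hT.le⟩ s hs
  have hlip : ∀ s ∈ Icc 0 T, ∀ t ∈ Icc s T, ‖U t - U s‖ ≤ M * (t - s) := fun s hs t ht => by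
    rw [hdiff s hs t ht, ← abs_of_nonneg (sub_nonneg.2 ht.1)]
    refine intervalIntegral.norm_integral_le_of_norm_le_const_ae ?_
    filter_upwards [hM'] with τ h1 h2
    rw [uIoc_of_le ht.1] at h2
    exact h1 ⟨hs.1.trans_lt h2.1, h2.2.trans ht.2⟩
  have hcont : ContinuousOn U (Icc 0 T) := by
    refine (LipschitzOnWith.of_dist_le_mul (K := M.toNNReal) fun x hx y hy => ?_).continuousOn
    rw [dist_eq_norm, dist_eq_norm, Real.coe_toNNReal M hM0]
    rcases le_total x y with h | h
    · rw [norm_sub_rev, norm_sub_rev x, Real.norm_of_nonneg (sub_nonneg.2 h)]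
      exact hlip x hx y ⟨h, hy.2⟩
    · rw [Real.norm_of_nonneg (sub_nonneg.2 h)]
      exact hlip y hy x ⟨h, hx.2⟩
  obtain ⟨N, hN⟩ := (isCompact_Icc.image_of_continuousOn hcont).isBounded.exists_norm_le
  have hN' : ∀ t ∈ Icc 0 T, ‖U t‖ ≤ N := fun t ht => hN _ (mem_image_of_mem U ht)
  have hgi : IntervalIntegrable (fun t => a (U' t) (U t)) volume 0 T := by
    rw [intervalIntegrable_iff_integrableOn_Ioo_of_le hT.le]
    refine ⟨?_, HasFiniteIntegral.restrict_of_bounded (‖a‖ * M * N) (by simp) ?_⟩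
    · exact (a.continuous₂).comp_aestronglyMeasurable₂ hm
        ((hcont.mono Ioo_subset_Icc_self).aestronglyMeasurable measurableSet_Ioo)
    · filter_upwards [hM, ae_restrict_mem measurableSet_Ioo] with t h1 h2
      refine (a.le_opNorm₂ _ _).trans ?_
      have := hN' t (Ioo_subset_Icc_self h2)
      gcongr
  have hquad : ContinuousOn (fun t => a (U t) (U t)) (Icc 0 T) :=
    a.continuous₂.comp_continuousOn (hcont.prodMk hcont)
  refine ⟨hquad, hgi, ?_⟩
  have hgsub : ∀ s ∈ Icc 0 T, ∀ t ∈ Icc s T,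
      IntervalIntegrable (fun t => a (U' t) (U t)) volume s t := fun s hs t ht =>
    hgi.mono_set (by
      rw [uIcc_of_le ht.1, uIcc_of_le hT.le]; exact Icc_subset_Icc hs.1 ht.2)
  set G : ℝ → ℝ := fun t => a (U t) (U t) - 2 * ∫ τ in (0 : ℝ)..t, a (U' τ) (U τ) with hG
  have key : ∀ s ∈ Icc 0 T, ∀ t ∈ Icc s T, |G t - G s| ≤ (‖a‖ * M * (2 * M)) * (t - s) ^ 2 := by
    intro s hs t ht
    have ht0 : t ∈ Icc 0 T := ⟨hs.1.trans ht.1, ht.2⟩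
    -- Symmetry gives a(Uₜ,Uₜ) - a(Uₛ,Uₛ) = a(Uₜ - Uₛ, Uₜ + Uₛ). The second argument below is (Uₜ -
    -- U_τ) - (U_τ - Uₛ), which is O(t-s) by the Lipschitz bound, and integrating over [s, t] adds
    -- another such factor.
    have e1 : G t - G s = ∫ τ in s..t, a (U' τ) (U t + U s - (2 : ℝ) • U τ) := by
      have h1 : a (U t - U s) (U t + U s) = ∫ τ in s..t, a (U' τ) (U t + U s) := by
        have := (a.flip (U t + U s)).intervalIntegral_comp_comm (hsub s hs t ht)
        rw [hdiff s hs t ht]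
        exact this.symm
      have h2 : ∫ τ in s..t, a (U' τ) (U t + U s - (2 : ℝ) • U τ)
          = (∫ τ in s..t, a (U' τ) (U t + U s)) - ∫ τ in s..t, 2 * a (U' τ) (U τ) := by
        rw [← intervalIntegral.integral_sub]
        · simp only [map_sub, map_smul, smul_eq_mul]
        · exact ⟨(a.flip (U t + U s)).integrable_comp (hsub s hs t ht).1,
            (a.flip (U t + U s)).integrable_comp (hsub s hs t ht).2⟩
        · exact (hgsub s hs t ht).const_mul 2
      have h3 := intervalIntegral.integral_interval_sub_left
        (hgsub 0 ⟨le_rfl, hT.le⟩ t ht0) (hgsub 0 ⟨le_rfl, hT.le⟩ s hs)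
      rw [h2, intervalIntegral.integral_const_mul, ← h1, ← h3]
      simp only [hG, map_sub, map_add, sub_apply]
      rw [ha (U s) (U t)]
      ring
    rw [e1, ← Real.norm_eq_abs]
    have : ‖∫ τ in s..t, a (U' τ) (U t + U s - (2 : ℝ) • U τ)‖
        ≤ (‖a‖ * M * (2 * M * (t - s))) * |t - s| := by
      refine intervalIntegral.norm_integral_le_of_norm_le_const_ae ?_
      filter_upwards [hM'] with τ h1 h2
      rw [uIoc_of_le ht.1] at h2
      have h3 := h1 ⟨hs.1.trans_lt h2.1, h2.2.trans ht.2⟩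
      have hτ : τ ∈ Icc 0 T := ⟨hs.1.trans h2.1.le, h2.2.trans ht.2⟩
      refine (a.le_opNorm₂ _ _).trans ?_
      have h4 : ‖U t + U s - (2 : ℝ) • U τ‖ ≤ 2 * M * (t - s) := by
        have e : U t + U s - (2 : ℝ) • U τ = (U t - U τ) - (U τ - U s) := by
          rw [two_smul]; abel
        rw [e]
        refine (norm_sub_le _ _).trans ?_
        have h5 := hlip τ hτ t ⟨h2.2, ht.2⟩
        have h6 := hlip s hs τ ⟨h2.1.le, hτ.2⟩
        nlinarith [h2.1, h2.2]
      gcongr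
    rw [abs_of_nonneg (sub_nonneg.2 ht.1)] at this
    linarith
  have hconst := constant_of_has_deriv_right_zero (f := G) (a := 0) (b := T) ?_
    fun x hx => hasDerivWithinAt_zero_of_sq_bound key hx
  · intro t ht
    have := hconst t ht
    simp only [hG, intervalIntegral.integral_same] at this
    linarith
  · refine hquad.sub (ContinuousOn.const_smul ?_ (2 : ℝ))
    have := intervalIntegral.continuousOn_primitive_interval' hgi left_mem_uIcc
    rwa [uIcc_of_le hT.le] at this

end Curve

/-! ### The truncated energy as a bounded bilinear form -/

theorem ft_const_mul (c : ℝ) {f : E3 → ℝ} (hf : MemLp f 2 volume) :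
    ft (fun x => c * f x) =ᵐ[volume] fun ξ => c * ft f ξ := by
  have hcf : MemLp (fun x => c * f x) 2 volume := hf.const_mul c
  rw [ft_eq hf, ft_eq hcf]
  have : (hcf.ofReal (K := ℂ)).toLp = (c : ℂ) • (hf.ofReal (K := ℂ)).toLp := by
    rw [← MemLp.toLp_const_smul]
    exact MemLp.toLp_congr _ _ (Eventually.of_forall fun x => by simp)
  rw [this, FourierTransform.fourier_smul]
  exact Lp.coeFn_smul _ _

theorem ftc_add (v w : L2V) (i : Fin 3) :
    ftc (v + w : L2V) i =ᵐ[volume] fun ξ => ftc v i ξ + ftc w i ξ := by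
  have e : ftc (v + w : L2V) i = ft fun x => v x i + w x i := ft_congr (by
    filter_upwards [Lp.coeFn_add v w] with x hx
    rw [hx]; rfl)
  rw [e]
  exact ft_add (memLp_coord (Lp.memLp v) i) (memLp_coord (Lp.memLp w) i)

theorem ftc_smul (c : ℝ) (v : L2V) (i : Fin 3) :
    ftc (c • v : L2V) i =ᵐ[volume] fun ξ => c * ftc v i ξ := by
  have e : ftc (c • v : L2V) i = ft fun x => c * v x i := ft_congr (by
    filter_upwards [Lp.coeFn_smul c v] with x hx
    rw [hx]; rfl)
  rw [e]
  exact ft_const_mul c (memLp_coord (Lp.memLp v) i)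

theorem crossDensity_comm (α : ℝ) (v w : E3 → E3) (ξ : E3) :
    crossDensity α v w ξ = crossDensity α w v ξ := by
  unfold crossDensity
  congr 1
  refine Finset.sum_congr rfl fun i _ => ?_
  simp only [Complex.mul_re, Complex.conj_re, Complex.conj_im]
  ring

theorem crossDensity_self (α : ℝ) (v : E3 → E3) (ξ : E3) :
    crossDensity α v v ξ = energyDensity α v ξ := by
  unfold crossDensity energyDensity
  congr 1
  refine Finset.sum_congr rfl fun i _ => ?_
  rw [Complex.mul_conj, Complex.ofReal_re, Complex.normSq_eq_norm_sq]

theorem crossDensity_add_left (α : ℝ) (v v' : L2V) (w : E3 → E3) :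
    crossDensity α (v + v' : L2V) w =ᵐ[volume]
      fun ξ => crossDensity α v w ξ + crossDensity α v' w ξ := by
  filter_upwards [ae_all_iff.2 fun i => ftc_add v v' i] with ξ h
  simp only [crossDensity, h, add_mul, Complex.add_re, Finset.sum_add_distrib, mul_add]

theorem crossDensity_smul_left (α c : ℝ) (v : L2V) (w : E3 → E3) :
    crossDensity α (c • v : L2V) w =ᵐ[volume] fun ξ => c * crossDensity α v w ξ := by
  filter_upwards [ae_all_iff.2 fun i => ftc_smul c v i] with ξ h
  simp only [crossDensity, h, mul_assoc, Complex.re_ofReal_mul, ← Finset.mul_sum]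
  ring

theorem abs_crossDensity_le {α : ℝ} (hα : 0 ≤ α) (w v : E3 → E3) (ξ : E3) :
    |crossDensity α w v ξ| ≤ stressSymbol α ξ * (amplitude w ξ * amplitude v ξ) := by
  have hs := (stressSymbol_pos hα ξ).le
  rw [crossDensity, abs_mul, abs_of_nonneg hs]
  refine mul_le_mul_of_nonneg_left ?_ hs
  refine (Finset.abs_sum_le_sum_abs _ _).trans ((Finset.sum_le_sum fun i _ => ?_).trans
    (Real.sum_mul_le_sqrt_mul_sqrt _ _ _))
  refine (Complex.abs_re_le_norm _).trans ?_
  rw [norm_mul, RCLike.norm_conj]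

theorem stressSymbol_le {α : ℝ} (hα : 0 ≤ α) {R : ℝ} {ξ : E3} (h : ξ ∈ Metric.closedBall (0 : E3) R) :
    stressSymbol α ξ ≤ 1 + 4 * Real.pi ^ 2 * α * R ^ 2 := by
  have : ‖ξ‖ ≤ R := by simpa using h
  unfold stressSymbol
  gcongr

theorem integrable_amplitude_mul (w v : E3 → E3) :
    Integrable fun ξ => amplitude w ξ * amplitude v ξ :=
  (memLp_amplitude w).integrable_mul (memLp_amplitude v)

theorem integrableOn_crossDensity {α : ℝ} (hα : 0 ≤ α) (w v : E3 → E3) (R : ℝ) :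
    IntegrableOn (crossDensity α w v) (Metric.closedBall 0 R) := by
  refine ((integrable_amplitude_mul w v).integrableOn.const_mul
    (1 + 4 * Real.pi ^ 2 * α * R ^ 2)).mono' (aestronglyMeasurable_crossDensity α w v).restrict ?_
  filter_upwards [ae_restrict_mem Metric.isClosed_closedBall.measurableSet] with ξ hξ
  refine (abs_crossDensity_le hα w v ξ).trans ?_
  exact mul_le_mul_of_nonneg_right (stressSymbol_le hα hξ)
    (mul_nonneg (amplitude_nonneg w ξ) (amplitude_nonneg v ξ))

theorem L2V_norm_sq (v : L2V) : ‖v‖ ^ 2 = ∫ ξ, amplitude v ξ ^ 2 := by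
  simp only [amplitude_sq]
  rw [← sqNormL2_eq (Lp.memLp v), ← real_inner_self_eq_norm_sq, L2.inner_def]
  simp only [real_inner_self_eq_norm_sq, sqNormL2]

theorem integral_amplitude_mul_le (v w : L2V) :
    ∫ ξ, amplitude v ξ * amplitude w ξ ≤ ‖v‖ * ‖w‖ := by
  have hh := integral_mul_le_Lp_mul_Lq_of_nonneg (μ := (volume : Measure E3))
    (Real.HolderConjugate.two_two) (f := amplitude v) (g := amplitude w)
    (Eventually.of_forall (amplitude_nonneg v)) (Eventually.of_forall (amplitude_nonneg w))
    (by simpa using memLp_amplitude v) (by simpa using memLp_amplitude w)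
  simp only [← Real.sqrt_eq_rpow, Real.rpow_ofNat, ← L2V_norm_sq] at hh
  rwa [Real.sqrt_sq (norm_nonneg _), Real.sqrt_sq (norm_nonneg _)] at hh

/-- The form `(v, w) ↦ ∫_{|ξ| ≤ R} (1 + 4π² α |ξ|²) Re ⟨v̂, ŵ⟩`. -/
def truncatedForm {α : ℝ} (hα : 0 ≤ α) (R : ℝ) : L2V →L[ℝ] L2V →L[ℝ] ℝ :=
  LinearMap.mkContinuous₂
    (LinearMap.mk₂ ℝ (fun v w : L2V => ∫ ξ in Metric.closedBall 0 R, crossDensity α v w ξ)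
      (fun v v' w => by
        rw [integral_congr_ae (ae_restrict_of_ae (crossDensity_add_left α v v' w)), integral_add
          (integrableOn_crossDensity hα v w R) (integrableOn_crossDensity hα v' w R)])
      (fun c v w => by
        rw [integral_congr_ae (ae_restrict_of_ae (crossDensity_smul_left α c v w)),
          integral_const_mul, smul_eq_mul])
      (fun w v v' => by
        simp only [crossDensity_comm α w]
        rw [integral_congr_ae (ae_restrict_of_ae (crossDensity_add_left α v v' w)), integral_add
          (integrableOn_crossDensity hα v w R) (integrableOn_crossDensity hα v' w R)])
      (fun c w v => by
        simp only [crossDensity_comm α w]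
        rw [integral_congr_ae (ae_restrict_of_ae (crossDensity_smul_left α c v w)),
          integral_const_mul, smul_eq_mul]))
    (1 + 4 * Real.pi ^ 2 * α * R ^ 2) (fun v w => by
      have hc : 0 ≤ 1 + 4 * Real.pi ^ 2 * α * R ^ 2 := by positivity
      have hi := integrable_amplitude_mul v w
      rw [LinearMap.mk₂_apply, mul_assoc]
      refine (norm_integral_le_of_norm_le (hi.integrableOn.const_mul _) ?_).trans
        (?_ : ∫ ξ in Metric.closedBall 0 R, (1 + 4 * Real.pi ^ 2 * α * R ^ 2) *
          (amplitude v ξ * amplitude w ξ) ≤ _)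
      · filter_upwards [ae_restrict_mem Metric.isClosed_closedBall.measurableSet] with ξ hξ
        refine (abs_crossDensity_le hα v w ξ).trans ?_
        exact mul_le_mul_of_nonneg_right (stressSymbol_le hα hξ)
          (mul_nonneg (amplitude_nonneg v ξ) (amplitude_nonneg w ξ))
      · rw [integral_const_mul]
        refine mul_le_mul_of_nonneg_left ((setIntegral_le_integral hi
          (Eventually.of_forall fun ξ => ?_)).trans (integral_amplitude_mul_le v w)) hc
        exact mul_nonneg (amplitude_nonneg v ξ) (amplitude_nonneg w ξ))

theorem truncatedForm_apply {α : ℝ} (hα : 0 ≤ α) (R : ℝ) (v w : L2V) :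
    truncatedForm hα R v w = ∫ ξ in Metric.closedBall 0 R, crossDensity α v w ξ := by
  simp [truncatedForm]

theorem truncatedForm_symm {α : ℝ} (hα : 0 ≤ α) (R : ℝ) (v w : L2V) :
    truncatedForm hα R v w = truncatedForm hα R w v := by
  simp only [truncatedForm_apply, crossDensity_comm α v]

theorem truncatedForm_self {α : ℝ} (hα : 0 ≤ α) (R : ℝ) (v : L2V) :
    truncatedForm hα R v v = ∫ ξ in Metric.closedBall 0 R, energyDensity α v ξ := by
  simp only [truncatedForm_apply, crossDensity_self]

/-! ### Evolution in time: energy equality and low-frequency growth. -/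

/-- A curve in `L²` solving the equation almost everywhere in time, with locally bounded energies. -/
structure IsEvolution (α μ : ℝ) (u u' : ℝ → L2V) : Prop where
  meas : AEStronglyMeasurable u' (volume.restrict (Ioi (0 : ℝ)))
  bound : ∀ T > 0, ∃ M : ℝ, ∀ᵐ t ∂(volume.restrict (Ioo (0 : ℝ) T)),
    MemV2 α (u t) ∧ MemV (u' t) ∧ WeakFormAt α μ (u t) (u' t) ∧
      ∫ ξ, energyDensity α (u t) ξ ≤ M ∧ ∫ ξ, energyDensity α (u' t) ξ ≤ M
  eq : ∀ t ≥ 0, u t = u 0 + ∫ s in (0 : ℝ)..t, u' s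
  init : MemV2 α (u 0)

theorem sqNormL2_nonneg (v : E3 → E3) : 0 ≤ sqNormL2 v := integral_nonneg fun _ => by positivity

theorem sqNormGrad_nonneg (v : E3 → E3) : 0 ≤ sqNormGrad v :=
  integral_nonneg fun _ => Finset.sum_nonneg fun _ _ => Finset.sum_nonneg fun _ _ => sq_nonneg _

theorem sqNormH1_le_normV2_sq {α : ℝ} (hα : 0 ≤ α) (v : E3 → E3) :
    sqNormH1 α v ≤ normV2 α v ^ 2 := by
  have h1 := sqNormL2_nonneg v
  have h2 := sqNormGrad_nonneg v
  have h3 := sqNormL2_nonneg (curlStress α v)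
  unfold normV2 sqNormH1
  rw [Real.sq_sqrt (by positivity)]
  linarith

theorem IsWeakSolution.exists_isEvolution {α μ : ℝ} (hα : 0 < α) {u₀ : L2V} {u : ℝ → L2V}
    (h : IsWeakSolution α μ u₀ u) (h0 : MemV2 α u₀) :
    u 0 = u₀ ∧ ∃ u', IsEvolution α μ u u' := by
  obtain ⟨u', hm, h1, h2, h3, h4⟩ := h
  have hu0 : u 0 = u₀ := by simpa using h3 0 le_rfl
  refine ⟨hu0, u', hm, fun T hT => ?_, fun t ht => by rw [hu0]; exact h3 t ht, by rwa [hu0]⟩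
  obtain ⟨M₁, hM₁⟩ := h1 T hT
  obtain ⟨M₂, hM₂⟩ := h2 T hT
  -- `normV2` is a norm while energies are squared, hence the square. The factor 1 + α converts the
  -- H¹ bound with weight 1 on u' into one with weight α.
  refine ⟨max (M₁ ^ 2) ((1 + α) * M₂), ?_⟩
  have h4' := ae_restrict_of_ae_restrict_of_subset (Ioo_subset_Ioi_self (a := T) (b := (0 : ℝ))) h4
  filter_upwards [hM₁, hM₂, h4'] with t a1 a2 a3
  refine ⟨a1.1, a2.1, a3, le_max_of_le_left ?_, le_max_of_le_right ?_⟩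
  · rw [← a1.1.1.1.sqNormH1_eq]
    refine (sqNormH1_le_normV2_sq hα.le _).trans ?_
    exact pow_le_pow_left₀ (Real.sqrt_nonneg _) a1.2 2
  · rw [← a2.1.1.sqNormH1_eq]
    have b1 := sqNormL2_nonneg (u' t)
    have b2 := sqNormGrad_nonneg (u' t)
    have b3 := a2.2
    unfold sqNormH1 at b3 ⊢
    nlinarith

/-- The total energy `∫ (1 + 4π² α |ξ|²) |v̂|²`. -/
def energy (α : ℝ) (v : E3 → E3) : ℝ := ∫ ξ, energyDensity α v ξ

/-- The energy in the frequencies `|ξ| ≤ R`. -/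
def lowEnergy (α R : ℝ) (v : E3 → E3) : ℝ := ∫ ξ in Metric.closedBall 0 R, energyDensity α v ξ

section

variable {α μ : ℝ} {u u' : ℝ → L2V} {v w : E3 → E3}

theorem energy_nonneg (hα : 0 ≤ α) (v : E3 → E3) : 0 ≤ energy α v :=
  integral_nonneg fun ξ => energyDensity_nonneg hα v ξ

theorem lowEnergy_nonneg (hα : 0 ≤ α) (R : ℝ) (v : E3 → E3) : 0 ≤ lowEnergy α R v :=
  integral_nonneg fun ξ => energyDensity_nonneg hα v ξ

theorem integrableOn_energyDensity (hα : 0 ≤ α) (v : E3 → E3) (R : ℝ) :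
    IntegrableOn (energyDensity α v) (Metric.closedBall 0 R) := by
  have := integrableOn_crossDensity hα v v R
  simpa only [funext (crossDensity_self α v)] using this

theorem MemH1.lowEnergy_le (hα : 0 ≤ α) (hv : MemH1 v) (R : ℝ) : lowEnergy α R v ≤ energy α v :=
  setIntegral_le_integral hv.integrable_energyDensity
    (Eventually.of_forall fun ξ => energyDensity_nonneg hα v ξ)

theorem aecover_ball : AECover (volume : Measure E3) atTop fun n : ℕ => Metric.closedBall 0 (n : ℝ) :=
  aecover_closedBall tendsto_natCast_atTop_atTop

theorem memH1_of_integrable_energyDensity (hα : 0 < α) (hv : MemLp v 2 volume)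
    (h : Integrable (energyDensity α v)) : MemH1 v := by
  refine ⟨hv, fun i j => ?_⟩
  have hm : AEStronglyMeasurable (fun ξ : E3 => (ξ j : ℂ) * ft (fun x => v x i) ξ) volume :=
    (Continuous.aestronglyMeasurable (by fun_prop)).mul (ftc_aesm v i)
  have hL : MemLp (fun ξ : E3 => (ξ j : ℂ) * ft (fun x => v x i) ξ) 2 volume := by
    rw [memLp_two_iff_integrable_sq_norm hm]
    refine (h.const_mul (4 * Real.pi ^ 2 * α)⁻¹).mono' (hm.norm.pow 2)
      (Eventually.of_forall fun ξ => ?_)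
    have hc : 0 < 4 * Real.pi ^ 2 * α := by positivity
    rw [norm_pow, norm_norm, ← div_eq_inv_mul, le_div_iff₀ hc, norm_mul, mul_pow,
      Complex.norm_real, energyDensity]
    have h1 : ‖ft (fun x => v x i) ξ‖ ^ 2 ≤ ∑ i, ‖ftc v i ξ‖ ^ 2 :=
      Finset.single_le_sum (f := fun i => ‖ftc v i ξ‖ ^ 2) (fun i _ => by positivity)
        (Finset.mem_univ i)
    have h2 : ‖ξ j‖ ^ 2 ≤ ‖ξ‖ ^ 2 := pow_le_pow_left₀ (norm_nonneg _) (abs_coord_le ξ j) 2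
    have h3 : 4 * Real.pi ^ 2 * α * ‖ξ‖ ^ 2 ≤ stressSymbol α ξ := by unfold stressSymbol; linarith
    calc _ = (4 * Real.pi ^ 2 * α * ‖ξ j‖ ^ 2) * ‖ft (fun x => v x i) ξ‖ ^ 2 := by ring
      _ ≤ (4 * Real.pi ^ 2 * α * ‖ξ‖ ^ 2) * ∑ i, ‖ftc v i ξ‖ ^ 2 := by gcongr
      _ ≤ _ := by gcongr
  obtain ⟨g, hg⟩ := exists_isWD (memLp_coord hv i) hL
  exact ⟨g, hg.right, hg.weak⟩

theorem MemH1.integral_abs_crossDensity_le (hα : 0 ≤ α) (hw : MemH1 w) (hv : MemH1 v) :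
    ∫ ξ, |crossDensity α w v ξ| ≤ energy α w + energy α v := by
  have e : energy α w + energy α v = ∫ ξ, (energyDensity α w ξ + energyDensity α v ξ) :=
    (integral_add hw.integrable_energyDensity hv.integrable_energyDensity).symm
  rw [e]
  refine integral_mono (hw.integrable_crossDensity hα hv).abs
    (hw.integrable_energyDensity.add hv.integrable_energyDensity) fun ξ => ?_
  refine (abs_crossDensity_le hα w v ξ).trans ?_
  have hs := (stressSymbol_pos hα ξ).le
  simp only [energyDensity, ← amplitude_sq]
  rw [← mul_add]
  refine mul_le_mul_of_nonneg_left ?_ hs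
  nlinarith [sq_nonneg (amplitude w ξ - amplitude v ξ), sq_nonneg (amplitude w ξ + amplitude v ξ)]

theorem abs_truncatedForm_le (hα : 0 ≤ α) (R : ℝ) {v w : L2V} (hw : MemH1 w) (hv : MemH1 v) :
    |truncatedForm hα R w v| ≤ energy α w + energy α v := by
  rw [truncatedForm_apply]
  refine (abs_integral_le_integral_abs).trans
    ((setIntegral_le_integral (hw.integrable_crossDensity hα hv).abs
      (Eventually.of_forall fun ξ => abs_nonneg _)).trans (hw.integral_abs_crossDensity_le hα hv))

theorem L2V_norm_sq_le (hα : 0 ≤ α) {w : L2V} (hw : MemH1 w) : ‖w‖ ^ 2 ≤ energy α w := by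
  rw [L2V_norm_sq]
  refine integral_mono (memLp_amplitude w).integrable_sq hw.integrable_energyDensity fun ξ => ?_
  simp only [amplitude_sq]
  exact normSq_le_energyDensity hα w ξ

/-- On a ball the symbol of 1 - αΔ is bounded, so the truncated energy is a continuous quadratic
form on L² and the chain rule for Lipschitz curves applies. -/
theorem IsEvolution.truncated (h : IsEvolution α μ u u') (hα : 0 ≤ α) {T : ℝ} (hT : 0 < T) (R : ℝ) :
    ContinuousOn (fun t => lowEnergy α R (u t)) (Icc 0 T) ∧
    IntervalIntegrable (fun t => truncatedForm hα R (u' t) (u t)) volume 0 T ∧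
    ∀ t ∈ Icc 0 T, lowEnergy α R (u t) - lowEnergy α R (u 0)
      = 2 * ∫ τ in (0 : ℝ)..t, truncatedForm hα R (u' τ) (u τ) := by
  obtain ⟨M, hM⟩ := h.bound T hT
  have hb : ∀ᵐ t ∂(volume.restrict (Ioo (0 : ℝ) T)), ‖u' t‖ ≤ Real.sqrt M := by
    filter_upwards [hM] with t ht
    exact Real.le_sqrt_of_sq_le ((L2V_norm_sq_le hα ht.2.1.1).trans ht.2.2.2.2)
  obtain ⟨a1, a2, a3⟩ := bilinear_sub_eq_integral (truncatedForm hα R) (truncatedForm_symm hα R) hT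
    (h.meas.mono_set Ioo_subset_Ioi_self) hb fun t ht => h.eq t ht.1
  simp only [truncatedForm_self] at a1 a3
  exact ⟨a1, a2, a3⟩

theorem ae_Ioc_of_ae_Ioo {p : ℝ → Prop} {T : ℝ} (h : ∀ᵐ t ∂(volume.restrict (Ioo (0 : ℝ) T)), p t) :
    ∀ᵐ t ∂(volume : Measure ℝ), t ∈ Ioc 0 T → p t := by
  rwa [← Measure.restrict_congr_set Ioo_ae_eq_Ioc.symm, ae_restrict_iff' measurableSet_Ioc] at h

/-- H¹ membership is given only for almost every time. The truncated energies at time t are bounded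
independently of the radius, because the a.e. bounds control their rates, and monotone convergence
then gives a finite full energy. -/
theorem IsEvolution.memH1 (h : IsEvolution α μ u u') (hα : 0 < α) {t : ℝ} (ht : 0 ≤ t) :
    MemH1 (u t) := by
  have hT : 0 < t + 1 := by linarith
  obtain ⟨M, hM⟩ := h.bound (t + 1) hT
  have hM' := ae_Ioc_of_ae_Ioo hM
  refine memH1_of_integrable_energyDensity hα (Lp.memLp _) ?_
  refine aecover_ball.integrable_of_integral_bounded_of_nonneg_ae
    (energy α (u 0) + 2 * ((M + M) * t))
    (fun n => integrableOn_energyDensity hα.le _ _)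
    (Eventually.of_forall fun ξ => energyDensity_nonneg hα.le _ ξ) (Eventually.of_forall fun n => ?_)
  obtain ⟨-, -, h3⟩ := h.truncated hα.le hT n
  have e := h3 t ⟨ht, by linarith⟩
  have b : ‖∫ τ in (0 : ℝ)..t, truncatedForm hα.le n (u' τ) (u τ)‖ ≤ (M + M) * |t - 0| := by
    refine intervalIntegral.norm_integral_le_of_norm_le_const_ae ?_
    filter_upwards [hM'] with τ h1 h2
    rw [uIoc_of_le ht] at h2
    obtain ⟨p1, p2, -, p3, p4⟩ := h1 ⟨h2.1, h2.2.trans (by linarith)⟩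
    exact (abs_truncatedForm_le hα.le n p2.1 p1.1.1).trans (add_le_add p4 p3)
  rw [sub_zero, abs_of_nonneg ht] at b
  have b2 := (le_abs_self _).trans b
  have b3 := h.init.1.1.lowEnergy_le hα.le n
  change lowEnergy α n (u t) ≤ _
  linarith

theorem tendsto_lowEnergy (hv : MemH1 v) :
    Tendsto (fun n : ℕ => lowEnergy α n v) atTop (𝓝 (energy α v)) :=
  aecover_ball.integral_tendsto_of_countably_generated hv.integrable_energyDensity

/-- The energy equality. -/
theorem IsEvolution.energy_sub (h : IsEvolution α μ u u') (hα : 0 < α) (hμ : 0 < μ) {T : ℝ}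
    (hT : 0 < T) :
    IntervalIntegrable (fun t => ∫ ξ, dissipationDensity (u t) ξ) volume 0 T ∧
    ∀ t ∈ Icc 0 T, energy α (u t) - energy α (u 0)
      = -2 * μ * ∫ τ in (0 : ℝ)..t, ∫ ξ, dissipationDensity (u τ) ξ := by
  obtain ⟨M, hM⟩ := h.bound T hT
  have hM' := ae_Ioc_of_ae_Ioo hM
  -- As the radius grows, the truncated rate tends to the full cross term, which the fixed-time
  -- energy identity evaluates. The domination is the constant M + M.
  have hlim : ∀ᵐ τ ∂(volume : Measure ℝ), τ ∈ Ioc 0 T → Tendsto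
      (fun n : ℕ => truncatedForm hα.le n (u' τ) (u τ)) atTop
      (𝓝 (-μ * ∫ ξ, dissipationDensity (u τ) ξ)) := by
    filter_upwards [hM'] with τ h1 h2
    obtain ⟨p1, p2, p3, -⟩ := h1 h2
    rw [← p1.energy_identity hα p2 p3]
    simp only [truncatedForm_apply]
    exact aecover_ball.integral_tendsto_of_countably_generated
      (p2.1.integrable_crossDensity hα.le p1.1.1)
  have hbd : ∀ n : ℕ, ∀ᵐ τ ∂(volume : Measure ℝ), τ ∈ Ioc 0 T →
      ‖truncatedForm hα.le n (u' τ) (u τ)‖ ≤ M + M := fun n => by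
    filter_upwards [hM'] with τ h1 h2
    obtain ⟨p1, p2, -, p3, p4⟩ := h1 h2
    exact (abs_truncatedForm_le hα.le n p2.1 p1.1.1).trans (add_le_add p4 p3)
  have hint : IntervalIntegrable (fun t => -μ * ∫ ξ, dissipationDensity (u t) ξ) volume 0 T := by
    rw [intervalIntegrable_iff_integrableOn_Ioc_of_le hT.le]
    refine ⟨aestronglyMeasurable_of_tendsto_ae atTop (f := fun (n : ℕ) τ =>
      truncatedForm hα.le n (u' τ) (u τ)) (fun n => ?_)
      ((ae_restrict_iff' measurableSet_Ioc).2 hlim),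
      HasFiniteIntegral.restrict_of_bounded (M + M) (by simp)
      ((ae_restrict_iff' measurableSet_Ioc).2 ?_)⟩
    · exact (h.truncated hα.le hT n).2.1.1.1
    · filter_upwards [hlim, ae_all_iff.2 hbd] with τ h1 h2 h3
      exact le_of_tendsto (h1 h3).norm (Eventually.of_forall fun n => h2 n h3)
  constructor
  · refine (hint.const_mul (-μ)⁻¹).congr (fun t _ => ?_)
    have : -μ ≠ 0 := by linarith
    field_simp
  intro t ht
  have hDCT : Tendsto (fun n : ℕ => ∫ τ in (0 : ℝ)..t, truncatedForm hα.le n (u' τ) (u τ)) atTop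
      (𝓝 (∫ τ in (0 : ℝ)..t, -μ * ∫ ξ, dissipationDensity (u τ) ξ)) := by
    refine intervalIntegral.tendsto_integral_filter_of_dominated_convergence (fun _ => M + M)
      (Eventually.of_forall fun n => ?_) (Eventually.of_forall fun n => ?_) (by simp) ?_
    · rw [uIoc_of_le ht.1]
      exact (h.truncated hα.le hT n).2.1.1.1.mono_set (Ioc_subset_Ioc_right ht.2)
    · filter_upwards [hbd n] with τ h1 h2
      rw [uIoc_of_le ht.1] at h2
      exact h1 ⟨h2.1, h2.2.trans ht.2⟩
    · filter_upwards [hlim] with τ h1 h2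
      rw [uIoc_of_le ht.1] at h2
      exact h1 ⟨h2.1, h2.2.trans ht.2⟩
  have hl := (tendsto_lowEnergy (α := α) (h.memH1 hα ht.1)).sub
    (tendsto_lowEnergy (α := α) h.init.1.1)
  simp only [(h.truncated hα.le hT _).2.2 t ht] at hl
  have := tendsto_nhds_unique hl (hDCT.const_mul 2)
  rw [this, intervalIntegral.integral_const_mul]
  ring

theorem IsEvolution.continuousOn_energy (h : IsEvolution α μ u u') (hα : 0 < α) (hμ : 0 < μ) {T : ℝ}
    (hT : 0 < T) : ContinuousOn (fun t => energy α (u t)) (Icc 0 T) := by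
  obtain ⟨h1, h2⟩ := h.energy_sub hα hμ hT
  have := intervalIntegral.continuousOn_primitive_interval' h1 left_mem_uIcc
  rw [uIcc_of_le hT.le] at this
  refine ((this.const_smul (-2 * μ)).const_add (energy α (u 0))).congr fun t ht => ?_
  have := h2 t ht
  simp only [Pi.smul_apply, smul_eq_mul]
  linarith

/-- The rate is bounded by the energy times the square root of the low-frequency energy. Replacing
that root by its maximum √Y over [0, t] gives Y ≤ Y₀ + 2KκI√Y, with I the time integral of the
energy, and Young's inequality absorbs √Y into half of Y. -/
theorem IsEvolution.lowEnergy_le (h : IsEvolution α μ u u') (hα : 0 < α) (hμ : 0 < μ) {ρ : ℝ}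
    (hρ : 0 < ρ) (hρ1 : ρ ≤ 1) {t : ℝ} (ht : 0 ≤ t) :
    lowEnergy α ρ (u t) ≤ 2 * lowEnergy α ρ (u 0) +
      4 * (16000 * (1 + α) * (1 + 1 / α) * Real.sqrt (Real.pi * 4 / 3)) ^ 2 * ρ ^ 5
        * (∫ τ in (0 : ℝ)..t, energy α (u τ)) ^ 2 := by
  set K := 16000 * (1 + α) * (1 + 1 / α) * Real.sqrt (Real.pi * 4 / 3) with hK
  have hK0 : 0 ≤ K := by positivity
  have hT : 0 < t + 1 := by linarith
  obtain ⟨M, hM⟩ := h.bound (t + 1) hT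
  have hM' := ae_Ioc_of_ae_Ioo hM
  obtain ⟨c1, c2, c3⟩ := h.truncated hα.le hT ρ
  have hsubset : Icc 0 t ⊆ Icc 0 (t + 1) := Icc_subset_Icc_right (by linarith)
  obtain ⟨s, hs, hmax⟩ := isCompact_Icc.exists_isMaxOn (nonempty_Icc.2 ht) (c1.mono hsubset)
  set Y := lowEnergy α ρ (u s) with hY
  have hY0 : 0 ≤ Y := lowEnergy_nonneg hα.le ρ _
  have hE : IntervalIntegrable (fun τ => energy α (u τ)) volume 0 (t + 1) := by
    refine ContinuousOn.intervalIntegrable ?_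
    rw [uIcc_of_le hT.le]
    exact h.continuousOn_energy hα hμ hT
  set I := ∫ τ in (0 : ℝ)..t, energy α (u τ) with hI
  have hIs : ∫ τ in (0 : ℝ)..s, energy α (u τ) ≤ I :=
    intervalIntegral.integral_mono_interval le_rfl hs.1 hs.2
      (Eventually.of_forall fun τ => energy_nonneg hα.le _)
      (hE.mono_set (by rw [uIcc_of_le ht, uIcc_of_le hT.le]; exact hsubset))
  have hI0 : 0 ≤ ∫ τ in (0 : ℝ)..s, energy α (u τ) :=
    intervalIntegral.integral_nonneg hs.1 fun τ _ => energy_nonneg hα.le _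
  set κ := ρ * Real.sqrt (ρ ^ 3) with hκ
  have hκ0 : 0 ≤ κ := by positivity
  have hκ2 : κ ^ 2 = ρ ^ 5 := by
    rw [hκ, mul_pow, Real.sq_sqrt (by positivity)]; ring
  have step : ∫ τ in (0 : ℝ)..s, truncatedForm hα.le ρ (u' τ) (u τ)
      ≤ ∫ τ in (0 : ℝ)..s, (K * κ * Real.sqrt Y) * energy α (u τ) := by
    have hsub2 : uIcc 0 s ⊆ uIcc 0 (t + 1) := by
      rw [uIcc_of_le hs.1, uIcc_of_le hT.le]
      exact Icc_subset_Icc_right (hs.2.trans (by linarith))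
    refine intervalIntegral.integral_mono_ae_restrict hs.1 (c2.mono_set hsub2)
      ((hE.mono_set hsub2).const_mul _) ?_
    refine (ae_restrict_iff' measurableSet_Icc).2 ?_
    filter_upwards [hM', measure_eq_zero_iff_ae_notMem.1 (Real.volume_singleton (a := 0))]
      with τ h1 h0 h2
    have hτ0 : 0 < τ := lt_of_le_of_ne h2.1 fun e => h0 e.symm
    obtain ⟨p1, p2, p3, -⟩ := h1 ⟨hτ0, h2.2.trans (hs.2.trans (by linarith))⟩
    have q1 := p1.low_frequency_bound hα hμ p2 p3 hρ hρ1
    have q2 : lowEnergy α ρ (u τ) ≤ Y := hmax ⟨h2.1, h2.2.trans hs.2⟩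
    have q3 := energy_nonneg hα.le (u τ)
    have q4 := Real.sqrt_le_sqrt q2
    rw [truncatedForm_apply]
    refine q1.trans ?_
    change K * energy α (u τ) * κ * Real.sqrt (lowEnergy α ρ (u τ)) ≤ _
    calc _ = (K * κ * energy α (u τ)) * Real.sqrt (lowEnergy α ρ (u τ)) := by ring
      _ ≤ (K * κ * energy α (u τ)) * Real.sqrt Y := by gcongr
      _ = _ := by ring
  rw [intervalIntegral.integral_const_mul] at step
  have e := c3 s (hsubset hs)
  have hr : Real.sqrt Y ^ 2 = Y := Real.sq_sqrt hY0
  have h5 : K * κ * Real.sqrt Y * ∫ τ in (0 : ℝ)..s, energy α (u τ) ≤ K * κ * Real.sqrt Y * I := by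
    gcongr
  have h6 : Y ≤ lowEnergy α ρ (u 0) + 2 * (K * κ * Real.sqrt Y * I) := by linarith
  have h7 : 4 * (K * κ * Real.sqrt Y * I) ≤ Y + 4 * (K * κ * I) ^ 2 := by
    nlinarith [sq_nonneg (Real.sqrt Y - 2 * (K * κ * I))]
  have h8 : lowEnergy α ρ (u t) ≤ Y := hmax ⟨ht, le_rfl⟩
  have h9 : (K * κ * I) ^ 2 = K ^ 2 * ρ ^ 5 * I ^ 2 := by rw [← hκ2]; ring
  nlinarith

end

/-! ### Decay of scalar functions with a dissipation inequality -/

/-- `E ≥ 0` is absolutely continuous with derivative `-D`, `D ≥ 0`. -/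
structure IsDissipative (E D : ℝ → ℝ) : Prop where
  nonneg : ∀ t, 0 ≤ E t
  rate_nonneg : ∀ t, 0 ≤ D t
  integrable : ∀ T > 0, IntervalIntegrable D volume 0 T
  eq : ∀ t ≥ 0, E t - E 0 = -∫ τ in (0 : ℝ)..t, D τ

section

variable {E D : ℝ → ℝ}

theorem IsDissipative.intervalIntegrable (h : IsDissipative E D) {s t : ℝ} (hs : 0 ≤ s)
    (hst : s ≤ t) : IntervalIntegrable D volume s t := by
  refine (h.integrable (t + 1) (by linarith)).mono_set ?_
  rw [uIcc_of_le hst, uIcc_of_le (by linarith)]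
  exact Icc_subset_Icc hs (by linarith)

theorem IsDissipative.sub_eq (h : IsDissipative E D) {s t : ℝ} (hs : 0 ≤ s) (hst : s ≤ t) :
    E t - E s = -∫ τ in s..t, D τ := by
  have := intervalIntegral.integral_interval_sub_left (h.intervalIntegrable le_rfl (hs.trans hst))
    (h.intervalIntegrable le_rfl hs)
  linarith [h.eq t (hs.trans hst), h.eq s hs]

theorem IsDissipative.le_of_le (h : IsDissipative E D) {s t : ℝ} (hs : 0 ≤ s) (hst : s ≤ t) :
    E t ≤ E s := by
  have := intervalIntegral.integral_nonneg (μ := volume) hst fun τ _ => h.rate_nonneg τ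
  linarith [h.sub_eq hs hst]

theorem IsDissipative.continuousOn (h : IsDissipative E D) {T : ℝ} (hT : 0 < T) :
    ContinuousOn E (Icc 0 T) := by
  have := intervalIntegral.continuousOn_primitive_interval' (h.integrable T hT) left_mem_uIcc
  rw [uIcc_of_le hT.le] at this
  refine (this.neg.const_add (E 0)).congr fun t ht => ?_
  have := h.eq t ht.1
  simp only [Pi.neg_apply]
  linarith

theorem IsDissipative.intervalIntegrable_left (h : IsDissipative E D) {T : ℝ} (hT : 0 ≤ T) :
    IntervalIntegrable E volume 0 T := by
  refine ContinuousOn.intervalIntegrable ?_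
  rw [uIcc_of_le hT]
  exact (h.continuousOn (T := T + 1) (by linarith)).mono (Icc_subset_Icc_right (by linarith))

/-- A barrier argument. If the bound failed at t, take the last earlier time at which E lies under
the barrier; beyond it E lies above, so E falls at least as fast as the barrier and cannot exceed it
at t. -/
theorem IsDissipative.le_rpow (h : IsDissipative E D) {T₀ B a K : ℝ} (hT₀ : 1 ≤ T₀) (ha : a ≤ 5 / 2)
    (hB : 0 ≤ B) (hK : 6 * B ≤ K) (hK0 : E 0 ≤ K * T₀ ^ (-a))
    (hD : ∀ τ ≥ 0, 3 / (τ + T₀) * (E τ - B * (τ + T₀) ^ (-a)) ≤ D τ) {t : ℝ} (ht : 0 ≤ t) :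
    E t ≤ K * (t + T₀) ^ (-a) := by
  set Y : ℝ → ℝ := fun t => K * (t + T₀) ^ (-a) with hY
  by_contra! hlt
  have ht0 : 0 < t := by
    rcases ht.eq_or_lt with e | e
    · rw [← e, zero_add] at hlt; linarith
    · exact e
  have hYc : ContinuousOn Y (Icc 0 t) := by
    refine continuousOn_const.mul (ContinuousOn.rpow_const (by fun_prop) fun x hx => Or.inl ?_)
    have := hx.1; linarith
  have hZ : ContinuousOn (fun τ => E τ - Y τ) (Icc 0 t) := (h.continuousOn ht0).sub hYc
  set S : Set ℝ := Icc 0 t ∩ (fun τ => E τ - Y τ) ⁻¹' Iic 0 with hS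
  have hSc : IsCompact S := isCompact_Icc.of_isClosed_subset
    (hZ.preimage_isClosed_of_isClosed isClosed_Icc isClosed_Iic) inter_subset_left
  have hSne : S.Nonempty := ⟨0, ⟨le_rfl, ht⟩, by simp [hY]; linarith⟩
  obtain ⟨s, ⟨hs, hs2⟩, hmax⟩ := hSc.exists_isGreatest hSne
  have hs2' : E s ≤ Y s := by simpa using hs2
  have hpos : ∀ τ ∈ Ioc s t, Y τ < E τ := fun τ hτ => by
    by_contra! hc
    have : τ ∈ S := ⟨⟨hs.1.trans hτ.1.le, hτ.2⟩, by simpa using hc⟩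
    exact absurd (hmax this) (not_le.2 hτ.1)
  have hder : ∀ τ ∈ uIcc s t, HasDerivAt Y (K * (-a * (τ + T₀) ^ (-a - 1))) τ := fun τ hτ => by
    rw [uIcc_of_le hs.2] at hτ
    have hp : 0 < τ + T₀ := by linarith [hs.1, hτ.1]
    have := ((hasDerivAt_id τ).add_const T₀).rpow_const (p := -a) (Or.inl hp.ne')
    simpa using this.const_mul K
  have hdc : ContinuousOn (fun τ => K * (-a * (τ + T₀) ^ (-a - 1))) (uIcc s t) := by
    rw [uIcc_of_le hs.2]
    refine continuousOn_const.mul (continuousOn_const.mul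
      (ContinuousOn.rpow_const (by fun_prop) fun x hx => Or.inl ?_))
    have := hx.1; have := hs.1; linarith
  have hYint := intervalIntegral.integral_eq_sub_of_hasDerivAt hder hdc.intervalIntegrable
  have hle : ∫ τ in s..t, -(K * (-a * (τ + T₀) ^ (-a - 1))) ≤ ∫ τ in s..t, D τ := by
    refine intervalIntegral.integral_mono_on_of_le_Ioo hs.2 hdc.intervalIntegrable.neg
      (h.intervalIntegrable hs.1 hs.2) fun τ hτ => ?_
    have hp : 0 < τ + T₀ := by linarith [hs.1, hτ.1]
    refine le_trans ?_ (hD τ (by linarith [hs.1, hτ.1]))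
    have h1 := (hpos τ ⟨hτ.1, hτ.2.le⟩).le
    simp only [hY] at h1
    have h2 : (τ + T₀) ^ (-a - 1) = (τ + T₀) ^ (-a) / (τ + T₀) := Real.rpow_sub_one hp.ne' _
    have h3 : 0 < (τ + T₀) ^ (-a) := Real.rpow_pos_of_pos hp _
    rw [h2, div_mul_eq_mul_div, le_div_iff₀ hp]
    have h4 : -(K * (-a * ((τ + T₀) ^ (-a) / (τ + T₀)))) * (τ + T₀) = a * K * (τ + T₀) ^ (-a) := by
      field_simp
    rw [h4]
    -- With B ≤ K/6, the right side is at least 5K/2, and a ≤ 5/2. The splitting constant 3 exceeds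
    -- 5/2 precisely to leave this margin.
    have h5 : a * K ≤ 3 * (K - B) := by nlinarith
    calc a * K * (τ + T₀) ^ (-a) ≤ 3 * (K - B) * (τ + T₀) ^ (-a) := by gcongr
      _ ≤ _ := by linarith
  rw [intervalIntegral.integral_neg, hYint] at hle
  have := h.sub_eq hs.1 hs.2
  have : E t ≤ Y t := by linarith
  exact absurd this (not_le.2 hlt)

/-- A growth bound s^c for (∫E)² makes the quadratic source s^(c-5/2). The new rate is thus limited
by the initial data through q and by 5/2 - c. -/
theorem IsDissipative.bootstrap_step (h : IsDissipative E D) {T₀ c₁ c₂ E₀ L q c a : ℝ}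
    (hT₀ : 1 ≤ T₀) (hc₁ : 0 ≤ c₁) (hc₂ : 0 ≤ c₂) (hE₀ : E 0 ≤ E₀) (hL : 0 ≤ L)
    (hD : ∀ τ ≥ 0, 3 / (τ + T₀) * (E τ - (c₁ * (τ + T₀) ^ (-q)
      + c₂ * (τ + T₀) ^ (-(5 / 2 : ℝ)) * (∫ s in (0 : ℝ)..τ, E s) ^ 2)) ≤ D τ)
    (hI : ∀ τ ≥ 0, (∫ s in (0 : ℝ)..τ, E s) ^ 2 ≤ L * (τ + T₀) ^ c)
    (haq : a ≤ q) (hac : a ≤ 5 / 2 - c) (ha : a ≤ 5 / 2) {t : ℝ} (ht : 0 ≤ t) :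
    E t ≤ max (6 * (c₁ + c₂ * L)) (E₀ * T₀ ^ a) * (t + T₀) ^ (-a) := by
  have hT0 : 0 < T₀ := by linarith
  refine h.le_rpow hT₀ ha (B := c₁ + c₂ * L) (by positivity) (le_max_left _ _) ?_ ?_ ht
  · calc E 0 ≤ E₀ * (T₀ ^ a * T₀ ^ (-a)) := by
          rw [← Real.rpow_add hT0, add_neg_cancel, Real.rpow_zero, mul_one]; exact hE₀
      _ = E₀ * T₀ ^ a * T₀ ^ (-a) := by ring
      _ ≤ _ := by gcongr; exact le_max_right _ _
  · intro τ hτ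
    have hp : 1 ≤ τ + T₀ := by linarith
    have hp0 : 0 < τ + T₀ := by linarith
    refine le_trans ?_ (hD τ hτ)
    have h1 : (τ + T₀) ^ (-q) ≤ (τ + T₀) ^ (-a) := Real.rpow_le_rpow_of_exponent_le hp (by linarith)
    have h2 : (τ + T₀) ^ (-(5 / 2 : ℝ)) * (∫ s in (0 : ℝ)..τ, E s) ^ 2 ≤ L * (τ + T₀) ^ (-a) :=
      calc _ ≤ (τ + T₀) ^ (-(5 / 2 : ℝ)) * (L * (τ + T₀) ^ c) := by
            gcongr; exact hI τ hτ
        _ = L * (τ + T₀) ^ (-(5 / 2 : ℝ) + c) := by rw [Real.rpow_add hp0]; ring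
        _ ≤ _ := by
            refine mul_le_mul_of_nonneg_left
              (Real.rpow_le_rpow_of_exponent_le hp (by linarith)) hL
    have h3 : c₁ * (τ + T₀) ^ (-q) + c₂ * (τ + T₀) ^ (-(5 / 2 : ℝ)) * (∫ s in (0 : ℝ)..τ, E s) ^ 2
        ≤ (c₁ + c₂ * L) * (τ + T₀) ^ (-a) := by
      rw [mul_assoc, add_mul, mul_assoc]
      gcongr
    gcongr

theorem IsDissipative.integral_sq_le (h : IsDissipative E D) {T₀ K p : ℝ} (hT₀ : 1 ≤ T₀)
    (hE : ∀ t ≥ 0, E t ≤ K * (t + T₀) ^ (-p)) {F : ℝ → ℝ}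
    (hF : ∀ τ ≥ 0, ∫ s in (0 : ℝ)..τ, (s + T₀) ^ (-p) ≤ F τ) {τ : ℝ} (hτ : 0 ≤ τ) :
    (∫ s in (0 : ℝ)..τ, E s) ^ 2 ≤ K ^ 2 * F τ ^ 2 := by
  have hK : 0 ≤ K := by
    have h1 := (h.nonneg 0).trans (hE 0 le_rfl)
    exact nonneg_of_mul_nonneg_left h1 (Real.rpow_pos_of_pos (by linarith) _)
  have hc : IntervalIntegrable (fun s => K * (s + T₀) ^ (-p)) volume 0 τ := by
    refine ContinuousOn.intervalIntegrable ?_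
    rw [uIcc_of_le hτ]
    refine continuousOn_const.mul (ContinuousOn.rpow_const (by fun_prop) fun x hx => Or.inl ?_)
    have := hx.1; linarith
  have h1 : ∫ s in (0 : ℝ)..τ, E s ≤ ∫ s in (0 : ℝ)..τ, K * (s + T₀) ^ (-p) :=
    intervalIntegral.integral_mono_on hτ (h.intervalIntegrable_left hτ) hc fun s hs => hE s hs.1
  rw [intervalIntegral.integral_const_mul] at h1
  have h0 : 0 ≤ ∫ s in (0 : ℝ)..τ, E s := intervalIntegral.integral_nonneg hτ fun s _ => h.nonneg s
  rw [← mul_pow]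
  exact pow_le_pow_left₀ h0 (h1.trans (mul_le_mul_of_nonneg_left (hF τ hτ) hK)) 2

theorem integral_shift_rpow {T₀ p : ℝ} (hT₀ : 1 ≤ T₀) (hp : p ≠ 1) {τ : ℝ} (hτ : 0 ≤ τ) :
    ∫ s in (0 : ℝ)..τ, (s + T₀) ^ (-p)
      = ((τ + T₀) ^ (-p + 1) - T₀ ^ (-p + 1)) / (-p + 1) := by
  rw [intervalIntegral.integral_comp_add_right (fun s => s ^ (-p)) T₀, zero_add]
  refine integral_rpow (Or.inr ⟨fun h => hp (by linarith), fun h => ?_⟩)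
  rw [uIcc_of_le (by linarith)] at h
  linarith [h.1]

theorem IsDissipative.integral_sq_le_zero (h : IsDissipative E D) {T₀ E₀ : ℝ} (hT₀ : 1 ≤ T₀)
    (hE₀ : E 0 ≤ E₀) {τ : ℝ} (hτ : 0 ≤ τ) :
    (∫ s in (0 : ℝ)..τ, E s) ^ 2 ≤ E₀ ^ 2 * (τ + T₀) ^ (2 : ℝ) := by
  rw [Real.rpow_ofNat]
  refine h.integral_sq_le (p := 0) (F := fun τ => τ + T₀) hT₀ (fun t ht => ?_) (fun τ hτ => ?_) hτ
  · simpa using (h.le_of_le le_rfl ht).trans hE₀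
  · simp; linarith

theorem IsDissipative.integral_sq_le_half (h : IsDissipative E D) {T₀ K : ℝ} (hT₀ : 1 ≤ T₀)
    (hE : ∀ t ≥ 0, E t ≤ K * (t + T₀) ^ (-(1 / 2 : ℝ))) {τ : ℝ} (hτ : 0 ≤ τ) :
    (∫ s in (0 : ℝ)..τ, E s) ^ 2 ≤ (4 * K ^ 2) * (τ + T₀) ^ (1 : ℝ) := by
  have hp : 0 ≤ τ + T₀ := by linarith
  have := h.integral_sq_le hT₀ hE (F := fun τ => 2 * (τ + T₀) ^ (1 / 2 : ℝ)) (fun τ hτ => ?_) hτ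
  · refine this.trans_eq ?_
    rw [mul_pow, ← Real.sqrt_eq_rpow, Real.sq_sqrt hp, Real.rpow_one]
    ring
  · rw [integral_shift_rpow hT₀ (by norm_num) hτ]
    have : 0 ≤ T₀ ^ (1 / 2 : ℝ) := by positivity
    norm_num at this ⊢
    linarith

theorem IsDissipative.integral_sq_le_three_halves (h : IsDissipative E D) {T₀ K : ℝ} (hT₀ : 1 ≤ T₀)
    (hE : ∀ t ≥ 0, E t ≤ K * (t + T₀) ^ (-(3 / 2 : ℝ))) {τ : ℝ} (hτ : 0 ≤ τ) :
    (∫ s in (0 : ℝ)..τ, E s) ^ 2 ≤ (4 * K ^ 2) * (τ + T₀) ^ (0 : ℝ) := by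
  have := h.integral_sq_le hT₀ hE (F := fun _ => 2) (fun τ hτ => ?_) hτ
  · refine this.trans_eq ?_
    rw [Real.rpow_zero]; ring
  · rw [integral_shift_rpow hT₀ (by norm_num) hτ]
    have h1 : 0 ≤ (τ + T₀) ^ (-(1 / 2) : ℝ) := Real.rpow_nonneg (by linarith) _
    have h2 : T₀ ^ (-(1 / 2) : ℝ) ≤ 1 := Real.rpow_le_one_of_one_le_of_nonpos hT₀ (by norm_num)
    norm_num at h1 h2 ⊢
    linarith

/-- The ladder of rates 1/2, 3/2, 5/2: bounds on E of order 0, 1/2 and 3/2 give (∫E)² growth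
exponents c = 2, 1 and 0. The climb stops at the first rung allowing q. No logarithm appears because
the rate 1 is never used for the integral. -/
theorem exists_decay_constant {T₀ c₁ c₂ E₀ q : ℝ} (hT₀ : 1 ≤ T₀) (hc₁ : 0 ≤ c₁) (hc₂ : 0 ≤ c₂)
    (hq : q ≤ 5 / 2) :
    ∃ K : ℝ, ∀ E D : ℝ → ℝ, IsDissipative E D → E 0 ≤ E₀ →
      (∀ τ ≥ 0, 3 / (τ + T₀) * (E τ - (c₁ * (τ + T₀) ^ (-q)
        + c₂ * (τ + T₀) ^ (-(5 / 2 : ℝ)) * (∫ s in (0 : ℝ)..τ, E s) ^ 2)) ≤ D τ) →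
      ∀ t ≥ 0, E t ≤ K * (t + T₀) ^ (-q) := by
  rcases le_or_gt q (1 / 2) with h1 | h1
  · exact ⟨_, fun E D h h0 hD t ht => h.bootstrap_step hT₀ hc₁ hc₂ h0 (sq_nonneg E₀) hD
      (fun τ hτ => h.integral_sq_le_zero hT₀ h0 hτ) le_rfl (by linarith) hq ht⟩
  set K₁ := max (6 * (c₁ + c₂ * E₀ ^ 2)) (E₀ * T₀ ^ (1 / 2 : ℝ))
  have s1 : ∀ E D : ℝ → ℝ, IsDissipative E D → E 0 ≤ E₀ →
      (∀ τ ≥ 0, 3 / (τ + T₀) * (E τ - (c₁ * (τ + T₀) ^ (-q)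
        + c₂ * (τ + T₀) ^ (-(5 / 2 : ℝ)) * (∫ s in (0 : ℝ)..τ, E s) ^ 2)) ≤ D τ) →
      ∀ t ≥ 0, E t ≤ K₁ * (t + T₀) ^ (-(1 / 2 : ℝ)) :=
    fun E D h h0 hD t ht => h.bootstrap_step hT₀ hc₁ hc₂ h0 (sq_nonneg E₀) hD
      (fun τ hτ => h.integral_sq_le_zero hT₀ h0 hτ) h1.le (by norm_num) (by norm_num) ht
  rcases le_or_gt q (3 / 2) with h2 | h2
  · exact ⟨_, fun E D h h0 hD t ht => h.bootstrap_step hT₀ hc₁ hc₂ h0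
      (by positivity : 0 ≤ 4 * K₁ ^ 2) hD
      (fun τ hτ => h.integral_sq_le_half hT₀ (s1 E D h h0 hD) hτ) le_rfl (by linarith) hq ht⟩
  set K₂ := max (6 * (c₁ + c₂ * (4 * K₁ ^ 2))) (E₀ * T₀ ^ (3 / 2 : ℝ))
  exact ⟨_, fun E D h h0 hD t ht => h.bootstrap_step hT₀ hc₁ hc₂ h0
      (by positivity : 0 ≤ 4 * K₂ ^ 2) hD
      (fun τ hτ => h.integral_sq_le_three_halves hT₀ (fun t ht => h.bootstrap_step hT₀ hc₁ hc₂ h0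
        (by positivity : 0 ≤ 4 * K₁ ^ 2) hD
        (fun τ hτ => h.integral_sq_le_half hT₀ (s1 E D h h0 hD) hτ) h2.le (by norm_num)
        (by norm_num) ht) hτ) le_rfl (by linarith) hq ht⟩

end

/-! ### Fourier splitting applied to evolutions. -/

section

variable {α μ : ℝ} {u u' : ℝ → L2V} {v : E3 → E3}

theorem dissipationDensity_nonneg (v : E3 → E3) (ξ : E3) : 0 ≤ dissipationDensity v ξ := by
  unfold dissipationDensity
  have : 0 ≤ ∑ i, ‖ftc v i ξ‖ ^ 2 := Finset.sum_nonneg fun i _ => by positivity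
  positivity

theorem IsEvolution.isDissipative (h : IsEvolution α μ u u') (hα : 0 < α) (hμ : 0 < μ) :
    IsDissipative (fun t => energy α (u t)) fun t => 2 * μ * ∫ ξ, dissipationDensity (u t) ξ where
  nonneg t := energy_nonneg hα.le _
  rate_nonneg t := by
    have : 0 ≤ ∫ ξ, dissipationDensity (u t) ξ :=
      integral_nonneg fun ξ => dissipationDensity_nonneg (u t) ξ
    exact mul_nonneg (by positivity) this
  integrable T hT := (h.energy_sub hα hμ hT).1.const_mul _
  eq t ht := by
    rw [intervalIntegral.integral_const_mul]
    have := (h.energy_sub hα hμ (T := t + 1) (by linarith)).2 t ⟨ht, by linarith⟩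
    linarith

/-- High frequencies are dissipated at rate `3 / s`. -/
theorem MemH1.high_frequency_le (hμ : 0 < μ) (hv : MemH1 v) {s : ℝ} (hs : 0 < s)
    (hs2 : 3 * α ≤ μ * s) :
    3 / s * (energy α v - lowEnergy α (Real.sqrt (3 / (4 * Real.pi ^ 2 * μ * s))) v)
      ≤ 2 * μ * ∫ ξ, dissipationDensity v ξ := by
  set ρ := Real.sqrt (3 / (4 * Real.pi ^ 2 * μ * s)) with hρ
  have hB : MeasurableSet (Metric.closedBall (0 : E3) ρ) := Metric.isClosed_closedBall.measurableSet
  have hi := hv.integrable_energyDensity (α := α)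
  have hd : Integrable (dissipationDensity v) := hv.integrable_freq_sq.const_mul _
  have e : energy α v - lowEnergy α ρ v = ∫ ξ in (Metric.closedBall (0 : E3) ρ)ᶜ, energyDensity α v ξ := by
    have := integral_add_compl hB hi
    unfold energy lowEnergy
    linarith
  rw [e, ← integral_const_mul, ← integral_const_mul]
  refine (setIntegral_mono_on (hi.const_mul _).integrableOn (hd.const_mul (2 * μ)).integrableOn
    hB.compl fun ξ hξ => ?_).trans (setIntegral_le_integral (hd.const_mul _)
      (Eventually.of_forall fun ξ => mul_nonneg (by positivity) (dissipationDensity_nonneg v ξ)))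
  have h1 : ρ < ‖ξ‖ := by simpa using hξ
  have h2 : 3 / (4 * Real.pi ^ 2 * μ * s) ≤ ‖ξ‖ ^ 2 := by
    have := (Real.sqrt_lt' ((Real.sqrt_nonneg _).trans_lt h1)).1 h1
    exact this.le
  rw [div_le_iff₀ (by positivity)] at h2
  rw [div_mul_eq_mul_div, div_le_iff₀ hs]
  unfold energyDensity dissipationDensity stressSymbol
  have hS : 0 ≤ ∑ i, ‖ftc v i ξ‖ ^ 2 := Finset.sum_nonneg fun i _ => by positivity
  -- The rate 2μ is split in two halves: the choice of `ρ` makes one dominate the L² part of the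
  -- energy, and 3α ≤ μs makes the other dominate the gradient part.
  have h3 : 3 * α * (4 * Real.pi ^ 2 * ‖ξ‖ ^ 2) ≤ μ * s * (4 * Real.pi ^ 2 * ‖ξ‖ ^ 2) := by gcongr
  have h4 : 3 * (1 + 4 * Real.pi ^ 2 * α * ‖ξ‖ ^ 2) ≤ 2 * μ * s * (4 * Real.pi ^ 2 * ‖ξ‖ ^ 2) := by
    linarith
  nlinarith [mul_le_mul_of_nonneg_right h4 hS]

/-- Algebraic decay of the energy when the initial low-frequency energy is `O(ρ^{2q})`. -/
theorem exists_energy_decay (hα : 0 < α) (hμ : 0 < μ) {q A₀ E₀ : ℝ} (hq : q ≤ 5 / 2)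
    (hA₀ : 0 ≤ A₀) (hE₀ : 0 ≤ E₀) :
    ∃ C : ℝ, 0 < C ∧ ∀ u u' : ℝ → L2V, IsEvolution α μ u u' → energy α (u 0) ≤ E₀ →
      (∀ ρ > 0, 2 * Real.pi * ρ ≤ 1 → lowEnergy α ρ (u 0) ≤ A₀ * (ρ ^ 2) ^ q) →
      ∀ t ≥ 0, energy α (u t) ≤ C * (t + 1) ^ (-q) := by
  -- The shift makes the splitting valid from t = 0: 3/μ keeps the radius within 2πρ ≤ 1, where the
  -- data are controlled, 3α/μ is the condition for high-frequency dissipation, and 1 is needed to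
  -- compare powers.
  set T₀ := max 1 (max (3 / μ) (3 * α / μ)) with hT₀
  have hT1 : 1 ≤ T₀ := le_max_left _ _
  have hT2 : 3 ≤ μ * T₀ := by
    have : 3 / μ ≤ T₀ := (le_max_left _ _).trans (le_max_right _ _)
    rwa [div_le_iff₀' hμ] at this
  have hT3 : 3 * α ≤ μ * T₀ := by
    have : 3 * α / μ ≤ T₀ := (le_max_right _ _).trans (le_max_right _ _)
    rwa [div_le_iff₀' hμ] at this
  set b := 3 / (4 * Real.pi ^ 2 * μ) with hb
  have hb0 : 0 < b := by positivity
  set K₀ := 4 * (16000 * (1 + α) * (1 + 1 / α) * Real.sqrt (Real.pi * 4 / 3)) ^ 2 with hK₀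
  have hK₀0 : 0 ≤ K₀ := by positivity
  obtain ⟨K, hK⟩ := exists_decay_constant (E₀ := E₀) (c₁ := 2 * A₀ * b ^ q)
    (c₂ := K₀ * b ^ (5 / 2 : ℝ)) hT1 (by positivity) (by positivity) hq
  refine ⟨|K| + E₀ + 1, by positivity, fun u u' h h0 hlow t ht => ?_⟩
  have hdis := h.isDissipative hα hμ
  have main := hK _ _ hdis h0 (fun τ hτ => ?_) t ht
  · have ht1 : 0 < t + 1 := by linarith
    have hpow : 0 ≤ (t + 1) ^ (-q) := Real.rpow_nonneg ht1.le _
    -- For q ≥ 0 the shift from t + T₀ to t + 1 only enlarges the power. For q < 0 the target power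
    -- is at least 1, and monotonicity of the energy suffices; the summand E₀ in the constant is for
    -- this case.
    rcases le_or_gt 0 q with hq0 | hq0
    · have h1 : (t + T₀) ^ (-q) ≤ (t + 1) ^ (-q) :=
        Real.rpow_le_rpow_of_nonpos ht1 (by linarith) (by linarith)
      have h2 : 0 ≤ (t + T₀) ^ (-q) := Real.rpow_nonneg (by linarith) _
      calc _ ≤ K * (t + T₀) ^ (-q) := main
        _ ≤ |K| * (t + T₀) ^ (-q) := by gcongr; exact le_abs_self K
        _ ≤ |K| * (t + 1) ^ (-q) := by gcongr
        _ ≤ _ := by gcongr; linarith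
    · have h1 : 1 ≤ (t + 1) ^ (-q) := Real.one_le_rpow (by linarith) (by linarith)
      have h2 := (hdis.le_of_le le_rfl ht).trans h0
      have h3 := abs_nonneg K
      nlinarith
  · set s := τ + T₀ with hs
    have hs0 : 0 < s := by linarith
    have hsT : μ * T₀ ≤ μ * s := by gcongr; linarith
    set ρ := Real.sqrt (3 / (4 * Real.pi ^ 2 * μ * s)) with hρ
    have hρ2 : ρ ^ 2 = b * s⁻¹ := by
      rw [hρ, Real.sq_sqrt (by positivity), hb]; field_simp
    have hρ0 : 0 < ρ := Real.sqrt_pos.2 (by positivity)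
    have hρπ : 2 * Real.pi * ρ ≤ 1 := by
      have : (2 * Real.pi * ρ) ^ 2 ≤ 1 := by
        rw [mul_pow, hρ, Real.sq_sqrt (by positivity)]
        have : (2 * Real.pi) ^ 2 * (3 / (4 * Real.pi ^ 2 * μ * s)) = 3 / (μ * s) := by
          field_simp; ring
        rw [this, div_le_one (by positivity)]
        linarith
      exact (sq_le_one_iff₀ (by positivity)).1 this
    have hρ1 : ρ ≤ 1 := by nlinarith [Real.pi_gt_three]
    have e1 : (ρ ^ 2) ^ q = b ^ q * s ^ (-q) := by
      rw [hρ2, Real.mul_rpow hb0.le (by positivity), Real.inv_rpow hs0.le, Real.rpow_neg hs0.le]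
    have e2 : ρ ^ 5 = b ^ (5 / 2 : ℝ) * s ^ (-(5 / 2 : ℝ)) := by
      rw [Real.rpow_neg hs0.le, ← Real.inv_rpow hs0.le, ← Real.mul_rpow hb0.le (by positivity),
        ← hρ2, ← Real.rpow_natCast ρ 2, ← Real.rpow_mul hρ0.le, ← Real.rpow_natCast ρ 5]
      norm_num
    have l1 := h.lowEnergy_le hα hμ hρ0 hρ1 hτ
    have l2 := hlow ρ hρ0 hρπ
    rw [e1] at l2
    rw [← hK₀, e2] at l1
    have l3 : lowEnergy α ρ (u τ) ≤ 2 * A₀ * b ^ q * s ^ (-q) + K₀ * b ^ (5 / 2 : ℝ)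
        * s ^ (-(5 / 2 : ℝ)) * (∫ τ in (0 : ℝ)..τ, energy α (u τ)) ^ 2 := by
      refine l1.trans ?_
      have := mul_le_mul_of_nonneg_left l2 zero_le_two
      linarith
    refine le_trans ?_ ((h.memH1 hα hτ).high_frequency_le hμ hs0 (hT3.trans hsT))
    gcongr

/-! ### Decay characters -/

theorem hat_eq (v : L2V) (i : Fin 3) (ξ : E3) : hat v i ξ = ftc v i ((2 * Real.pi)⁻¹ • ξ) := by
  unfold hat ftc
  rw [ft_eq (memLp_coord (Lp.memLp v) i)]
  have : (Complex.ofRealCLM ∘L (EuclideanSpace.proj i : E3 →L[ℝ] ℝ)).compLp v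
      = ((memLp_coord (Lp.memLp v) i).ofReal (K := ℂ)).toLp := by
    refine Lp.ext ?_
    filter_upwards [ContinuousLinearMap.coeFn_compLp
      (Complex.ofRealCLM ∘L (EuclideanSpace.proj i : E3 →L[ℝ] ℝ)) v,
      ((memLp_coord (Lp.memLp v) i).ofReal (K := ℂ)).coeFn_toLp] with x h1 h2
    rw [h1, h2]
    rfl
  rw [this]

theorem setLIntegral_smul_closedBall (f : E3 → ℝ≥0∞) {c : ℝ} (hc : 0 < c) (ρ : ℝ) :
    ∫⁻ ξ in Metric.closedBall (0 : E3) (c * ρ), f (c⁻¹ • ξ)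
      = ENNReal.ofReal (c ^ 3) * ∫⁻ η in Metric.closedBall (0 : E3) ρ, f η := by
  have hg : MeasurableEmbedding fun ξ : E3 => c⁻¹ • ξ :=
    (Homeomorph.smulOfNeZero c⁻¹ (inv_ne_zero hc.ne')).measurableEmbedding
  have hpre : (fun ξ : E3 => c⁻¹ • ξ) ⁻¹' Metric.closedBall 0 ρ = Metric.closedBall 0 (c * ρ) := by
    ext ξ
    simp only [mem_preimage, mem_closedBall_zero_iff, norm_smul, norm_inv,
      Real.norm_of_nonneg hc.le]
    rw [inv_mul_le_iff₀ hc]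
  have hmap := Measure.map_addHaar_smul (volume : Measure E3) (inv_ne_zero hc.ne')
  rw [← hpre, ← hg.lintegral_map, ← hg.restrict_map, hmap, Measure.restrict_smul,
    lintegral_smul_measure, finrank_euclideanSpace_fin, inv_pow, inv_inv,
    abs_of_nonneg (by positivity), smul_eq_mul]

theorem lintegral_hat_eq (v : L2V) (ρ : ℝ) :
    ∫⁻ ξ in Metric.closedBall (0 : E3) (2 * Real.pi * ρ), ∑ i, ‖hat v i ξ‖ₑ ^ 2
      = ENNReal.ofReal ((2 * Real.pi) ^ 3) *
        ∫⁻ η in Metric.closedBall (0 : E3) ρ, ∑ i, ‖ftc v i η‖ₑ ^ 2 := by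
  rw [← setLIntegral_smul_closedBall _ (by positivity)]
  simp only [hat_eq]

theorem ofReal_sum_normSq (v : E3 → E3) (ξ : E3) :
    ∑ i, ‖ftc v i ξ‖ₑ ^ 2 = ENNReal.ofReal (∑ i, ‖ftc v i ξ‖ ^ 2) := by
  rw [ENNReal.ofReal_sum_of_nonneg fun i _ => by positivity]
  refine Finset.sum_congr rfl fun i _ => ?_
  rw [ENNReal.ofReal_pow (norm_nonneg _), ofReal_norm]

theorem setLIntegral_ftc_lt_top (v : E3 → E3) (s : Set E3) :
    ∫⁻ η in s, ∑ i, ‖ftc v i η‖ₑ ^ 2 < ⊤ := by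
  have hi : Integrable fun ξ => ∑ i, ‖ftc v i ξ‖ ^ 2 :=
    integrable_finsetSum Finset.univ fun i _ => integrable_ftc_sq v i
  simp only [ofReal_sum_normSq]
  exact (setLIntegral_le_lintegral _ _).trans_lt hi.lintegral_lt_top

theorem setLIntegral_hat_lt_top (v : L2V) (ρ : ℝ) :
    ∫⁻ ξ in Metric.closedBall (0 : E3) ρ, ∑ i, ‖hat v i ξ‖ₑ ^ 2 < ⊤ := by
  have e : ρ = 2 * Real.pi * ((2 * Real.pi)⁻¹ * ρ) := by
    field_simp
  rw [e, lintegral_hat_eq]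
  exact ENNReal.mul_lt_top ENNReal.ofReal_lt_top (setLIntegral_ftc_lt_top v _)

theorem decaySup_mono (v : L2V) {r r' : ℝ} (h : r ≤ r') : decaySup r v ≤ decaySup r' v := by
  refine iSup₂_mono fun ρ hρ => mul_le_mul_left (ENNReal.ofReal_le_ofReal ?_) _
  exact Real.rpow_le_rpow_of_exponent_ge hρ.1 hρ.2 (by linarith)

/-- The finite limsup controls radii below some δ. On [δ, 1] the power of ρ is bounded and the
integral is at most its finite value on the unit ball. -/
theorem decaySup_lt_top {v : L2V} {r : ℝ} (h : upperDecayIndicator r v < ⊤) : decaySup r v < ⊤ := by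
  obtain ⟨c, hc1, hc2⟩ := exists_between h
  have hev := eventually_lt_of_limsup_lt hc1
  obtain ⟨δ, hδ, hδ2⟩ := mem_nhdsGT_iff_exists_Ioo_subset.1 hev
  have hδ0 : 0 < δ := hδ
  set J := ∫⁻ ξ in Metric.closedBall (0 : E3) 1, ∑ i, ‖hat v i ξ‖ₑ ^ 2 with hJ
  set M := ENNReal.ofReal (max (δ ^ (-2 * r - 3)) 1) * J with hM
  have hMt : M < ⊤ := ENNReal.mul_lt_top ENNReal.ofReal_lt_top (setLIntegral_hat_lt_top v 1)
  refine lt_of_le_of_lt (iSup₂_le fun ρ hρ => ?_) (max_lt hc2 hMt)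
  rcases lt_or_ge ρ δ with h1 | h1
  · exact le_max_of_le_left (hδ2 ⟨hρ.1, h1⟩ : _ < _).le
  · refine le_max_of_le_right ?_
    refine mul_le_mul' (ENNReal.ofReal_le_ofReal ?_)
      (lintegral_mono_set (Metric.closedBall_subset_closedBall hρ.2))
    rcases le_or_gt 0 (-2 * r - 3) with h2 | h2
    · exact le_max_of_le_right (Real.rpow_le_one hρ.1.le hρ.2 h2)
    · exact le_max_of_le_left (Real.rpow_le_rpow_of_nonpos hδ0 h1 h2.le)

/-- The two Fourier normalisations differ by the dilation 2π, so radius ρ here corresponds to 2πρ in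
`decaySup`, which must not exceed 1. The Jacobian (2π)³ ≥ 1 helps and is discarded, while 1 + 4π²α
bounds the symbol of 1 - αΔ on the ball. -/
theorem lowEnergy_le_of_decaySup (hα : 0 ≤ α) {v : L2V} {r : ℝ} (h : decaySup r v ≠ ⊤) {ρ : ℝ}
    (hρ : 0 < ρ) (hρ1 : 2 * Real.pi * ρ ≤ 1) :
    lowEnergy α ρ v ≤ (1 + 4 * Real.pi ^ 2 * α) * (decaySup r v).toReal *
      ((2 * Real.pi) ^ 2) ^ (3 / 2 + r) * (ρ ^ 2) ^ (3 / 2 + r) := by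
  have hπ : 0 < 2 * Real.pi := by positivity
  set x := 2 * Real.pi * ρ with hx
  have hx0 : 0 < x := by positivity
  have hρ' : ρ ≤ 1 := by nlinarith [Real.pi_gt_three]
  set A := decaySup r v with hA
  have h1 : decayQuotient r v x ≤ A :=
    le_iSup₂ (f := fun ρ (_ : ρ ∈ Ioc (0 : ℝ) 1) => decayQuotient r v ρ) x ⟨hx0, hρ1⟩
  have hi : Integrable fun ξ => ∑ i, ‖ftc v i ξ‖ ^ 2 :=
    integrable_finsetSum Finset.univ fun i _ => integrable_ftc_sq v i
  set S := ∫ ξ in Metric.closedBall (0 : E3) ρ, ∑ i, ‖ftc v i ξ‖ ^ 2 with hS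
  have hS0 : 0 ≤ S := integral_nonneg fun ξ => Finset.sum_nonneg fun i _ => by positivity
  have hSe : ∫⁻ η in Metric.closedBall (0 : E3) ρ, ∑ i, ‖ftc v i η‖ₑ ^ 2 = ENNReal.ofReal S := by
    simp only [ofReal_sum_normSq]
    exact (ofReal_integral_eq_lintegral_ofReal hi.integrableOn (Eventually.of_forall fun ξ =>
      Finset.sum_nonneg fun i _ => by positivity)).symm
  unfold decayQuotient at h1
  rw [hx, lintegral_hat_eq, hSe, ← hx, ← ENNReal.ofReal_mul (by positivity),
    ← ENNReal.ofReal_mul (by positivity), ENNReal.ofReal_le_iff_le_toReal h] at h1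
  have h2 : x ^ (-2 * r - 3) * S ≤ A.toReal := by
    refine le_trans ?_ h1
    have : 1 ≤ (2 * Real.pi) ^ 3 := one_le_pow₀ (by linarith [Real.pi_gt_three])
    gcongr
    exact le_mul_of_one_le_left hS0 this
  have h3 : S ≤ A.toReal * (x ^ 2) ^ (3 / 2 + r) := by
    have e : (x ^ 2) ^ (3 / 2 + r) * x ^ (-2 * r - 3) = 1 := by
      rw [← Real.rpow_natCast x 2, ← Real.rpow_mul hx0.le, ← Real.rpow_add hx0]
      have : ((2 : ℕ) : ℝ) * (3 / 2 + r) + (-2 * r - 3) = 0 := by push_cast; ring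
      rw [this, Real.rpow_zero]
    calc S = (x ^ 2) ^ (3 / 2 + r) * (x ^ (-2 * r - 3) * S) := by rw [← mul_assoc, e, one_mul]
      _ ≤ (x ^ 2) ^ (3 / 2 + r) * A.toReal := by gcongr
      _ = _ := mul_comm _ _
  have h4 : lowEnergy α ρ v ≤ (1 + 4 * Real.pi ^ 2 * α) * S := by
    rw [hS, ← integral_const_mul]
    refine setIntegral_mono_on (integrableOn_energyDensity hα v ρ) (hi.const_mul _).integrableOn
      Metric.isClosed_closedBall.measurableSet fun ξ hξ => ?_
    refine mul_le_mul_of_nonneg_right ?_ (Finset.sum_nonneg fun i _ => by positivity)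
    refine (stressSymbol_le hα hξ).trans ?_
    have : ρ ^ 2 ≤ 1 := pow_le_one₀ hρ.le hρ'
    have := mul_le_mul_of_nonneg_left this (by positivity : 0 ≤ 4 * Real.pi ^ 2 * α)
    linarith
  refine h4.trans ?_
  rw [hx, mul_pow, Real.mul_rpow (by positivity) (by positivity)] at h3
  have := mul_le_mul_of_nonneg_left h3 (by positivity : 0 ≤ 1 + 4 * Real.pi ^ 2 * α)
  linarith

theorem truncOne_coe (r : ℝ) : truncOne r = min r 1 := by
  unfold truncOne
  rw [← EReal.coe_one, ← EReal.coe_strictMono.monotone.map_min, EReal.toReal_coe]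

theorem truncOne_le_one {r : EReal} (h : r ≠ ⊥) : truncOne r ≤ 1 := by
  induction r with
  | bot => exact absurd rfl h
  | top => simp [truncOne]
  | coe r => rw [truncOne_coe]; exact min_le_right _ _

theorem truncOne_of_one_lt {r : EReal} (h : 1 < r) : truncOne r = 1 := by
  unfold truncOne
  rw [min_eq_right h.le, EReal.toReal_one]

theorem decayRate_eq {r : EReal} (h : r ≠ ⊥) : decayRate r = 3 / 2 + truncOne r := by
  induction r with
  | bot => exact absurd rfl h
  | top => simp [decayRate, truncOne]; norm_num
  | coe r =>
    rw [truncOne_coe, decayRate, ← EReal.coe_add, ← EReal.coe_strictMono.monotone.map_min, EReal.toReal_coe,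
      show (5 / 2 : ℝ) = 3 / 2 + 1 by norm_num, min_add_add_left]

theorem decaySup_truncOne_lt_top_of_lt {v : L2V} {r : ℝ} (h : (r : EReal) < upperDecayCharacter v) :
    decaySup (truncOne r) v < ⊤ := by
  obtain ⟨-, ⟨r', hr', rfl⟩, hlt⟩ := lt_sSup_iff.1 h
  refine (decaySup_mono v ?_).trans_lt (decaySup_lt_top hr')
  rw [truncOne_coe]
  exact (min_le_left _ _).trans (EReal.coe_lt_coe_iff.1 hlt).le

/-- Uniform decay under a bound on the low frequencies of the initial value. -/
theorem exists_weakSolution_decay (hα : 0 < α) (hμ : 0 < μ) (r : EReal) (N : ℝ) (A : ℝ≥0∞) :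
    ∃ C : ℝ, 0 < C ∧ (r ≠ ⊥ → A ≠ ⊤ → ∀ u₀ : L2V, MemV2 α u₀ → normV2 α u₀ = N →
      decaySup (truncOne r) u₀ = A → ∀ u : ℝ → L2V, IsWeakSolution α μ u₀ u →
      ∀ t ≥ 0, sqNormH1 α (u t) ≤ C * (t + 1) ^ (-decayRate r)) := by
  -- The conditions on r and A stand after the constant so that choice yields one total function of
  -- (r, N, A). For r = ⊥ any positive value will do.
  by_cases hr : r = ⊥
  · exact ⟨1, one_pos, fun h => absurd hr h⟩
  have hr1 := truncOne_le_one hr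
  obtain ⟨C, hC, hdecay⟩ := exists_energy_decay hα hμ (q := 3 / 2 + truncOne r)
    (A₀ := (1 + 4 * Real.pi ^ 2 * α) * A.toReal * ((2 * Real.pi) ^ 2) ^ (3 / 2 + truncOne r))
    (E₀ := N ^ 2) (by linarith) (by positivity) (sq_nonneg N)
  refine ⟨C, hC, fun _ hA u₀ h0 hN hS u hu t ht => ?_⟩
  obtain ⟨rfl, u', hev⟩ := hu.exists_isEvolution hα h0
  rw [(hev.memH1 hα ht).sqNormH1_eq, decayRate_eq hr]
  refine hdecay u u' hev ?_ (fun ρ hρ hρ1 => ?_) t ht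
  · have := sqNormH1_le_normV2_sq hα.le (u 0)
    rwa [hN, h0.1.1.sqNormH1_eq] at this
  · have := lowEnergy_le_of_decaySup hα.le (by rwa [hS] : decaySup (truncOne r) (u 0) ≠ ⊤) hρ hρ1
    rwa [hS] at this

end

end

end SecondGradeFluid

/-! ### Assembly of the theorem. -/

open SecondGradeFluid
theorem theorem1 (α μ : ℝ) (hα : 0 < α) (hμ : 0 < μ) :
    ∃ ε : ℝ, 0 < ε ∧
    ∃ C : EReal → ℝ → ℝ≥0∞ → ℝ, (∀ r N A, 0 < C r N A) ∧
    ∀ u₀ : L2V, MemV2 α u₀ → normV2 α u₀ < ε →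
    ∀ u : ℝ → L2V, IsWeakSolution α μ u₀ u →
      -- the solution stays in `H¹`, so that its `H¹_α` norm is meaningful at every time
      (∀ t ≥ 0, MemH1 (u t)) ∧
      -- the decay with the rate given by `r*₊`, when `r*₊ > 1` or the supremum `r*₊` is attained
      ((1 < upperDecayCharacter u₀ ∨
          ∃ r : ℝ, upperDecayCharacter u₀ = r ∧ upperDecayIndicator r u₀ < ⊤) →
        ∀ t ≥ 0, sqNormH1 α (u t) ≤
          C (upperDecayCharacter u₀) (normV2 α u₀)
              (decaySup (truncOne (upperDecayCharacter u₀)) u₀)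
            * (t + 1) ^ (-decayRate (upperDecayCharacter u₀))) ∧
      -- without that proviso, the decay with the rate given by any `r < r*₊`
      (∀ r : ℝ, (r : EReal) < upperDecayCharacter u₀ →
        ∀ t ≥ 0, sqNormH1 α (u t) ≤
          C r (normV2 α u₀) (decaySup (truncOne r) u₀) * (t + 1) ^ (-decayRate r)) := by
  choose C hC hdecay using exists_weakSolution_decay hα hμ
  refine ⟨1, one_pos, C, hC, fun u₀ h0 _ u hu => ⟨fun t ht => ?_, fun h t ht => ?_,
    fun r hr t ht => ?_⟩⟩
  · obtain ⟨-, u', hev⟩ := hu.exists_isEvolution hα h0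
    exact hev.memH1 hα ht
  · rcases h with h | ⟨r, hr, hfin⟩
    -- Above 1 the rate is capped, so only the indicator at exponent 1 is needed. It is controlled
    -- because 1 lies strictly below the supremum, even when that supremum is infinite or not
    -- attained.
    · have h1 := decaySup_truncOne_lt_top_of_lt (r := 1) (by simpa using h)
      refine hdecay _ _ _ (bot_lt_iff_ne_bot.1 (bot_le.trans_lt h)) ?_ u₀ h0 rfl rfl u hu t ht
      rw [truncOne_of_one_lt h]
      rw [truncOne_coe, min_self] at h1
      exact h1.ne
    · refine hdecay _ _ _ (by rw [hr]; exact EReal.coe_ne_bot r) ?_ u₀ h0 rfl rfl u hu t ht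
      rw [hr, truncOne_coe]
      exact ((decaySup_mono u₀ (min_le_left _ _)).trans_lt (decaySup_lt_top hfin)).ne
  · exact hdecay _ _ _ (EReal.coe_ne_bot r) (decaySup_truncOne_lt_top_of_lt hr).ne u₀ h0 rfl rfl
      u hu t ht
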